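/- Let $\mathbb{R}^{n+2}_1$ be the Minkowski spacetime with inner product $\langle x,y\rangle=-x_0y_0+\sum_{i=1}^{n+1}x_iy_i$, and let $\Lambda^{n+1}=\{x\in\mathbb{R}^{n+2}_1 : \langle x,x\rangle=0\}$ be the light-cone. **Setting.** Let $(M^n,g)$, $n\ge 2$, be an oriented conformally flat smooth Riemannian manifold (Hausdorff, second countable, without boundary), and let $p:M^n\to\Lambda^{n+1}$ be a smooth isometric immersion, that is, $\langle dp(v),dp(w)\rangle=g(v,w)$ for all tangent vectors $v,w$ at the same point. The *dual map* of $p$ is the unique map $q:M^n\to\Lambda^{n+1}$ with $\langle p,q\rangle=1$ and $\langle dp(v),q\rangle=0$ for all tangent vectors $v$. The *null-space* of $p$ is $N^{n+1}=\mathbb{R}\times M^n$ with the degenerate metric $g_N=\Phi^*\langle\ ,\ \rangle$, where $\Phi(t,x)=p(x)+t\,q(x)$. **Variations.** A *compactly supported variation of $p$ in $N^{n+1}$* is a smooth map $G:(-\varepsilon,\varepsilon)\times M^n\to N^{n+1}$, $\varepsilon>0$, such that $G(0,x)=(0,x)$ for all $x$, such that $g_t:=G(t,\cdot)^*g_N$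 is positive definite for each $t$, and such that, for some compact $K\subset M^n$, $G(t,x)=(0,x)$ for all $t$ and all $x\notin K$. For each such $K$ put $\mathrm{Vol}_K(t)=\int_K dV_{g_t}$. (Enlarging $K$ changes $\mathrm{Vol}_K$ only by a constant.) The first and second variations of volume are $\frac{d}{dt}\big|_{t=0}\mathrm{Vol}_K(t)$ and $\frac{d^2}{dt^2}\big|_{t=0}\mathrm{Vol}_K(t)$. **Theorem.** The map $\iota:x\mapsto(0,x)$ is a smooth embedding of $M^n$ into $N^{n+1}$ with $\Phi\circ\iota=p$ and $\iota^*g_N=g$. Moreover, the following two statements are equivalent. (a) The scalar curvature $S$ of $(M^n,g)$ is identically zero. (b) For every compactly supported variation of $p$ in $N^{n+1}$ and every $K$ as above, the first variation exists and is zero. If (a) or (b) holds, then for every compactly supported variation of $p$ in $N^{n+1}$ and every $K$ as above, the function $\mathrm{Vol}_K$ is differentiable near $t=0$ and twice differentiable at $t=0$, and the second variation is nonpositive. -/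

import Mathlib

open Set Topology MeasureTheory
open scoped Manifold ContDiff Bundle ENNReal

noncomputable section

namespace NullSpace

/-! ### Minkowski spacetime and the light-cone -/

/-- The vector space underlying the `(n + 2)`-dimensional Minkowski spacetime. -/
abbrev Minkowski (n : ℕ) : Type := EuclideanSpace ℝ (Fin (n + 2))

/-- The Lorentzian inner product of signature `(- + ⋯ +)`. -/
def lorentz {n : ℕ} (v w : Minkowski n) : ℝ :=
  -(v 0 * w 0) + ∑ i : Fin (n + 1), v i.succ * w i.succ

/-- The light-cone `{x ; ⟨x, x⟩ = 0}` (the origin included). -/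
def lightCone (n : ℕ) : Set (Minkowski n) := {v | lorentz v v = 0}

/-! ### Fields of bilinear forms on a manifold, and pullbacks -/

section Forms

variable {E H M E' H' M' : Type*}
  [NormedAddCommGroup E] [NormedSpace ℝ E] [TopologicalSpace H]
  [TopologicalSpace M] [ChartedSpace H M]
  [NormedAddCommGroup E'] [NormedSpace ℝ E'] [TopologicalSpace H']
  [TopologicalSpace M'] [ChartedSpace H' M']

/-- A field assigning to each point `x` a two-variable function on the tangent space at `x`
(a Riemannian metric, or a possibly degenerate pulled back metric). -/
abbrev FormField (I : ModelWithCorners ℝ E H) (M : Type*) [TopologicalSpace M]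
    [ChartedSpace H M] : Type _ :=
  ∀ x : M, TangentSpace I x → TangentSpace I x → ℝ

/-- The pullback `f^* h`, that is `(f^* h)_x(v, w) = h_{f x}(df v, df w)`. -/
def pullbackForm (I : ModelWithCorners ℝ E H) (I' : ModelWithCorners ℝ E' H')
    (f : M → M') (h : FormField I' M') : FormField I M :=
  fun x v w => h (f x) (mfderiv I I' f x v) (mfderiv I I' f x w)

end Forms

/-- The Minkowski metric, on each tangent space of the spacetime. -/
def minkowskiForm (n : ℕ) : FormField 𝓘(ℝ, Minkowski n) (Minkowski n) :=
  fun _ v w => lorentz (n := n) v w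

/-! ### Riemannian geometry in charts -/

section Riemannian

variable {n : ℕ} {M : Type*} [TopologicalSpace M] [ChartedSpace (EuclideanSpace ℝ (Fin n)) M]

/-- Smooth Riemannian metrics on the `n`-dimensional manifold `M`. -/
abbrev SmoothMetric (n : ℕ) (M : Type*) [TopologicalSpace M]
    [ChartedSpace (EuclideanSpace ℝ (Fin n)) M] [IsManifold (𝓡 n) ∞ M] : Type _ :=
  Bundle.ContMDiffRiemannianMetric (𝓡 n) ∞ (EuclideanSpace ℝ (Fin n))
    (fun x : M => TangentSpace (𝓡 n) x)

/-- A Riemannian metric regarded as a field of bilinear forms. -/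
def SmoothMetric.form [IsManifold (𝓡 n) ∞ M] (g : SmoothMetric n M) : FormField (𝓡 n) M :=
  fun x v w => g.inner x v w

/-- The `i`-th standard basis vector of `ℝⁿ`. -/
def stdVec {n : ℕ} (i : Fin n) : EuclideanSpace ℝ (Fin n) := EuclideanSpace.single i 1

/-- The components `h_{ij} = h(∂_i, ∂_j)` in the chart `e`, as functions on `e.target ⊆ ℝⁿ`. -/
def chartMatrix (h : FormField (𝓡 n) M)
    (e : OpenPartialHomeomorph M (EuclideanSpace ℝ (Fin n))) (y : EuclideanSpace ℝ (Fin n)) :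
    Matrix (Fin n) (Fin n) ℝ :=
  Matrix.of fun i j =>
    h (e.symm y) (mfderiv (𝓡 n) (𝓡 n) e.symm y (stdVec i)) (mfderiv (𝓡 n) (𝓡 n) e.symm y (stdVec j))

/-- The partial derivative `∂_i f` at `y`. -/
def partialDeriv (i : Fin n) (f : EuclideanSpace ℝ (Fin n) → ℝ)
    (y : EuclideanSpace ℝ (Fin n)) : ℝ :=
  fderiv ℝ f y (stdVec i)

/-- The Christoffel symbol
`Γ^k_{ij} = ½ ∑_l G^{kl} (∂_i G_{jl} + ∂_j G_{il} - ∂_l G_{ij})` of a metric `G` in coordinates. -/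
def christoffel (G : EuclideanSpace ℝ (Fin n) → Matrix (Fin n) (Fin n) ℝ) (k i j : Fin n)
    (y : EuclideanSpace ℝ (Fin n)) : ℝ :=
  (1 / 2) * ∑ l, (G y)⁻¹ k l *
    (partialDeriv i (fun z => G z j l) y + partialDeriv j (fun z => G z i l) y
      - partialDeriv l (fun z => G z i j) y)

/-- The component `R^l_{kij}` of the curvature tensor
`R(X,Y)Z = ∇_X ∇_Y Z - ∇_Y ∇_X Z - ∇_{[X,Y]} Z`, i.e. `R(∂_i, ∂_j) ∂_k = ∑_l R^l_{kij} ∂_l`. -/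
def curvature (G : EuclideanSpace ℝ (Fin n) → Matrix (Fin n) (Fin n) ℝ) (l k i j : Fin n)
    (y : EuclideanSpace ℝ (Fin n)) : ℝ :=
  partialDeriv i (christoffel G l j k) y - partialDeriv j (christoffel G l i k) y
    + ∑ m, (christoffel G l i m y * christoffel G m j k y
      - christoffel G l j m y * christoffel G m i k y)

/-- The Ricci component `Ric(∂_j, ∂_k)`, the trace of `X ↦ R(X, ∂_j) ∂_k`. -/
def ricci (G : EuclideanSpace ℝ (Fin n) → Matrix (Fin n) (Fin n) ℝ) (j k : Fin n)
    (y : EuclideanSpace ℝ (Fin n)) : ℝ :=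
  ∑ i, curvature G i k i j y

/-- The scalar curvature of `h` at `x`, computed in the preferred chart at `x`
(its value does not depend on the chart). -/
def scalarCurvature (h : FormField (𝓡 n) M) (x : M) : ℝ :=
  let e := chartAt (EuclideanSpace ℝ (Fin n)) x
  let G := chartMatrix h e
  ∑ j, ∑ k, (G (e x))⁻¹ j k * ricci G j k (e x)

/-- `(M, g)` is conformally flat: near each point there is a smooth chart in which
`g = e^{2u} ∑ (dx^i)²` for a smooth function `u`. -/
def IsConformallyFlat [IsManifold (𝓡 n) ∞ M] (g : SmoothMetric n M) : Prop :=
  ∀ x : M, ∃ e ∈ IsManifold.maximalAtlas (𝓡 n) ∞ M, x ∈ e.source ∧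
    ∃ u : EuclideanSpace ℝ (Fin n) → ℝ, ContDiffOn ℝ ∞ u e.target ∧
      ∀ y ∈ e.target, chartMatrix g.form e y = Real.exp (2 * u y) • (1 : Matrix (Fin n) (Fin n) ℝ)

/-- An orientation of `M`, given by an atlas of smooth charts whose transition maps have
positive Jacobian determinant. -/
structure OrientedAtlas (n : ℕ) (M : Type*) [TopologicalSpace M]
    [ChartedSpace (EuclideanSpace ℝ (Fin n)) M] where
  charts : Set (OpenPartialHomeomorph M (EuclideanSpace ℝ (Fin n)))
  smooth : charts ⊆ IsManifold.maximalAtlas (𝓡 n) ∞ M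
  cover : ∀ x : M, ∃ e ∈ charts, x ∈ e.source
  positive : ∀ e ∈ charts, ∀ e' ∈ charts, ∀ y ∈ (e.symm.trans e').source,
    0 < (fderiv ℝ (e.symm.trans e') y).det

/-- The volume measure of `M` for the metric `h`: the smallest measure that dominates, for every
preferred chart `e`, the measure `√(det h_{ij}) dx¹ ⋯ dxⁿ` on the domain of `e`. When `h` is a
Riemannian metric these local measures agree on overlaps, so this is the measure that restricts to
each of them. -/
def volumeMeasure [MeasurableSpace M] (h : FormField (𝓡 n) M) : Measure M :=
  ⨆ x : M,
    let e := chartAt (EuclideanSpace ℝ (Fin n)) x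
    (((volume : Measure (EuclideanSpace ℝ (Fin n))).restrict e.target).withDensity
      (fun y => ENNReal.ofReal (Real.sqrt (chartMatrix h e y).det))).map e.symm

/-- The volume of the subset `K` of `M` for the metric `h`. -/
def vol [MeasurableSpace M] (h : FormField (𝓡 n) M) (K : Set M) : ℝ :=
  (volumeMeasure h K).toReal

end Riemannian

/-! ### Hypersurfaces in the light-cone and their dual maps -/

section Hypersurface

variable {n : ℕ} {M : Type*} [TopologicalSpace M] [ChartedSpace (EuclideanSpace ℝ (Fin n)) M]

/-- `p` is an isometric immersion of `(M, g)` into the light-cone. (The differential is injective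
because it preserves the positive definite inner products `g`.) -/
structure IsIsometricImmersion [IsManifold (𝓡 n) ∞ M] (g : SmoothMetric n M)
    (p : M → Minkowski n) : Prop where
  smooth : ContMDiff (𝓡 n) 𝓘(ℝ, Minkowski n) ∞ p
  mem_lightCone : ∀ x, p x ∈ lightCone n
  isometric : pullbackForm (𝓡 n) 𝓘(ℝ, Minkowski n) p (minkowskiForm n) = g.form

/-- `w` is a null vector with `⟨p x, w⟩ = 1` that is orthogonal to `dp(T_x M)`. -/
structure IsDualVector (p : M → Minkowski n) (x : M) (w : Minkowski n) : Prop where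
  mem_lightCone : w ∈ lightCone n
  inner_self : lorentz (p x) w = 1
  inner_tangent : ∀ v : TangentSpace (𝓡 n) x,
    lorentz (n := n) (mfderiv (𝓡 n) 𝓘(ℝ, Minkowski n) p x v) w = 0

/-- The dual map of `p`, with value at `x` the unique dual vector of `p` at `x`. -/
def dualMap (p : M → Minkowski n) (x : M) : Minkowski n :=
  Classical.epsilon (IsDualVector p x)

/-- The extended ruled map `(t, x) ↦ p(x) + t q(x)`, with `q` the dual map of `p`. -/
def ruledMap (p : M → Minkowski n) : ℝ × M → Minkowski n :=
  fun z => p z.2 + z.1 • dualMap p z.2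

/-- The (degenerate) metric of the null-space `ℝ × M`: the pullback of the Minkowski metric under
the extended ruled map. -/
def nullForm (p : M → Minkowski n) : FormField (𝓘(ℝ, ℝ).prod (𝓡 n)) (ℝ × M) :=
  pullbackForm (𝓘(ℝ, ℝ).prod (𝓡 n)) 𝓘(ℝ, Minkowski n) (ruledMap p) (minkowskiForm n)

/-- The metric `g_t` induced on `M` by the map `f : M → ℝ × M` into the null-space of `p`. -/
def inducedForm (p : M → Minkowski n) (f : M → ℝ × M) : FormField (𝓡 n) M :=
  pullbackForm (𝓡 n) (𝓘(ℝ, ℝ).prod (𝓡 n)) f (nullForm p)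

/-- `G`, defined for parameters `t ∈ (-ε, ε)`, is a variation of `p` in its null-space `ℝ × M`,
i.e. of `x ↦ (0, x)`, through spacelike immersions, and it is constant outside the compact
set `K`. -/
structure IsVariation (p : M → Minkowski n) (ε : ℝ) (K : Set M) (G : ℝ → M → ℝ × M) :
    Prop where
  eps_pos : 0 < ε
  smooth : ContMDiffOn (𝓘(ℝ, ℝ).prod (𝓡 n)) (𝓘(ℝ, ℝ).prod (𝓡 n)) ∞
    (fun z : ℝ × M => G z.1 z.2) (Ioo (-ε) ε ×ˢ univ)
  spacelike : ∀ t ∈ Ioo (-ε) ε, ∀ (x : M) (v : TangentSpace (𝓡 n) x), v ≠ 0 →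
    0 < inducedForm p (G t) x v v
  initial : ∀ x, G 0 x = (0, x)
  isCompact : IsCompact K
  support : ∀ t ∈ Ioo (-ε) ε, ∀ x ∉ K, G t x = (0, x)

/-- The volume of the part `K` of `M` for the metric induced by `G t`. For a variation with support
in the compact set `K`, changing `K` changes this function near `t = 0` by a constant only. -/
def volumeFunction [MeasurableSpace M] (p : M → Minkowski n) (K : Set M)
    (G : ℝ → M → ℝ × M) (t : ℝ) : ℝ :=
  vol (inducedForm p (G t)) K

end Hypersurface

/-! ### Existence and uniqueness of the dual map -/

section Dual

variable {n : ℕ}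

theorem lorentz_comm (v w : Minkowski n) : lorentz v w = lorentz w v := by
  simp only [lorentz, mul_comm]

theorem lorentz_add_left (u v w : Minkowski n) :
    lorentz (u + v) w = lorentz u w + lorentz v w := by
  simp only [lorentz, PiLp.add_apply, add_mul, Finset.sum_add_distrib]
  ring

theorem lorentz_smul_left (c : ℝ) (v w : Minkowski n) :
    lorentz (c • v) w = c * lorentz v w := by
  simp only [lorentz, PiLp.smul_apply, smul_eq_mul, mul_assoc, Finset.mul_sum, mul_add, mul_neg]

theorem lorentz_add_right (u v w : Minkowski n) :
    lorentz u (v + w) = lorentz u v + lorentz u w := by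
  rw [lorentz_comm, lorentz_add_left, lorentz_comm v, lorentz_comm w]

theorem lorentz_smul_right (c : ℝ) (v w : Minkowski n) :
    lorentz v (c • w) = c * lorentz v w := by
  rw [lorentz_comm, lorentz_smul_left, lorentz_comm w]

theorem lorentz_zero_left (w : Minkowski n) : lorentz (0 : Minkowski n) w = 0 := by
  simp [lorentz]

theorem continuous_lorentz_self : Continuous fun v : Minkowski n => lorentz v v := by
  unfold lorentz
  fun_prop

/-- Every linear functional is `⟨w, ·⟩` for some `w`. -/
theorem exists_lorentz_eq (φ : Minkowski n →ₗ[ℝ] ℝ) :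
    ∃ w : Minkowski n, ∀ v, lorentz v w = φ v := by
  refine ⟨WithLp.toLp 2 (Fin.cons (-φ (EuclideanSpace.single 0 1))
    fun i => φ (EuclideanSpace.single i.succ 1)), fun v => ?_⟩
  have hv : v = ∑ i, v i • (EuclideanSpace.single i (1 : ℝ) : Minkowski n) := by
    ext j
    simp [Finset.sum_apply, Pi.single_apply]
  conv_rhs => rw [hv]
  rw [map_sum, Fin.sum_univ_succ]
  simp [lorentz]

/-- Linear algebra behind the dual map: a spacelike `n`-dimensional subspace and a nonzero null
vector orthogonal to it determine a unique dual null vector. -/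
theorem existsUnique_dual_linear (D : EuclideanSpace ℝ (Fin n) →ₗ[ℝ] Minkowski n)
    (P : Minkowski n) (hD : ∀ v, v ≠ 0 → 0 < lorentz (D v) (D v)) (hP : lorentz P P = 0)
    (hP0 : P ≠ 0) (hPD : ∀ v, lorentz (D v) P = 0) :
    ∃! w : Minkowski n, lorentz w w = 0 ∧ lorentz P w = 1 ∧ ∀ v, lorentz (D v) w = 0 := by
  have hDz : ∀ v, lorentz (D v) (D v) = 0 → v = 0 := fun v h => by
    by_contra hv
    exact (hD v hv).ne' h
  let T : EuclideanSpace ℝ (Fin n) × ℝ →ₗ[ℝ] Minkowski n :=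
    D.coprod (LinearMap.toSpanSingleton ℝ _ P)
  have hT : ∀ v a, T (v, a) = D v + a • P := fun v a => by simp [T]
  have hTinj : LinearMap.ker T = ⊥ := by
    rw [LinearMap.ker_eq_bot']
    rintro ⟨v, a⟩ h
    rw [hT] at h
    have h1 : lorentz (D v + a • P) (D v) = 0 := by rw [h, lorentz_zero_left]
    rw [lorentz_add_left, lorentz_smul_left, lorentz_comm P, hPD, mul_zero, add_zero] at h1
    have hv := hDz v h1
    subst hv
    simp only [map_zero, zero_add, smul_eq_zero, hP0, or_false] at h
    simp [h]
  obtain ⟨r, hr⟩ := T.exists_leftInverse_of_injective hTinj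
  obtain ⟨w, hw⟩ := exists_lorentz_eq ((LinearMap.snd ℝ _ ℝ).comp r)
  have hrT : ∀ v a, r (D v + a • P) = (v, a) := fun v a => by
    rw [← hT]
    exact LinearMap.congr_fun hr (v, a)
  have hPw : lorentz P w = 1 := by
    have := hrT 0 1
    simp only [map_zero, zero_add, one_smul] at this
    rw [hw]
    simp [this]
  have hDw : ∀ v, lorentz (D v) w = 0 := fun v => by
    have := hrT v 0
    simp only [zero_smul, add_zero] at this
    rw [hw]
    simp [this]
  obtain ⟨q, hqq, hPq, hDq⟩ : ∃ q : Minkowski n,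
      lorentz q q = 0 ∧ lorentz P q = 1 ∧ ∀ v, lorentz (D v) q = 0 := by
    refine ⟨w + (-(lorentz w w / 2)) • P, ?_, ?_, fun v => ?_⟩
    · simp only [lorentz_add_left, lorentz_add_right, lorentz_smul_left, lorentz_smul_right, hP,
        hPw, lorentz_comm w P]
      ring
    · rw [lorentz_add_right, lorentz_smul_right, hP, hPw]
      ring
    · rw [lorentz_add_right, lorentz_smul_right, hPD, hDw]
      ring
  refine ⟨q, ⟨hqq, hPq, hDq⟩, ?_⟩
  rintro w' ⟨hww, hPw', hDw'⟩
  let U : (EuclideanSpace ℝ (Fin n) × ℝ) × ℝ →ₗ[ℝ] Minkowski n :=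
    T.coprod (LinearMap.toSpanSingleton ℝ _ q)
  have hU : ∀ v a b, U ((v, a), b) = D v + a • P + b • q := fun v a b => by simp [U, hT]
  have hUinj : Function.Injective U := by
    rw [← LinearMap.ker_eq_bot, LinearMap.ker_eq_bot']
    rintro ⟨⟨v, a⟩, b⟩ h
    rw [hU] at h
    have h1 : lorentz (D v + a • P + b • q) P = 0 := by rw [h, lorentz_zero_left]
    rw [lorentz_add_left, lorentz_add_left, lorentz_smul_left, lorentz_smul_left, hPD, hP,
      lorentz_comm q, hPq] at h1
    have hb : b = 0 := by linarith
    subst hb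
    have h2 : T (v, a) = 0 := by
      rw [hT]
      simpa using h
    have h3 := (LinearMap.ker_eq_bot'.1 hTinj) _ h2
    simp [h3]
  have hUsurj : Function.Surjective U := by
    refine (LinearMap.injective_iff_surjective_of_finrank_eq_finrank ?_).1 hUinj
    simp
  obtain ⟨⟨⟨v, a⟩, b⟩, hd⟩ := hUsurj (w' - q)
  rw [hU] at hd
  have hw' : w' = q + (D v + a • P + b • q) := by rw [hd]; abel
  rw [hw'] at hPw'
  simp only [lorentz_add_right, lorentz_smul_right, hPq, hP, lorentz_comm P (D v), hPD] at hPw'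
  have hb : b = 0 := by linarith
  subst hb
  have h4 := hDw' v
  rw [hw'] at h4
  simp only [lorentz_add_right, lorentz_smul_right, hDq, hPD] at h4
  have hv : v = 0 := hDz v (by linarith)
  subst hv
  rw [hw'] at hww
  simp only [map_zero, zero_add, zero_smul, add_zero, lorentz_add_left, lorentz_add_right,
    lorentz_smul_left, lorentz_smul_right, hqq, hPq, hP, lorentz_comm q P] at hww
  have ha : a = 0 := by linarith
  subst ha
  rw [hw']
  simp

/-- If a curve in the light-cone has velocity `L` at a parameter where it passes through the
origin, then `L` is null; and in general its position and velocity are orthogonal. -/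
theorem lorentz_curve {c : ℝ → Minkowski n} {L : Minkowski n} (hc : HasDerivAt c L 0)
    (h : ∀ᶠ s in 𝓝 0, lorentz (c s) (c s) = 0) :
    lorentz L (c 0) = 0 ∧ (c 0 = 0 → lorentz L L = 0) := by
  have hi : ∀ i, HasDerivAt (fun s => c s i) (L i) 0 := fun i => by
    have := (EuclideanSpace.proj (𝕜 := ℝ) i : Minkowski n →L[ℝ] ℝ).hasFDerivAt.comp_hasDerivAt
      (0 : ℝ) hc
    simpa [Function.comp_def] using this
  constructor
  · have h1 : HasDerivAt (fun s => lorentz (c s) (c s)) (lorentz L (c 0) + lorentz (c 0) L) 0 := by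
      unfold lorentz
      have h2 := ((hi 0).mul (hi 0)).neg.add
        (HasDerivAt.fun_sum (u := Finset.univ)
          fun (i : Fin (n + 1)) _ => (hi i.succ).mul (hi i.succ))
      refine h2.congr_deriv ?_
      rw [Finset.sum_add_distrib]
      ring
    have h3 : HasDerivAt (fun s => lorentz (c s) (c s)) 0 0 :=
      (hasDerivAt_const (0 : ℝ) (0 : ℝ)).congr_of_eventuallyEq h
    have h4 := h1.unique h3
    rw [lorentz_comm (c 0)] at h4
    linarith
  · intro h0
    have h1 := hc.tendsto_slope_zero
    have h2 := (continuous_lorentz_self.tendsto L).comp h1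
    refine tendsto_nhds_unique h2 (tendsto_const_nhds.congr' ?_)
    filter_upwards [nhdsWithin_le_nhds h] with s hs
    simp [h0, lorentz_smul_left, lorentz_smul_right, hs]

variable {M : Type*} [TopologicalSpace M] [ChartedSpace (EuclideanSpace ℝ (Fin n)) M]
  [IsManifold (𝓡 n) ∞ M]

/-- For an isometric immersion into the light-cone there is exactly one dual vector at each
point. -/
theorem existsUnique_isDualVector (hn : 1 ≤ n) {g : SmoothMetric n M} {p : M → Minkowski n}
    (hp : IsIsometricImmersion g p) (x : M) : ∃! w, IsDualVector p x w := by
  have hmd : MDifferentiableAt (𝓡 n) 𝓘(ℝ, Minkowski n) p x :=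
    hp.smooth.mdifferentiableAt (by simp)
  let D : EuclideanSpace ℝ (Fin n) →L[ℝ] Minkowski n := mfderiv (𝓡 n) 𝓘(ℝ, Minkowski n) p x
  have hD : ∀ v, v ≠ 0 → 0 < lorentz (D v) (D v) := fun v hv => by
    have h1 : lorentz (D v) (D v) = g.form x v v :=
      congrFun (congrFun (congrFun hp.isometric x) v) v
    rw [h1]
    exact g.pos x v hv
  have hcurve : ∀ v : EuclideanSpace ℝ (Fin n), lorentz (D v) (p x) = 0 ∧
      (p x = 0 → lorentz (D v) (D v) = 0) := fun v => by
    let e := chartAt (EuclideanSpace ℝ (Fin n)) x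
    have h1 : HasFDerivAt (fun y => p (e.symm y)) D (e x) := by
      have h0 := hmd.hasMFDerivAt.2
      simp only [writtenInExtChartAt, extChartAt, mfld_simps] at h0
      exact hasFDerivWithinAt_univ.1 h0
    have h2 : HasDerivAt (fun s : ℝ => e x + s • v) v 0 := by
      simpa using ((hasDerivAt_id (0 : ℝ)).smul_const v).const_add (e x)
    have h3 : HasDerivAt (fun s : ℝ => p (e.symm (e x + s • v))) (D v) 0 :=
      HasFDerivAt.comp_hasDerivAt (0 : ℝ) (l := fun y => p (e.symm y)) (by simpa using h1) h2
    have h4 := lorentz_curve h3 (Filter.Eventually.of_forall fun s => hp.mem_lightCone _)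
    simpa [e] using h4
  have hP0 : p x ≠ 0 := fun h => by
    have hv : stdVec (⟨0, hn⟩ : Fin n) ≠ 0 := by simp [stdVec]
    exact (hD _ hv).ne' ((hcurve _).2 h)
  obtain ⟨w, ⟨h1, h2, h3⟩, huniq⟩ := existsUnique_dual_linear D.toLinearMap (p x) hD
    (hp.mem_lightCone x) hP0 fun v => (hcurve v).1
  exact ⟨w, ⟨h1, h2, h3⟩, fun w' hw' =>
    huniq w' ⟨hw'.mem_lightCone, hw'.inner_self, hw'.inner_tangent⟩⟩

theorem isDualVector_dualMap (hn : 1 ≤ n) {g : SmoothMetric n M} {p : M → Minkowski n}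
    (hp : IsIsometricImmersion g p) (x : M) : IsDualVector p x (dualMap p x) :=
  Classical.epsilon_spec (existsUnique_isDualVector hn hp x).exists

end Dual

end NullSpace

end

/-!
The metric of the null-space can be computed explicitly. Differentiating the relations
`⟨q, q⟩ = 0`, `⟨p, q⟩ = 1` and `⟨dp, q⟩ = 0` shows that the dual map satisfies `dq = dp ∘ A` for an
endomorphism field `A` that is self-adjoint for `g`, the shape operator (`mfderiv_dualMap`,
`inner_shapeOperator_comm`). Hence at `(s, x)` the metric of the null-space is
`g ((1 + s A) ·, (1 + s A) ·)`, evaluated on the components tangent to `M` (`nullForm_apply`), and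
at height zero it is `g`.

The shape operator also governs the curvature. The normal part of the second derivatives of `p` is
a combination of `p` and `q` with coefficients `-⟨dp, dq⟩` and `-g`, so the Gauss equation
(`LightconePatch.curvature_eq`) expresses the curvature tensor in terms of `A`, and contracting it
twice gives `S = 2 (n - 1) tr A` (`scalarCurvature_eq`). As `n ≥ 2`, the scalar curvature vanishes
if and only if `A` is trace-free.

Let `G t = (s_t, φ_t)` be a variation supported in `K`. Since the induced metrics are positive
definite and the null-space is degenerate along its rulings, each `φ_t` is a local diffeomorphism.
The family `φ_t` starts at the identity and is the identity outside of the compact set `K`, so that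
for small `t` it consists of diffeomorphisms with inverses depending smoothly on `t`
(`exists_smooth_inverse`). Reparametrising by these inverses, the variation becomes a family of
graphs of height functions `σ_t`, without changing the volume (`volumeMeasure_pullback`), and
`Vol_K(t) = ∫_K det (1 + σ_t A) dV_g` (`IsVariation.exists_height`).

From `det (1 + s A) = 1 + s tr A + s² ((tr A)² - tr A²) / 2 + O(s³)` and `σ_0 = 0`, the first
variation is `∫_K σ' tr A` (`IsVariation.exists_first_variation`). It vanishes for all variations
if `tr A = 0`. Conversely, the variation with speed `f = χ tr A` along the rulings, for a bump
function `χ`, has first variation `∫ χ (tr A)²` (`trace_shapeOperator_eq_zero`). If `tr A = 0`,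
then the term of the second variation containing `σ''` drops out, and what remains is
`-∫_K σ'² tr A²`. This is nonpositive, because the square of a self-adjoint endomorphism has
nonnegative trace (`trace_mul_self_nonneg`, `IsVariation.second_variation`).
-/

noncomputable section

namespace NullSpace

/-! ### Linear algebra -/

section LinearAlgebra

open Polynomial in
/-- Second order expansion of `det (1 + s A)`. The quadratic coefficient is found by comparing
`det (1 + s A) * det (1 - s A)` with `det (1 - s² A²)`. -/
theorem exists_polynomial_det_one_add_smul {ι : Type*} [Fintype ι] [DecidableEq ι]
    (A : Matrix ι ι ℝ) :
    ∃ P : ℝ[X], (∀ s : ℝ, (1 + s • A).det = P.eval s) ∧ P.derivative.eval 0 = A.trace ∧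
      P.derivative.derivative.eval 0 = A.trace ^ 2 - (A * A).trace := by
  set R : ℝ[X] := (Matrix.det (1 + (X : ℝ[X]) • A.map C)).divX.divX with hR
  set R₂ : ℝ[X] := (Matrix.det (1 + (X : ℝ[X]) • (A * A).map C)).divX.divX with hR₂
  have h1 : ∀ s : ℝ, (1 + s • A).det = 1 + A.trace * s + R.eval s * s ^ 2 := fun s =>
    Matrix.det_one_add_smul s A
  have h2 : ∀ s : ℝ, (1 + s • (A * A)).det = 1 + (A * A).trace * s + R₂.eval s * s ^ 2 := fun s =>
    Matrix.det_one_add_smul s (A * A)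
  have h3 : ∀ s : ℝ, (1 + s • A).det * (1 + (-s) • A).det = (1 + (-s ^ 2) • (A * A)).det := by
    intro s
    rw [← Matrix.det_mul]
    congr 1
    simp only [add_mul, mul_add, one_mul, mul_one, Matrix.smul_mul, neg_smul, mul_neg,
      Matrix.mul_smul, smul_smul, pow_two]
    abel
  have h4 : (fun s : ℝ => R.eval s + R.eval (-s) - A.trace ^ 2
        + A.trace * s * (R.eval (-s) - R.eval s) + R.eval s * R.eval (-s) * s ^ 2)
      = fun s : ℝ => -(A * A).trace + R₂.eval (-s ^ 2) * s ^ 2 := by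
    refine Continuous.ext_on (dense_compl_singleton (0 : ℝ)) (by fun_prop) (by fun_prop) ?_
    intro s hs
    have hs' : s ^ 2 ≠ 0 := pow_ne_zero 2 hs
    have h := h3 s
    rw [h1, h1, h2] at h
    apply mul_left_cancel₀ hs'
    simp only
    linear_combination h
  have h5 := congrFun h4 0
  simp only [neg_zero, mul_zero, zero_mul, add_zero, ne_eq, OfNat.ofNat_ne_zero, not_false_eq_true,
    zero_pow] at h5
  refine ⟨1 + C A.trace * X + R * X ^ 2, fun s => by rw [h1]; simp, by simp, ?_⟩
  simp
  linarith

variable {n : ℕ}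

/-- The standard basis of `ℝⁿ`, whose vectors are `stdVec i`. -/
def stdBasis (n : ℕ) : Module.Basis (Fin n) ℝ (EuclideanSpace ℝ (Fin n)) :=
  (EuclideanSpace.basisFun (Fin n) ℝ).toBasis

@[simp] theorem stdBasis_apply (i : Fin n) : stdBasis n i = stdVec i := by
  simp [stdBasis, stdVec]

/-- The Gram matrix of a bilinear form changes by the square of the determinant. -/
theorem det_gram_comp (β : EuclideanSpace ℝ (Fin n) →ₗ[ℝ] EuclideanSpace ℝ (Fin n) →ₗ[ℝ] ℝ)
    (T : EuclideanSpace ℝ (Fin n) →ₗ[ℝ] EuclideanSpace ℝ (Fin n)) :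
    (Matrix.of fun i j => β (T (stdVec i)) (T (stdVec j))).det
      = LinearMap.det T ^ 2 * (Matrix.of fun i j => β (stdVec i) (stdVec j)).det := by
  have h1 : (Matrix.of fun i j => β (T (stdVec i)) (T (stdVec j)))
      = LinearMap.toMatrix₂ (stdBasis n) (stdBasis n) (β.compl₁₂ T T) := by
    ext i j
    simp [LinearMap.toMatrix₂_apply]
  have h2 : (Matrix.of fun i j => β (stdVec i) (stdVec j))
      = LinearMap.toMatrix₂ (stdBasis n) (stdBasis n) β := by
    ext i j
    simp [LinearMap.toMatrix₂_apply]
  rw [h1, h2, LinearMap.toMatrix₂_compl₁₂ (stdBasis n) (stdBasis n), Matrix.det_mul,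
    Matrix.det_mul, Matrix.det_transpose, LinearMap.det_toMatrix]
  ring

/-- The square of an endomorphism that is self-adjoint for an inner product has nonnegative
trace. -/
theorem trace_mul_self_nonneg {V : Type*} [AddCommGroup V] [Module ℝ V] [FiniteDimensional ℝ V]
    (β : LinearMap.BilinForm ℝ V) (hsymm : ∀ v w, β v w = β w v) (hpos : ∀ v, v ≠ 0 → 0 < β v v)
    (A : V →ₗ[ℝ] V) (hA : ∀ v w, β (A v) w = β v (A w)) :
    0 ≤ LinearMap.trace ℝ V (A * A) := by
  obtain ⟨b, hb⟩ := LinearMap.BilinForm.exists_orthogonal_basis (B := β) ⟨fun v w => by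
    simpa using hsymm v w⟩
  have hd : ∀ i, 0 < β (b i) (b i) := fun i => hpos _ (b.ne_zero i)
  have hbo : ∀ i j, i ≠ j → β (b i) (b j) = 0 := fun i j hij => hb hij
  set N := LinearMap.toMatrix b b A with hN
  have hAb : ∀ i j, β (b i) (A (b j)) = β (b i) (b i) * N i j := by
    intro i j
    have : A (b j) = ∑ k, N k j • b k := by
      simp only [hN, LinearMap.toMatrix_apply]
      exact (b.sum_repr _).symm
    rw [this, map_sum, Finset.sum_eq_single i]
    · simp [mul_comm]
    · intro k _ hk
      simp [hbo i k (Ne.symm hk)]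
    · simp
  have hsw : ∀ i j, β (b i) (b i) * N i j = β (b j) (b j) * N j i := by
    intro i j
    rw [← hAb, ← hAb, ← hA, hsymm]
  rw [LinearMap.trace_eq_matrix_trace ℝ b, LinearMap.toMatrix_mul, ← hN, Matrix.trace]
  refine Finset.sum_nonneg fun i _ => ?_
  rw [Matrix.diag_apply, Matrix.mul_apply]
  refine Finset.sum_nonneg fun j _ => ?_
  have h1 : N j i = β (b i) (b i) * N i j / β (b j) (b j) := by
    rw [hsw i j]
    field_simp [(hd j).ne']
  rw [h1]
  have h2 := hd i
  have h3 := hd j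
  have : N i j * (β (b i) (b i) * N i j / β (b j) (b j))
      = (N i j) ^ 2 * β (b i) (b i) / β (b j) (b j) := by ring
  rw [this]
  positivity

/-- The Lorentzian inner product as a continuous bilinear map. -/
def lorentzL (n : ℕ) : Minkowski n →L[ℝ] Minkowski n →L[ℝ] ℝ :=
  (LinearMap.mk₂ ℝ (lorentz (n := n)) lorentz_add_left lorentz_smul_left lorentz_add_right
    lorentz_smul_right).toContinuousBilinearMap

@[simp] theorem lorentzL_apply (v w : Minkowski n) : lorentzL n v w = lorentz v w := rfl

theorem lorentz_sum_left {ι : Type*} (s : Finset ι) (v : ι → Minkowski n) (w : Minkowski n) :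
    lorentz (∑ i ∈ s, v i) w = ∑ i ∈ s, lorentz (v i) w := by
  simp only [← lorentzL_apply, map_sum, sum_apply]

theorem lorentz_sum_right {ι : Type*} (s : Finset ι) (v : ι → Minkowski n) (w : Minkowski n) :
    lorentz w (∑ i ∈ s, v i) = ∑ i ∈ s, lorentz w (v i) := by
  simp only [← lorentzL_apply, map_sum]

theorem lorentz_sub_left (u v w : Minkowski n) :
    lorentz (u - v) w = lorentz u w - lorentz v w := by
  simp only [← lorentzL_apply, map_sub, sub_apply]

theorem lorentz_sub_right (u v w : Minkowski n) :
    lorentz w (u - v) = lorentz w u - lorentz w v := by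
  simp only [← lorentzL_apply, map_sub]

/-- A lightlike pair `P`, `q` with `⟨P, q⟩ = 1` and a spacelike `n`-dimensional subspace orthogonal
to both span the spacetime. -/
theorem exists_eq_add_smul_add_smul (D : EuclideanSpace ℝ (Fin n) →ₗ[ℝ] Minkowski n)
    {P q : Minkowski n} (hD : ∀ v, v ≠ 0 → 0 < lorentz (D v) (D v)) (hP : lorentz P P = 0)
    (hPD : ∀ v, lorentz (D v) P = 0) (hq : lorentz q q = 0) (hPq : lorentz P q = 1)
    (hqD : ∀ v, lorentz (D v) q = 0) (z : Minkowski n) :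
    ∃ v, ∃ a b : ℝ, z = D v + a • P + b • q := by
  let U : (EuclideanSpace ℝ (Fin n) × ℝ) × ℝ →ₗ[ℝ] Minkowski n :=
    (D.coprod (LinearMap.toSpanSingleton ℝ _ P)).coprod (LinearMap.toSpanSingleton ℝ _ q)
  have hU : ∀ v a b, U ((v, a), b) = D v + a • P + b • q := fun v a b => by simp [U]
  have hUinj : Function.Injective U := by
    rw [← LinearMap.ker_eq_bot, LinearMap.ker_eq_bot']
    rintro ⟨⟨v, a⟩, b⟩ h
    rw [hU] at h
    have h1 : lorentz (D v + a • P + b • q) P = 0 := by rw [h, lorentz_zero_left]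
    have h2 : lorentz (D v + a • P + b • q) q = 0 := by rw [h, lorentz_zero_left]
    have h3 : lorentz (D v + a • P + b • q) (D v) = 0 := by rw [h, lorentz_zero_left]
    simp only [lorentz_add_left, lorentz_smul_left, hPD, hP, lorentz_comm q P, hPq] at h1
    simp only [lorentz_add_left, lorentz_smul_left, hqD, hq, hPq] at h2
    simp only [lorentz_add_left, lorentz_smul_left, lorentz_comm P, lorentz_comm q, hqD, hPD] at h3
    have ha : a = 0 := by linarith
    have hb : b = 0 := by linarith
    have hv : v = 0 := by
      by_contra hv
      have := hD v hv
      linarith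
    simp [ha, hb, hv]
  have hUsurj : Function.Surjective U :=
    (LinearMap.injective_iff_surjective_of_finrank_eq_finrank (by simp)).1 hUinj
  obtain ⟨⟨⟨v, a⟩, b⟩, h⟩ := hUsurj z
  exact ⟨v, a, b, by rw [← h, hU]⟩

end LinearAlgebra

/-! ### The volume measure of a field of bilinear forms -/

section Chart

variable {n : ℕ} {M : Type*} [TopologicalSpace M] [MeasurableSpace M] [BorelSpace M]

theorem measurableSet_chart_image (e : OpenPartialHomeomorph M (EuclideanSpace ℝ (Fin n)))
    {A : Set M} (hA : MeasurableSet A) : MeasurableSet (e.target ∩ e.symm ⁻¹' A) := by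
  have h1 : Measurable (e.target.domRestrict e.symm) :=
    (continuousOn_iff_continuous_domRestrict.1 e.continuousOn_symm).measurable
  have h2 := (e.open_target.measurableSet).subtype_image (h1 hA)
  convert! h2 using 1
  ext y
  constructor
  · rintro ⟨hy, hyA⟩
    exact ⟨⟨y, hy⟩, hyA, rfl⟩
  · rintro ⟨⟨z, hz⟩, hzA, rfl⟩
    exact ⟨hz, hzA⟩

theorem aemeasurable_chart_symm (e : OpenPartialHomeomorph M (EuclideanSpace ℝ (Fin n)))
    (f : EuclideanSpace ℝ (Fin n) → ℝ≥0∞) :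
    AEMeasurable e.symm ((volume.restrict e.target).withDensity f) :=
  (e.continuousOn_symm.aemeasurable e.open_target.measurableSet).mono_ac
    (withDensity_absolutelyContinuous _ _)

end Chart

section Volume

variable {n : ℕ} {M : Type*} [TopologicalSpace M] [ChartedSpace (EuclideanSpace ℝ (Fin n)) M]

/-- The field `h` consists of bilinear forms. -/
def FormField.IsBilinear (h : FormField (𝓡 n) M) : Prop :=
  ∀ x, ∃ β : EuclideanSpace ℝ (Fin n) →ₗ[ℝ] EuclideanSpace ℝ (Fin n) →ₗ[ℝ] ℝ,
    ∀ v w : EuclideanSpace ℝ (Fin n), h x v w = β v w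

/-- The coordinate frame of the chart `e`, as a linear endomorphism of the model space, to which
every tangent space of `M` is definitionally equal. -/
def chartFrame (e : OpenPartialHomeomorph M (EuclideanSpace ℝ (Fin n)))
    (y : EuclideanSpace ℝ (Fin n)) : EuclideanSpace ℝ (Fin n) →L[ℝ] EuclideanSpace ℝ (Fin n) :=
  mfderiv (𝓡 n) (𝓡 n) e.symm y

/-- The chain rule for `f ∘ e.symm = e'.symm ∘ (e' ∘ f ∘ e.symm)`. -/
theorem mfderiv_comp_chartFrame {e e' : OpenPartialHomeomorph M (EuclideanSpace ℝ (Fin n))}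
    (he : e ∈ IsManifold.maximalAtlas (𝓡 n) ∞ M) (he' : e' ∈ IsManifold.maximalAtlas (𝓡 n) ∞ M)
    {f : M → M} {y : EuclideanSpace ℝ (Fin n)} (hy : y ∈ e.target)
    (hf : MDifferentiableAt (𝓡 n) (𝓡 n) f (e.symm y)) (hfs : f (e.symm y) ∈ e'.source) :
    (mfderiv (𝓡 n) (𝓡 n) f (e.symm y) : _ →L[ℝ] _).comp (chartFrame e y)
      = (chartFrame e' (e' (f (e.symm y)))).comp (fderiv ℝ (fun z => e' (f (e.symm z))) y) := by
  set G : EuclideanSpace ℝ (Fin n) → EuclideanSpace ℝ (Fin n) := fun z => e' (f (e.symm z))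
  have hsymm : MDifferentiableAt (𝓡 n) (𝓡 n) e.symm y :=
    (contMDiffAt_symm_of_mem_maximalAtlas he hy).mdifferentiableAt (by simp)
  have hd : MDifferentiableAt (𝓡 n) (𝓡 n) (fun z => f (e.symm z)) y :=
    MDifferentiableAt.comp y hf hsymm
  have hGd : MDifferentiableAt (𝓡 n) (𝓡 n) G y :=
    MDifferentiableAt.comp y (g := e')
      ((contMDiffAt_of_mem_maximalAtlas he' hfs).mdifferentiableAt (by simp)) hd
  have h1 : mfderiv (𝓡 n) (𝓡 n) (f ∘ e.symm) y
      = (mfderiv (𝓡 n) (𝓡 n) f (e.symm y)).comp (mfderiv (𝓡 n) (𝓡 n) e.symm y) :=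
    mfderiv_comp y hf hsymm
  have h2 : mfderiv (𝓡 n) (𝓡 n) (e'.symm ∘ G) y
      = (mfderiv (𝓡 n) (𝓡 n) e'.symm (G y)).comp (mfderiv (𝓡 n) (𝓡 n) G y) :=
    mfderiv_comp y ((contMDiffAt_symm_of_mem_maximalAtlas he'
      (e'.map_source hfs)).mdifferentiableAt (by simp)) hGd
  have h3 : f ∘ e.symm =ᶠ[𝓝 y] e'.symm ∘ G := by
    have := hd.continuousAt.preimage_mem_nhds (e'.open_source.mem_nhds hfs)
    filter_upwards [this] with z hz
    exact (e'.left_inv hz).symm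
  rw [h3.mfderiv_eq, h2, mfderiv_eq_fderiv] at h1
  exact h1.symm

/-- The Gram determinant of `h` in the fixed basis of the model space, to which the tangent space
is definitionally equal. -/
def gramDet (h : FormField (𝓡 n) M) (x : M) : ℝ :=
  (Matrix.of fun i j => h x (stdVec i : EuclideanSpace ℝ (Fin n))
    (stdVec j : EuclideanSpace ℝ (Fin n))).det

theorem det_chartMatrix {h : FormField (𝓡 n) M} (hh : h.IsBilinear)
    (e : OpenPartialHomeomorph M (EuclideanSpace ℝ (Fin n))) (y : EuclideanSpace ℝ (Fin n)) :
    (chartMatrix h e y).det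
      = LinearMap.det (chartFrame e y).toLinearMap ^ 2 * gramDet h (e.symm y) := by
  obtain ⟨β, hβ⟩ := hh (e.symm y)
  have h1 := det_gram_comp β (chartFrame e y).toLinearMap
  simp only [← hβ] at h1
  exact h1

theorem gramDet_comp {h h' : FormField (𝓡 n) M} (hh : h.IsBilinear) {x x' : M}
    (L : EuclideanSpace ℝ (Fin n) →ₗ[ℝ] EuclideanSpace ℝ (Fin n))
    (hL : ∀ v w : EuclideanSpace ℝ (Fin n), h' x v w = h x' (L v) (L w)) :
    gramDet h' x = LinearMap.det L ^ 2 * gramDet h x' := by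
  obtain ⟨β, hβ⟩ := hh x'
  have h1 := det_gram_comp β L
  simp only [← hβ, ← hL] at h1
  exact h1

theorem FormField.IsBilinear.comp {h h' : FormField (𝓡 n) M} (hh : h.IsBilinear)
    (φ : M → M) (L : M → EuclideanSpace ℝ (Fin n) →ₗ[ℝ] EuclideanSpace ℝ (Fin n))
    (hL : ∀ x, ∀ v w : EuclideanSpace ℝ (Fin n), h' x v w = h (φ x) (L x v) (L x w)) :
    h'.IsBilinear := fun x => by
  obtain ⟨β, hβ⟩ := hh (φ x)
  exact ⟨β.compl₁₂ (L x) (L x), fun v w => (hL x v w).trans (hβ _ _)⟩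

theorem FormField.IsBilinear.pullback {h : FormField (𝓡 n) M} (hh : h.IsBilinear) (f : M → M) :
    (pullbackForm (𝓡 n) (𝓡 n) f h).IsBilinear :=
  hh.comp f (fun x => (mfderiv (𝓡 n) (𝓡 n) f x).toLinearMap) fun _ _ _ => rfl

theorem pullbackForm_id (h : FormField (𝓡 n) M) :
    pullbackForm (𝓡 n) (𝓡 n) (fun x : M => x) h = h := by
  funext x v w
  have : mfderiv (𝓡 n) (𝓡 n) (fun x : M => x) x = ContinuousLinearMap.id ℝ _ := mfderiv_id
  simp only [pullbackForm, this]
  rfl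

variable [MeasurableSpace M]

/-- The measure `√(det h_{ij}) dx¹ ⋯ dxⁿ` of the chart `e`. -/
def chartVolume (h : FormField (𝓡 n) M)
    (e : OpenPartialHomeomorph M (EuclideanSpace ℝ (Fin n))) : Measure M :=
  (((volume : Measure (EuclideanSpace ℝ (Fin n))).restrict e.target).withDensity
      (fun y => ENNReal.ofReal (Real.sqrt (chartMatrix h e y).det))).map e.symm

theorem volumeMeasure_eq (h : FormField (𝓡 n) M) :
    volumeMeasure h = ⨆ x : M, chartVolume h (chartAt (EuclideanSpace ℝ (Fin n)) x) := rfl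

variable [BorelSpace M]

theorem chartVolume_apply (h : FormField (𝓡 n) M)
    (e : OpenPartialHomeomorph M (EuclideanSpace ℝ (Fin n))) {A : Set M} (hA : MeasurableSet A) :
    chartVolume h e A = ∫⁻ y in e.target ∩ e.symm ⁻¹' A,
      ENNReal.ofReal (Real.sqrt (chartMatrix h e y).det) := by
  have hm := measurableSet_chart_image e hA
  rw [chartVolume, Measure.map_apply_of_aemeasurable (aemeasurable_chart_symm e _) hA]
  -- the preimage of `A` need not be measurable outside of the target of the chart
  have h1 : ((volume : Measure (EuclideanSpace ℝ (Fin n))).restrict e.target).withDensity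
      (fun y => ENNReal.ofReal (Real.sqrt (chartMatrix h e y).det)) e.targetᶜ = 0 := by
    apply withDensity_absolutelyContinuous
    rw [Measure.restrict_apply e.open_target.measurableSet.compl]
    simp
  have h2 : e.symm ⁻¹' A =ᵐ[((volume : Measure (EuclideanSpace ℝ (Fin n))).restrict
      e.target).withDensity (fun y => ENNReal.ofReal (Real.sqrt (chartMatrix h e y).det))]
      (e.target ∩ e.symm ⁻¹' A : Set _) := by
    have h3 : ∀ᵐ y ∂((volume : Measure (EuclideanSpace ℝ (Fin n))).restrict
      e.target).withDensity (fun y => ENNReal.ofReal (Real.sqrt (chartMatrix h e y).det)),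
        y ∈ e.target := h1
    filter_upwards [h3] with y hy
    apply propext
    change y ∈ e.symm ⁻¹' A ↔ y ∈ e.target ∩ e.symm ⁻¹' A
    simp [hy]
  rw [measure_congr h2, withDensity_apply _ hm, Measure.restrict_restrict hm,
    inter_right_comm, inter_self]

theorem chartVolume_compl_source (h : FormField (𝓡 n) M)
    (e : OpenPartialHomeomorph M (EuclideanSpace ℝ (Fin n))) : chartVolume h e e.sourceᶜ = 0 := by
  rw [chartVolume_apply h e e.open_source.measurableSet.compl]
  have : e.target ∩ e.symm ⁻¹' e.sourceᶜ = ∅ := by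
    ext y
    simp only [mem_inter_iff, mem_preimage, mem_compl_iff, mem_empty_iff_false, iff_false, not_and,
      not_not]
    exact fun hy => e.map_target hy
  rw [this, Measure.restrict_empty, lintegral_zero_measure]

/-- Change of variables: in charts, the volume of the image under an injective map is the volume
for the pulled back form. -/
theorem chartVolume_pullback [IsManifold (𝓡 n) ∞ M] {h : FormField (𝓡 n) M} (hh : h.IsBilinear)
    {e e' : OpenPartialHomeomorph M (EuclideanSpace ℝ (Fin n))}
    (he : e ∈ IsManifold.maximalAtlas (𝓡 n) ∞ M) (he' : e' ∈ IsManifold.maximalAtlas (𝓡 n) ∞ M)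
    {f : M → M} {A : Set M} (hA : MeasurableSet A) (hfA : MeasurableSet (f '' A))
    (hAe : A ⊆ e.source) (hAe' : f '' A ⊆ e'.source) (hinj : InjOn f A)
    (hf : ∀ x ∈ A, MDifferentiableAt (𝓡 n) (𝓡 n) f x) :
    chartVolume (pullbackForm (𝓡 n) (𝓡 n) f h) e A = chartVolume h e' (f '' A) := by
  set s := e.target ∩ e.symm ⁻¹' A with hs
  have hsm : MeasurableSet s := measurableSet_chart_image e hA
  set G : EuclideanSpace ℝ (Fin n) → EuclideanSpace ℝ (Fin n) := fun y => e' (f (e.symm y)) with hG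
  have himg : e'.target ∩ e'.symm ⁻¹' (f '' A) = G '' s := by
    ext z
    constructor
    · rintro ⟨hz, x, hx, hxz⟩
      refine ⟨e x, ⟨e.map_source (hAe hx), by simpa [e.left_inv (hAe hx)] using hx⟩, ?_⟩
      simp [hG, e.left_inv (hAe hx), hxz, e'.right_inv hz]
    · rintro ⟨y, ⟨hy, hyA⟩, rfl⟩
      have h1 : f (e.symm y) ∈ e'.source := hAe' ⟨_, hyA, rfl⟩
      exact ⟨e'.map_source h1, e.symm y, hyA, (e'.left_inv h1).symm⟩
  have hd : ∀ y ∈ s, MDifferentiableAt (𝓡 n) (𝓡 n) (fun z => f (e.symm z)) y := fun y hy =>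
    MDifferentiableAt.comp y (hf _ hy.2)
      ((contMDiffAt_symm_of_mem_maximalAtlas he hy.1).mdifferentiableAt (by simp))
  have hGd : ∀ y ∈ s, MDifferentiableAt (𝓡 n) (𝓡 n) G y := fun y hy =>
    MDifferentiableAt.comp y (g := e')
      ((contMDiffAt_of_mem_maximalAtlas he' (hAe' ⟨_, hy.2, rfl⟩)).mdifferentiableAt (by simp))
      (hd y hy)
  have hGf : ∀ y ∈ s, HasFDerivWithinAt G (fderiv ℝ G y) s y := fun y hy =>
    (hGd y hy).differentiableAt.hasFDerivAt.hasFDerivWithinAt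
  have hGinj : InjOn G s := by
    intro y hy z hz hyz
    have h1 := e'.injOn (hAe' ⟨_, hy.2, rfl⟩) (hAe' ⟨_, hz.2, rfl⟩) hyz
    exact e.symm.injOn hy.1 hz.1 (hinj hy.2 hz.2 h1)
  rw [chartVolume_apply _ _ hA, chartVolume_apply _ _ hfA, himg,
    lintegral_image_eq_lintegral_abs_det_fderiv_mul volume hsm hGf hGinj]
  refine setLIntegral_congr_fun hsm fun y hy => ?_
  have hys : e.symm y ∈ A := hy.2
  have hfs : f (e.symm y) ∈ e'.source := hAe' ⟨_, hys, rfl⟩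
  have hchain : (mfderiv (𝓡 n) (𝓡 n) f (e.symm y) : _ →L[ℝ] _).comp (chartFrame e y)
      = (chartFrame e' (G y)).comp (fderiv ℝ G y) :=
    mfderiv_comp_chartFrame he he' hy.1 (hf _ hys) hfs
  have hdet : LinearMap.det (mfderiv (𝓡 n) (𝓡 n) f (e.symm y)).toLinearMap
      * LinearMap.det (chartFrame e y).toLinearMap
      = LinearMap.det (chartFrame e' (G y)).toLinearMap * (fderiv ℝ G y).det :=
    (LinearMap.det_comp _ _).symm.trans ((congrArg
      (fun T : EuclideanSpace ℝ (Fin n) →L[ℝ] EuclideanSpace ℝ (Fin n) =>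
        LinearMap.det T.toLinearMap) hchain).trans (LinearMap.det_comp _ _))
  have hgram := gramDet_comp (h' := pullbackForm (𝓡 n) (𝓡 n) f h) hh (x := e.symm y)
    (mfderiv (𝓡 n) (𝓡 n) f (e.symm y)).toLinearMap fun v w => rfl
  have hback : e'.symm (G y) = f (e.symm y) := e'.left_inv hfs
  rw [det_chartMatrix (hh.pullback f), det_chartMatrix hh, hgram, hback,
    ← ENNReal.ofReal_mul (abs_nonneg _), ← mul_assoc, ← mul_pow,
    Real.sqrt_mul (sq_nonneg _), Real.sqrt_mul (sq_nonneg _), Real.sqrt_sq_eq_abs,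
    Real.sqrt_sq_eq_abs, ← mul_assoc, ← abs_mul,
    mul_comm (LinearMap.det (chartFrame e y).toLinearMap), mul_comm (ContinuousLinearMap.det _)]
  exact congrArg (fun c => ENNReal.ofReal (|c| * √(gramDet h (f (e.symm y))))) hdet

/-- On the domain of a preferred chart, the volume measure is the coordinate expression in that
chart. -/
theorem volumeMeasure_apply_of_subset [IsManifold (𝓡 n) ∞ M] {h : FormField (𝓡 n) M}
    (hh : h.IsBilinear) (x : M) {A : Set M} (hA : MeasurableSet A)
    (hAx : A ⊆ (chartAt (EuclideanSpace ℝ (Fin n)) x).source) :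
    volumeMeasure h A = chartVolume h (chartAt (EuclideanSpace ℝ (Fin n)) x) A := by
  set e := chartAt (EuclideanSpace ℝ (Fin n)) x
  have hem : e ∈ IsManifold.maximalAtlas (𝓡 n) ∞ M := IsManifold.chart_mem_maximalAtlas x
  have hloc : ∀ x' : M, ∀ B, MeasurableSet B → B ⊆ e.source →
      chartVolume h (chartAt (EuclideanSpace ℝ (Fin n)) x') B ≤ chartVolume h e B := by
    intro x' B hB hBe
    set e' := chartAt (EuclideanSpace ℝ (Fin n)) x'
    have hem' : e' ∈ IsManifold.maximalAtlas (𝓡 n) ∞ M := IsManifold.chart_mem_maximalAtlas x'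
    have hBm := hB.inter e'.open_source.measurableSet
    calc chartVolume h e' B ≤ chartVolume h e' (B ∩ e'.source) + chartVolume h e' e'.sourceᶜ :=
          (measure_le_inter_add_sdiff _ B e'.source).trans
            (add_le_add le_rfl (measure_mono fun _ hz => hz.2))
      _ = chartVolume h e' (B ∩ e'.source) := by rw [chartVolume_compl_source, add_zero]
      _ = chartVolume h e (B ∩ e'.source) := by
          have := chartVolume_pullback hh hem' hem (f := fun z : M => z) hBm
            (by simpa using hBm) inter_subset_right (by simpa using inter_subset_left.trans hBe)
            (fun _ _ _ _ h => h) fun z _ => mdifferentiableAt_id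
          simpa [pullbackForm_id] using this
      _ ≤ chartVolume h e B := measure_mono inter_subset_left
  apply le_antisymm
  · -- an upper bound of all chart measures: that of `e` on its domain, infinite elsewhere
    have hle : volumeMeasure h ≤ chartVolume h e + (⊤ : Measure M).restrict e.sourceᶜ := by
      rw [volumeMeasure_eq]
      refine iSup_le fun x' => Measure.le_iff.2 fun B hB => ?_
      rw [← measure_inter_add_sdiff B e.open_source.measurableSet, Measure.add_apply,
        Measure.restrict_apply hB]
      refine add_le_add ((hloc x' _ (hB.inter e.open_source.measurableSet)
        inter_subset_right).trans (measure_mono inter_subset_left)) ?_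
      exact Measure.le_iff'.1 le_top _
    refine (Measure.le_iff'.1 hle A).trans_eq ?_
    have : A ∩ e.sourceᶜ = ∅ := by
      rw [← sdiff_eq, sdiff_eq_empty]
      exact hAx
    rw [Measure.add_apply, Measure.restrict_apply hA, this, measure_empty, add_zero]
  · exact Measure.le_iff'.1 (le_iSup (fun x' => chartVolume h
      (chartAt (EuclideanSpace ℝ (Fin n)) x')) x) A

/-- Naturality of the volume measure under diffeomorphisms. -/
theorem volumeMeasure_pullback [IsManifold (𝓡 n) ∞ M] [SecondCountableTopology M]
    {h : FormField (𝓡 n) M} (hh : h.IsBilinear) (f : M ≃ₜ M)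
    (hf : MDifferentiable (𝓡 n) (𝓡 n) f) (A : Set M) :
    volumeMeasure (pullbackForm (𝓡 n) (𝓡 n) f h) A = volumeMeasure h (f '' A) := by
  have hme : MeasurableEmbedding f := f.measurableEmbedding
  suffices hsuff : volumeMeasure (pullbackForm (𝓡 n) (𝓡 n) f h) = (volumeMeasure h).comap f by
    rw [hsuff, hme.comap_apply]
  obtain ⟨S, hS, hSU⟩ := TopologicalSpace.countable_cover_nhds
    (f := fun x : M => (chartAt (EuclideanSpace ℝ (Fin n)) x).source ∩
      f ⁻¹' (chartAt (EuclideanSpace ℝ (Fin n)) (f x)).source) fun x =>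
    Filter.inter_mem (chart_source_mem_nhds _ x)
      (f.continuous.continuousAt.preimage_mem_nhds (chart_source_mem_nhds _ (f x)))
  refine Measure.ext_of_biUnion_eq_univ hS hSU fun x _ => Measure.ext fun B hB => ?_
  have hm : MeasurableSet ((chartAt (EuclideanSpace ℝ (Fin n)) x).source ∩
      f ⁻¹' (chartAt (EuclideanSpace ℝ (Fin n)) (f x)).source) :=
    ((chartAt _ x).open_source.inter
      ((chartAt _ (f x)).open_source.preimage f.continuous)).measurableSet
  have hBm := hB.inter hm
  rw [Measure.restrict_apply hB, Measure.restrict_apply hB, hme.comap_apply,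
    volumeMeasure_apply_of_subset (hh.pullback f) x hBm (fun z hz => hz.2.1),
    volumeMeasure_apply_of_subset hh (f x) (hme.measurableSet_image.2 hBm)
      (by rintro _ ⟨z, hz, rfl⟩; exact hz.2.2)]
  exact chartVolume_pullback hh (IsManifold.chart_mem_maximalAtlas x)
    (IsManifold.chart_mem_maximalAtlas (f x)) hBm (hme.measurableSet_image.2 hBm)
    (fun z hz => hz.2.1) (by rintro _ ⟨z, hz, rfl⟩; exact hz.2.2) f.injective.injOn
    fun z _ => hf z

/-- The volume measure of a form `h(L·, L·)` has density `|det L|`. -/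
theorem volumeMeasure_comp [IsManifold (𝓡 n) ∞ M] [SecondCountableTopology M]
    {h h' : FormField (𝓡 n) M} (hh : h.IsBilinear)
    (hc : ∀ x : M, ContinuousOn
      (fun y => (chartMatrix h (chartAt (EuclideanSpace ℝ (Fin n)) x) y).det)
      (chartAt (EuclideanSpace ℝ (Fin n)) x).target)
    (L : M → EuclideanSpace ℝ (Fin n) →ₗ[ℝ] EuclideanSpace ℝ (Fin n))
    (hL : ∀ x, ∀ v w : EuclideanSpace ℝ (Fin n), h' x v w = h x (L x v) (L x w))
    (hLc : Measurable fun x => LinearMap.det (L x)) :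
    volumeMeasure h'
      = (volumeMeasure h).withDensity fun x => ENNReal.ofReal |LinearMap.det (L x)| := by
  have hh' : h'.IsBilinear := hh.comp (fun x => x) L hL
  have hdm : Measurable fun x => ENNReal.ofReal |LinearMap.det (L x)| :=
    hLc.abs.ennreal_ofReal
  obtain ⟨S, hS, hSU⟩ := TopologicalSpace.countable_cover_nhds
    (f := fun x : M => (chartAt (EuclideanSpace ℝ (Fin n)) x).source)
    fun x => chart_source_mem_nhds _ x
  refine Measure.ext_of_biUnion_eq_univ hS hSU fun x _ => Measure.ext fun B hB => ?_
  set e := chartAt (EuclideanSpace ℝ (Fin n)) x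
  have hBm : MeasurableSet (B ∩ e.source) := hB.inter e.open_source.measurableSet
  have hres : (volumeMeasure h).restrict (B ∩ e.source)
      = (chartVolume h e).restrict (B ∩ e.source) := by
    refine Measure.ext fun C hC => ?_
    rw [Measure.restrict_apply hC, Measure.restrict_apply hC]
    exact volumeMeasure_apply_of_subset hh x (hC.inter hBm) fun z hz => hz.2.2
  rw [Measure.restrict_apply hB, Measure.restrict_apply hB, withDensity_apply _ hBm, hres,
    volumeMeasure_apply_of_subset hh' x hBm inter_subset_right, chartVolume_apply _ _ hBm]
  have hdens : AEMeasurable (fun y => ENNReal.ofReal (Real.sqrt (chartMatrix h e y).det))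
      (volume.restrict e.target) :=
    ((Real.continuous_sqrt.comp_continuousOn (hc x)).aemeasurable
      e.open_target.measurableSet).ennreal_ofReal
  have hdm' : Measurable ((B ∩ e.source).indicator
      fun x => ENNReal.ofReal |LinearMap.det (L x)|) := hdm.indicator hBm
  rw [← lintegral_indicator hBm, chartVolume,
    lintegral_map' hdm'.aemeasurable (aemeasurable_chart_symm e _)]
  have hcomp : AEMeasurable (fun y => (B ∩ e.source).indicator
      (fun x => ENNReal.ofReal |LinearMap.det (L x)|) (e.symm y)) (volume.restrict e.target) :=
    hdm'.comp_aemeasurable (e.continuousOn_symm.aemeasurable e.open_target.measurableSet)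
  rw [lintegral_withDensity_eq_lintegral_mul₀ hdens hcomp,
    ← lintegral_indicator (measurableSet_chart_image e hBm),
    ← lintegral_indicator e.open_target.measurableSet]
  refine lintegral_congr fun y => ?_
  by_cases hy : y ∈ e.target
  swap
  · rw [indicator_of_notMem (fun h => hy h.1), indicator_of_notMem hy]
  rw [indicator_of_mem hy, Pi.mul_apply]
  by_cases hyB : e.symm y ∈ B ∩ e.source
  swap
  · rw [indicator_of_notMem (fun h => hyB h.2), indicator_of_notMem hyB, mul_zero]
  rw [indicator_of_mem (show y ∈ e.target ∩ e.symm ⁻¹' (B ∩ e.source) from ⟨hy, hyB⟩),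
    indicator_of_mem hyB, ← ENNReal.ofReal_mul (Real.sqrt_nonneg _), det_chartMatrix hh,
    det_chartMatrix hh', gramDet_comp hh (L (e.symm y)) (hL (e.symm y)), mul_left_comm,
    Real.sqrt_mul (sq_nonneg _), Real.sqrt_sq_eq_abs, mul_comm]

/-- The volume measure of a continuous form is locally finite. -/
theorem isLocallyFiniteMeasure_volumeMeasure [IsManifold (𝓡 n) ∞ M] {h : FormField (𝓡 n) M}
    (hh : h.IsBilinear)
    (hc : ∀ x : M, ContinuousOn
      (fun y => (chartMatrix h (chartAt (EuclideanSpace ℝ (Fin n)) x) y).det)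
      (chartAt (EuclideanSpace ℝ (Fin n)) x).target) :
    IsLocallyFiniteMeasure (volumeMeasure h) := by
  refine ⟨fun x => ?_⟩
  set e := chartAt (EuclideanSpace ℝ (Fin n)) x
  have hx : x ∈ e.source := mem_chart_source _ x
  have hex : e.target ∈ 𝓝 (e x) := e.open_target.mem_nhds (e.map_source hx)
  have hcx : ContinuousAt (fun y => Real.sqrt (chartMatrix h e y).det) (e x) :=
    (Real.continuous_sqrt.comp_continuousOn (hc x)).continuousAt hex
  set C := Real.sqrt (chartMatrix h e (e x)).det + 1
  have hb : ∀ᶠ y in 𝓝 (e x), Real.sqrt (chartMatrix h e y).det < C :=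
    hcx.eventually_lt continuousAt_const (lt_add_one _)
  obtain ⟨r, hr, hrb⟩ := Metric.eventually_nhds_iff_ball.1 hb
  refine ⟨e.source ∩ e ⁻¹' Metric.ball (e x) r,
    e.continuousAt hx |>.preimage_mem_nhds (Metric.ball_mem_nhds _ hr) |>
      Filter.inter_mem (e.open_source.mem_nhds hx), ?_⟩
  have hm : MeasurableSet (e.source ∩ e ⁻¹' Metric.ball (e x) r) :=
    (e.isOpen_inter_preimage Metric.isOpen_ball).measurableSet
  rw [volumeMeasure_apply_of_subset hh x hm inter_subset_left, chartVolume_apply _ _ hm]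
  have hsub : e.target ∩ e.symm ⁻¹' (e.source ∩ e ⁻¹' Metric.ball (e x) r)
      ⊆ Metric.ball (e x) r := by
    rintro y ⟨hy, -, hyr⟩
    simpa [e.right_inv hy] using hyr
  calc ∫⁻ y in e.target ∩ e.symm ⁻¹' (e.source ∩ e ⁻¹' Metric.ball (e x) r),
        ENNReal.ofReal (Real.sqrt (chartMatrix h e y).det)
      ≤ ∫⁻ y in Metric.ball (e x) r, ENNReal.ofReal (Real.sqrt (chartMatrix h e y).det) :=
        lintegral_mono_set hsub
    _ ≤ ∫⁻ _ in Metric.ball (e x) r, ENNReal.ofReal C :=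
        setLIntegral_mono measurable_const fun y hy =>
          ENNReal.ofReal_le_ofReal (hrb y hy).le
    _ < ⊤ := by
        rw [setLIntegral_const]
        exact ENNReal.mul_lt_top ENNReal.ofReal_lt_top measure_ball_lt_top

/-- The volume measure of a nondegenerate form charges nonempty open sets. -/
theorem isOpenPosMeasure_volumeMeasure [IsManifold (𝓡 n) ∞ M] {h : FormField (𝓡 n) M}
    (hh : h.IsBilinear)
    (hc : ∀ x : M, ContinuousOn
      (fun y => (chartMatrix h (chartAt (EuclideanSpace ℝ (Fin n)) x) y).det)
      (chartAt (EuclideanSpace ℝ (Fin n)) x).target)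
    (hpos : ∀ x : M, ∀ y ∈ (chartAt (EuclideanSpace ℝ (Fin n)) x).target,
      0 < (chartMatrix h (chartAt (EuclideanSpace ℝ (Fin n)) x) y).det) :
    (volumeMeasure h).IsOpenPosMeasure := by
  refine ⟨fun U hU ⟨x, hxU⟩ h0 => ?_⟩
  set e := chartAt (EuclideanSpace ℝ (Fin n)) x
  have hx : x ∈ e.source := mem_chart_source _ x
  have hm : MeasurableSet (U ∩ e.source) := (hU.inter e.open_source).measurableSet
  have h1 : volumeMeasure h (U ∩ e.source) = 0 := measure_mono_null inter_subset_left h0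
  rw [volumeMeasure_apply_of_subset hh x hm inter_subset_right, chartVolume_apply _ _ hm] at h1
  have hopen : IsOpen (e.target ∩ e.symm ⁻¹' (U ∩ e.source)) :=
    e.isOpen_inter_preimage_symm (hU.inter e.open_source)
  have hdens : AEMeasurable (fun y => ENNReal.ofReal (Real.sqrt (chartMatrix h e y).det))
      (volume.restrict (e.target ∩ e.symm ⁻¹' (U ∩ e.source))) :=
    ((Real.continuous_sqrt.comp_continuousOn ((hc x).mono inter_subset_left)).aemeasurable
      hopen.measurableSet).ennreal_ofReal
  rw [lintegral_eq_zero_iff' hdens] at h1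
  have h2 : ∀ᵐ y ∂(volume.restrict (e.target ∩ e.symm ⁻¹' (U ∩ e.source))), False := by
    filter_upwards [h1, ae_restrict_mem hopen.measurableSet] with y hy hy'
    have := Real.sqrt_pos.2 (hpos x y hy'.1)
    simp only [Pi.zero_apply, ENNReal.ofReal_eq_zero] at hy
    linarith
  rw [Filter.eventually_false_iff_eq_bot, ae_eq_bot, Measure.restrict_eq_zero] at h2
  refine hopen.measure_ne_zero volume ⟨e x, e.map_source hx, ?_⟩ h2
  simp [e.left_inv hx, hxU, hx]

end Volume

/-! ### The Gauss equation in coordinates -/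

section Coordinates

variable {n : ℕ} {W : Type*} [NormedAddCommGroup W] [NormedSpace ℝ W]
  {U : Set (EuclideanSpace ℝ (Fin n))}

/-- The derivative of `F` in the constant direction `v`, as a function. -/
def dirDeriv (v : EuclideanSpace ℝ (Fin n)) (F : EuclideanSpace ℝ (Fin n) → W) :
    EuclideanSpace ℝ (Fin n) → W :=
  fun y => fderiv ℝ F y v

theorem contDiffOn_dirDeriv (hU : IsOpen U) {F : EuclideanSpace ℝ (Fin n) → W}
    (hF : ContDiffOn ℝ ∞ F U) (v : EuclideanSpace ℝ (Fin n)) :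
    ContDiffOn ℝ ∞ (dirDeriv v F) U :=
  (hF.fderiv_of_isOpen hU (m := ∞) (by simp)).clm_apply contDiffOn_const

theorem ContDiffOn.differentiableAt_of_isOpen (hU : IsOpen U) {F : EuclideanSpace ℝ (Fin n) → W}
    (hF : ContDiffOn ℝ ∞ F U) {y : EuclideanSpace ℝ (Fin n)} (hy : y ∈ U) :
    DifferentiableAt ℝ F y :=
  (hF.contDiffAt (hU.mem_nhds hy)).differentiableAt (by simp)

theorem dirDeriv_comm (hU : IsOpen U) {F : EuclideanSpace ℝ (Fin n) → W}
    (hF : ContDiffOn ℝ ∞ F U) (v w : EuclideanSpace ℝ (Fin n)) {y : EuclideanSpace ℝ (Fin n)}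
    (hy : y ∈ U) : dirDeriv w (dirDeriv v F) y = dirDeriv v (dirDeriv w F) y := by
  have hF' := hF.contDiffAt (hU.mem_nhds hy)
  have hd : DifferentiableAt ℝ (fderiv ℝ F) y :=
    (hF'.fderiv_right (m := 1) (by norm_cast)).differentiableAt (by simp)
  have h1 : ∀ v w : EuclideanSpace ℝ (Fin n),
      dirDeriv w (dirDeriv v F) y = fderiv ℝ (fderiv ℝ F) y w v := fun v w => by
    have := (hd.hasFDerivAt.clm_apply (hasFDerivAt_const v y)).fderiv
    unfold dirDeriv
    rw [this]
    simp
  rw [h1, h1]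
  refine (hF'.isSymmSndFDerivAt ?_) w v
  rw [minSmoothness_of_isRCLikeNormedField]
  exact WithTop.coe_le_coe.2 (le_top : (2 : ℕ∞) ≤ ⊤)

theorem dirDeriv_congr (hU : IsOpen U) {F F' : EuclideanSpace ℝ (Fin n) → W}
    (h : ∀ y ∈ U, F y = F' y) (v : EuclideanSpace ℝ (Fin n)) {y : EuclideanSpace ℝ (Fin n)}
    (hy : y ∈ U) : dirDeriv v F y = dirDeriv v F' y := by
  have : F =ᶠ[𝓝 y] F' := Filter.eventuallyEq_of_mem (hU.mem_nhds hy) h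
  simp only [dirDeriv, this.fderiv_eq]

theorem dirDeriv_lorentz {F F' : EuclideanSpace ℝ (Fin n) → Minkowski n}
    {y : EuclideanSpace ℝ (Fin n)} (hF : DifferentiableAt ℝ F y) (hF' : DifferentiableAt ℝ F' y)
    (v : EuclideanSpace ℝ (Fin n)) :
    dirDeriv v (fun z => lorentz (F z) (F' z)) y
      = lorentz (dirDeriv v F y) (F' y) + lorentz (F y) (dirDeriv v F' y) := by
  have h1 := ((lorentzL n).hasFDerivAt_of_bilinear hF.hasFDerivAt hF'.hasFDerivAt).fderiv
  simp only [lorentzL_apply] at h1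
  simp only [dirDeriv, h1]
  simp [ContinuousLinearMap.precompR, ContinuousLinearMap.precompL, add_comm]

theorem contDiffOn_lorentz {F F' : EuclideanSpace ℝ (Fin n) → Minkowski n}
    (hF : ContDiffOn ℝ ∞ F U) (hF' : ContDiffOn ℝ ∞ F' U) :
    ContDiffOn ℝ ∞ (fun z => lorentz (F z) (F' z)) U :=
  (lorentzL n).isBoundedBilinearMap.contDiff.comp_contDiffOn (hF.prodMk hF')

theorem dirDeriv_eq_sum (F : EuclideanSpace ℝ (Fin n) → W) (v y : EuclideanSpace ℝ (Fin n)) :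
    dirDeriv v F y = ∑ i, v i • dirDeriv (stdVec i) F y := by
  have : v = ∑ i, v i • stdVec i := by
    ext j
    simp [stdVec, Pi.single_apply]
  conv_lhs => rw [this]
  simp [dirDeriv]

theorem contDiffOn_matrix_det {V ι : Type*} [NormedAddCommGroup V] [NormedSpace ℝ V] [Fintype ι]
    [DecidableEq ι] {S : Set V} {G : V → Matrix ι ι ℝ}
    (hG : ∀ i j, ContDiffOn ℝ ∞ (fun y => G y i j) S) : ContDiffOn ℝ ∞ (fun y => (G y).det) S := by
  simp only [Matrix.det_apply']
  exact ContDiffOn.sum fun σ _ => contDiffOn_const.mul (contDiffOn_prod fun i _ => hG _ _)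

/-- The entries of the inverse of a smooth field of matrices are smooth. -/
theorem contDiffOn_matrix_inv {G : EuclideanSpace ℝ (Fin n) → Matrix (Fin n) (Fin n) ℝ}
    (hG : ∀ i j, ContDiffOn ℝ ∞ (fun y => G y i j) U) (hdet : ∀ y ∈ U, (G y).det ≠ 0)
    (i j : Fin n) : ContDiffOn ℝ ∞ (fun y => (G y)⁻¹ i j) U := by
  have hadj : ContDiffOn ℝ ∞ (fun y => (G y).adjugate i j) U := by
    simp only [Matrix.adjugate_apply]
    refine contDiffOn_matrix_det fun a b => ?_
    by_cases ha : a = j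
    · subst ha
      simp only [Matrix.updateRow_self]
      exact contDiffOn_const
    · simp only [Matrix.updateRow_ne ha]
      exact hG a b
  simp only [Matrix.inv_def, Matrix.smul_apply, smul_eq_mul, Ring.inverse_eq_inv']
  exact ((contDiffOn_matrix_det hG).inv hdet).mul hadj

/-- A coordinate patch `f` of a spacelike submanifold of codimension two contained in the
light-cone, with its dual map `k`. -/
structure LightconePatch (U : Set (EuclideanSpace ℝ (Fin n)))
    (f k : EuclideanSpace ℝ (Fin n) → Minkowski n) : Prop where
  isOpen : IsOpen U
  smooth : ContDiffOn ℝ ∞ f U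
  smooth_dual : ContDiffOn ℝ ∞ k U
  null : ∀ y ∈ U, lorentz (f y) (f y) = 0
  null_dual : ∀ y ∈ U, lorentz (k y) (k y) = 0
  inner_dual : ∀ y ∈ U, lorentz (f y) (k y) = 1
  tangent_dual : ∀ y ∈ U, ∀ v, lorentz (dirDeriv v f y) (k y) = 0
  spacelike : ∀ y ∈ U, ∀ v, v ≠ 0 → 0 < lorentz (dirDeriv v f y) (dirDeriv v f y)

/-- The matrix of the metric induced by `f`. -/
def gramMatrix (f : EuclideanSpace ℝ (Fin n) → Minkowski n) (y : EuclideanSpace ℝ (Fin n)) :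
    Matrix (Fin n) (Fin n) ℝ :=
  Matrix.of fun i j => lorentz (dirDeriv (stdVec i) f y) (dirDeriv (stdVec j) f y)

theorem gramMatrix_apply (f : EuclideanSpace ℝ (Fin n) → Minkowski n)
    (y : EuclideanSpace ℝ (Fin n)) (i j : Fin n) :
    gramMatrix f y i j = lorentz (dirDeriv (stdVec i) f y) (dirDeriv (stdVec j) f y) := rfl

theorem gramMatrix_isSymm (f : EuclideanSpace ℝ (Fin n) → Minkowski n)
    (y : EuclideanSpace ℝ (Fin n)) : (gramMatrix f y).IsSymm := by
  ext i j
  exact lorentz_comm _ _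

theorem contDiffOn_gramMatrix (hU : IsOpen U) {f : EuclideanSpace ℝ (Fin n) → Minkowski n}
    (hf : ContDiffOn ℝ ∞ f U) (i j : Fin n) :
    ContDiffOn ℝ ∞ (fun y => gramMatrix f y i j) U :=
  contDiffOn_lorentz (contDiffOn_dirDeriv hU hf _) (contDiffOn_dirDeriv hU hf _)

theorem gramMatrix_posDef {f : EuclideanSpace ℝ (Fin n) → Minkowski n}
    {y : EuclideanSpace ℝ (Fin n)}
    (hpos : ∀ v, v ≠ 0 → 0 < lorentz (dirDeriv v f y) (dirDeriv v f y)) :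
    (gramMatrix f y).PosDef := by
  refine Matrix.PosDef.of_dotProduct_mulVec_pos ?_ ?_
  · ext i j
    simpa using congrFun (congrFun (gramMatrix_isSymm f y) i) j
  · intro x hx
    have hx' : WithLp.toLp 2 x ≠ 0 := by simpa using hx
    have h1 := hpos _ hx'
    rw [dirDeriv_eq_sum, lorentz_sum_left] at h1
    simp only [lorentz_sum_right, lorentz_smul_left, lorentz_smul_right] at h1
    simpa [dotProduct, Matrix.mulVec, gramMatrix_apply, Finset.mul_sum, mul_comm,
      mul_left_comm] using h1

namespace LightconePatch

variable {f k : EuclideanSpace ℝ (Fin n) → Minkowski n} {y : EuclideanSpace ℝ (Fin n)}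

theorem differentiableAt (hf : LightconePatch U f k) (hy : y ∈ U) : DifferentiableAt ℝ f y :=
  ContDiffOn.differentiableAt_of_isOpen hf.isOpen hf.smooth hy

theorem differentiableAt_dual (hf : LightconePatch U f k) (hy : y ∈ U) : DifferentiableAt ℝ k y :=
  ContDiffOn.differentiableAt_of_isOpen hf.isOpen hf.smooth_dual hy

theorem differentiableAt_dirDeriv (hf : LightconePatch U f k) (hy : y ∈ U)
    (v : EuclideanSpace ℝ (Fin n)) : DifferentiableAt ℝ (dirDeriv v f) y :=
  ContDiffOn.differentiableAt_of_isOpen hf.isOpen (contDiffOn_dirDeriv hf.isOpen hf.smooth v) hy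

/-- A relation `⟨F, F'⟩ = c` on `U` can be differentiated. -/
theorem add_eq_zero_of_lorentz_const (hU : IsOpen U)
    {F F' : EuclideanSpace ℝ (Fin n) → Minkowski n} {c : ℝ}
    (h : ∀ y ∈ U, lorentz (F y) (F' y) = c) (hy : y ∈ U) (hF : DifferentiableAt ℝ F y)
    (hF' : DifferentiableAt ℝ F' y) (v : EuclideanSpace ℝ (Fin n)) :
    lorentz (dirDeriv v F y) (F' y) + lorentz (F y) (dirDeriv v F' y) = 0 := by
  rw [← dirDeriv_lorentz hF hF',
    dirDeriv_congr hU (F' := fun _ => c) (fun z hz => h z hz) v hy]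
  simp [dirDeriv]

theorem tangent_self (hf : LightconePatch U f k) (hy : y ∈ U) (v : EuclideanSpace ℝ (Fin n)) :
    lorentz (dirDeriv v f y) (f y) = 0 := by
  have := add_eq_zero_of_lorentz_const hf.isOpen hf.null hy (hf.differentiableAt hy)
    (hf.differentiableAt hy) v
  rw [lorentz_comm (f y)] at this
  linarith

theorem dual_tangent_dual (hf : LightconePatch U f k) (hy : y ∈ U)
    (v : EuclideanSpace ℝ (Fin n)) : lorentz (k y) (dirDeriv v k y) = 0 := by
  have := add_eq_zero_of_lorentz_const hf.isOpen hf.null_dual hy (hf.differentiableAt_dual hy)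
    (hf.differentiableAt_dual hy) v
  rw [lorentz_comm (dirDeriv v k y)] at this
  linarith

theorem self_tangent_dual (hf : LightconePatch U f k) (hy : y ∈ U)
    (v : EuclideanSpace ℝ (Fin n)) : lorentz (f y) (dirDeriv v k y) = 0 := by
  have := add_eq_zero_of_lorentz_const hf.isOpen hf.inner_dual hy (hf.differentiableAt hy)
    (hf.differentiableAt_dual hy) v
  rw [hf.tangent_dual y hy v] at this
  linarith

theorem second_self (hf : LightconePatch U f k) (hy : y ∈ U) (v w : EuclideanSpace ℝ (Fin n)) :
    lorentz (dirDeriv w (dirDeriv v f) y) (f y)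
      = -lorentz (dirDeriv v f y) (dirDeriv w f y) := by
  have := add_eq_zero_of_lorentz_const hf.isOpen (fun z hz => hf.tangent_self hz v) hy
    (hf.differentiableAt_dirDeriv hy v) (hf.differentiableAt hy) w
  linarith

theorem second_dual (hf : LightconePatch U f k) (hy : y ∈ U) (v w : EuclideanSpace ℝ (Fin n)) :
    lorentz (dirDeriv w (dirDeriv v f) y) (k y)
      = -lorentz (dirDeriv v f y) (dirDeriv w k y) := by
  have := add_eq_zero_of_lorentz_const hf.isOpen (fun z hz => hf.tangent_dual z hz v) hy
    (hf.differentiableAt_dirDeriv hy v) (hf.differentiableAt_dual hy) w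
  linarith

/-- The form `⟨df, dk⟩` is symmetric. -/
theorem lorentz_dirDeriv_dual_comm (hf : LightconePatch U f k) (hy : y ∈ U)
    (v w : EuclideanSpace ℝ (Fin n)) :
    lorentz (dirDeriv v f y) (dirDeriv w k y) = lorentz (dirDeriv w f y) (dirDeriv v k y) := by
  have h1 := hf.second_dual hy v w
  have h2 := hf.second_dual hy w v
  rw [dirDeriv_comm hf.isOpen hf.smooth v w hy] at h1
  linarith

theorem exists_eq (hf : LightconePatch U f k) (hy : y ∈ U) (z : Minkowski n) :
    ∃ v, ∃ a b : ℝ, z = dirDeriv v f y + a • f y + b • k y :=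
  exists_eq_add_smul_add_smul (fderiv ℝ f y).toLinearMap (hf.spacelike y hy) (hf.null y hy)
    (hf.tangent_self hy) (hf.null_dual y hy) (hf.inner_dual y hy) (hf.tangent_dual y hy) z

/-- The first Christoffel identity: `⟨∂_i ∂_j f, ∂_l f⟩` in terms of the metric. -/
theorem two_mul_second_tangent (hf : LightconePatch U f k) (hy : y ∈ U) (i j l : Fin n) :
    2 * lorentz (dirDeriv (stdVec j) (dirDeriv (stdVec i) f) y) (dirDeriv (stdVec l) f y)
      = partialDeriv i (fun z => gramMatrix f z j l) y
        + partialDeriv j (fun z => gramMatrix f z i l) y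
        - partialDeriv l (fun z => gramMatrix f z i j) y := by
  have h : ∀ a b c : Fin n, partialDeriv a (fun z => gramMatrix f z b c) y
      = lorentz (dirDeriv (stdVec a) (dirDeriv (stdVec b) f) y) (dirDeriv (stdVec c) f y)
        + lorentz (dirDeriv (stdVec b) f y) (dirDeriv (stdVec a) (dirDeriv (stdVec c) f) y) :=
    fun a b c => dirDeriv_lorentz (hf.differentiableAt_dirDeriv hy _)
      (hf.differentiableAt_dirDeriv hy _) _
  have hc : ∀ a b : Fin n, dirDeriv (stdVec a) (dirDeriv (stdVec b) f) y
      = dirDeriv (stdVec b) (dirDeriv (stdVec a) f) y :=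
    fun a b => dirDeriv_comm hf.isOpen hf.smooth _ _ hy
  rw [h, h, h, hc i j, hc l i, hc l j,
    lorentz_comm (dirDeriv (stdVec j) f y) (dirDeriv (stdVec i) (dirDeriv (stdVec l) f) y),
    lorentz_comm (dirDeriv (stdVec i) f y) (dirDeriv (stdVec j) (dirDeriv (stdVec l) f) y)]
  ring

/-- The tangential coefficient of a vector along `∂_m f`. -/
def tangentCoeff (f : EuclideanSpace ℝ (Fin n) → Minkowski n) (y : EuclideanSpace ℝ (Fin n))
    (m : Fin n) : Minkowski n →ₗ[ℝ] ℝ :=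
  ∑ a, (gramMatrix f y)⁻¹ m a • (lorentzL n (dirDeriv (stdVec a) f y)).toLinearMap

theorem tangentCoeff_apply (m : Fin n) (w : Minkowski n) :
    tangentCoeff f y m w
      = ∑ a, (gramMatrix f y)⁻¹ m a * lorentz (dirDeriv (stdVec a) f y) w := by
  simp [tangentCoeff, LinearMap.sum_apply]

theorem inv_mul_gramMatrix (hf : LightconePatch U f k) (hy : y ∈ U) :
    (gramMatrix f y)⁻¹ * gramMatrix f y = 1 :=
  Matrix.nonsing_inv_mul _ (gramMatrix_posDef (hf.spacelike y hy)).det_pos.ne'.isUnit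

theorem tangentCoeff_tangent (hf : LightconePatch U f k) (hy : y ∈ U) (m i : Fin n) :
    tangentCoeff f y m (dirDeriv (stdVec i) f y) = (1 : Matrix (Fin n) (Fin n) ℝ) m i := by
  rw [tangentCoeff_apply, ← hf.inv_mul_gramMatrix hy, Matrix.mul_apply]
  rfl

theorem tangentCoeff_self (hf : LightconePatch U f k) (hy : y ∈ U) (m : Fin n) :
    tangentCoeff f y m (f y) = 0 := by
  simp [tangentCoeff_apply, hf.tangent_self hy]

theorem tangentCoeff_dual (hf : LightconePatch U f k) (hy : y ∈ U) (m : Fin n) :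
    tangentCoeff f y m (k y) = 0 := by
  simp [tangentCoeff_apply, hf.tangent_dual y hy]

/-- The Christoffel symbols are the tangential coefficients of the second derivatives. -/
theorem tangentCoeff_second (hf : LightconePatch U f k) (hy : y ∈ U) (m i j : Fin n) :
    tangentCoeff f y m (dirDeriv (stdVec j) (dirDeriv (stdVec i) f) y)
      = christoffel (gramMatrix f) m i j y := by
  rw [tangentCoeff_apply, christoffel, Finset.mul_sum]
  refine Finset.sum_congr rfl fun l _ => ?_
  rw [← hf.two_mul_second_tangent hy, lorentz_comm]
  ring

theorem eq_sum_tangentCoeff (hf : LightconePatch U f k) (hy : y ∈ U) (z : Minkowski n) :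
    z = ∑ m, tangentCoeff f y m z • dirDeriv (stdVec m) f y + lorentz z (k y) • f y
      + lorentz z (f y) • k y := by
  obtain ⟨v, a, b, rfl⟩ := hf.exists_eq hy z
  have hv := dirDeriv_eq_sum f v y
  have h1 : ∀ m, tangentCoeff f y m (dirDeriv v f y + a • f y + b • k y) = v m := fun m => by
    rw [map_add, map_add, map_smul, map_smul, hf.tangentCoeff_self hy, hf.tangentCoeff_dual hy, hv,
      map_sum]
    simp [hf.tangentCoeff_tangent hy, Matrix.one_apply]
  simp only [h1, lorentz_add_left, lorentz_smul_left, hf.tangent_self hy, hf.tangent_dual y hy,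
    hf.null y hy, hf.null_dual y hy, hf.inner_dual y hy, lorentz_comm (k y) (f y), ← hv]
  simp

theorem contDiffOn_christoffel (hf : LightconePatch U f k) (m i j : Fin n) :
    ContDiffOn ℝ ∞ (christoffel (gramMatrix f) m i j) U := by
  have hG := contDiffOn_gramMatrix hf.isOpen hf.smooth
  refine contDiffOn_const.mul (ContDiffOn.sum fun l _ => ?_)
  refine (contDiffOn_matrix_inv hG
    (fun y hy => (gramMatrix_posDef (hf.spacelike y hy)).det_pos.ne') m l).mul ?_
  exact ((contDiffOn_dirDeriv hf.isOpen (hG j l) _).add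
    (contDiffOn_dirDeriv hf.isOpen (hG i l) _)).sub (contDiffOn_dirDeriv hf.isOpen (hG i j) _)

/-- The Gauss formula: the normal part of `∂_i ∂_j f` is a combination of `f` and `k`. -/
theorem second_eq (hf : LightconePatch U f k) (hy : y ∈ U) (i j : Fin n) :
    dirDeriv (stdVec j) (dirDeriv (stdVec i) f) y
      = ∑ m, christoffel (gramMatrix f) m i j y • dirDeriv (stdVec m) f y
        - lorentz (dirDeriv (stdVec i) f y) (dirDeriv (stdVec j) k y) • f y
        - gramMatrix f y i j • k y := by
  conv_lhs => rw [hf.eq_sum_tangentCoeff hy (dirDeriv (stdVec j) (dirDeriv (stdVec i) f) y)]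
  rw [hf.second_self hy, hf.second_dual hy, neg_smul, neg_smul, ← sub_eq_add_neg, ← sub_eq_add_neg]
  simp only [hf.tangentCoeff_second hy]
  rfl

/-- The tangential part of the third derivatives, from differentiating the Gauss formula. -/
theorem tangentCoeff_third (hf : LightconePatch U f k) (hy : y ∈ U) (m i j l : Fin n) :
    tangentCoeff f y m
        (dirDeriv (stdVec l) (dirDeriv (stdVec j) (dirDeriv (stdVec i) f)) y)
      = partialDeriv l (christoffel (gramMatrix f) m i j) y
        + ∑ a, christoffel (gramMatrix f) a i j y * christoffel (gramMatrix f) m a l y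
        - lorentz (dirDeriv (stdVec i) f y) (dirDeriv (stdVec j) k y)
          * (1 : Matrix (Fin n) (Fin n) ℝ) m l
        - gramMatrix f y i j * tangentCoeff f y m (dirDeriv (stdVec l) k y) := by
  have hdf := hf.differentiableAt hy
  have hdk := hf.differentiableAt_dual hy
  have hdc : ∀ a, HasFDerivAt (christoffel (gramMatrix f) a i j)
      (fderiv ℝ (christoffel (gramMatrix f) a i j) y) y := fun a =>
    (ContDiffOn.differentiableAt_of_isOpen hf.isOpen
      (hf.contDiffOn_christoffel a i j) hy).hasFDerivAt
  have hdB : DifferentiableAt ℝ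
      (fun z => lorentz (dirDeriv (stdVec i) f z) (dirDeriv (stdVec j) k z)) y :=
    ContDiffOn.differentiableAt_of_isOpen hf.isOpen
      (contDiffOn_lorentz (contDiffOn_dirDeriv hf.isOpen hf.smooth _)
        (contDiffOn_dirDeriv hf.isOpen hf.smooth_dual _)) hy
  have hdG : DifferentiableAt ℝ (fun z => gramMatrix f z i j) y :=
    ContDiffOn.differentiableAt_of_isOpen hf.isOpen
      (contDiffOn_gramMatrix hf.isOpen hf.smooth i j) hy
  have h1 := ((HasFDerivAt.fun_sum (u := Finset.univ) fun a _ => (hdc a).smul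
    (hf.differentiableAt_dirDeriv hy (stdVec a)).hasFDerivAt).sub
      (hdB.hasFDerivAt.smul hdf.hasFDerivAt)).sub (hdG.hasFDerivAt.smul hdk.hasFDerivAt)
  rw [dirDeriv_congr hf.isOpen (fun z hz => hf.second_eq hz i j) (stdVec l) hy, dirDeriv]
  erw [h1.fderiv]
  have hs : ∀ a, tangentCoeff f y m (fderiv ℝ (dirDeriv (stdVec a) f) y (stdVec l))
      = christoffel (gramMatrix f) m a l y := fun a => hf.tangentCoeff_second hy m a l
  have ht : tangentCoeff f y m (fderiv ℝ f y (stdVec l)) = (1 : Matrix (Fin n) (Fin n) ℝ) m l :=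
    hf.tangentCoeff_tangent hy m l
  simp only [sub_apply, add_apply, sum_apply, smul_apply,
    ContinuousLinearMap.smulRight_apply, map_sub, map_add, map_sum, map_smul, smul_eq_mul,
    hs, ht, hf.tangentCoeff_tangent hy, hf.tangentCoeff_self hy, hf.tangentCoeff_dual hy,
    Finset.sum_add_distrib]
  simp [Matrix.one_apply, partialDeriv, dirDeriv]
  ring

theorem christoffel_comm (hf : LightconePatch U f k) (hy : y ∈ U) (m i j : Fin n) :
    christoffel (gramMatrix f) m i j y = christoffel (gramMatrix f) m j i y := by
  rw [← hf.tangentCoeff_second hy, ← hf.tangentCoeff_second hy,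
    dirDeriv_comm hf.isOpen hf.smooth _ _ hy]

/-- The matrix of the form `⟨df, dk⟩`. -/
def dualGram (f k : EuclideanSpace ℝ (Fin n) → Minkowski n) (y : EuclideanSpace ℝ (Fin n)) :
    Matrix (Fin n) (Fin n) ℝ :=
  Matrix.of fun i j => lorentz (dirDeriv (stdVec i) f y) (dirDeriv (stdVec j) k y)

/-- The matrix of the shape operator: the tangential coefficients of `dk`. -/
def shapeMatrix (f k : EuclideanSpace ℝ (Fin n) → Minkowski n) (y : EuclideanSpace ℝ (Fin n)) :
    Matrix (Fin n) (Fin n) ℝ :=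
  (gramMatrix f y)⁻¹ * dualGram f k y

theorem tangentCoeff_dirDeriv_dual (l i : Fin n) :
    tangentCoeff f y l (dirDeriv (stdVec i) k y) = shapeMatrix f k y l i := by
  rw [tangentCoeff_apply, shapeMatrix, Matrix.mul_apply]
  rfl

theorem contDiffOn_shapeMatrix (hf : LightconePatch U f k) (i j : Fin n) :
    ContDiffOn ℝ ∞ (fun y => shapeMatrix f k y i j) U := by
  simp only [shapeMatrix, Matrix.mul_apply]
  exact ContDiffOn.sum fun a _ => (contDiffOn_matrix_inv
    (contDiffOn_gramMatrix hf.isOpen hf.smooth)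
    (fun y hy => (gramMatrix_posDef (hf.spacelike y hy)).det_pos.ne') i a).mul
      (contDiffOn_lorentz (contDiffOn_dirDeriv hf.isOpen hf.smooth _)
        (contDiffOn_dirDeriv hf.isOpen hf.smooth_dual _))

/-- The Weingarten formula: `dk` is tangential. -/
theorem dirDeriv_dual_eq (hf : LightconePatch U f k) (hy : y ∈ U) (j : Fin n) :
    dirDeriv (stdVec j) k y = ∑ i, shapeMatrix f k y i j • dirDeriv (stdVec i) f y := by
  conv_lhs => rw [hf.eq_sum_tangentCoeff hy (dirDeriv (stdVec j) k y)]
  simp only [tangentCoeff_dirDeriv_dual]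
  rw [lorentz_comm, hf.dual_tangent_dual hy, lorentz_comm _ (f y), hf.self_tangent_dual hy]
  simp

/-- The Gauss equation. -/
theorem curvature_eq (hf : LightconePatch U f k) (hy : y ∈ U) (l m i j : Fin n) :
    curvature (gramMatrix f) l m i j y
      = dualGram f k y j m * (1 : Matrix (Fin n) (Fin n) ℝ) l i
        + gramMatrix f y j m * shapeMatrix f k y l i
        - dualGram f k y i m * (1 : Matrix (Fin n) (Fin n) ℝ) l j
        - gramMatrix f y i m * shapeMatrix f k y l j := by
  have h1 := hf.tangentCoeff_third hy l j m i
  have h2 := hf.tangentCoeff_third hy l i m j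
  -- both are the tangential part of the third derivative in the directions `i`, `j`, `m`
  have h3 : dirDeriv (stdVec i) (dirDeriv (stdVec m) (dirDeriv (stdVec j) f)) y
      = dirDeriv (stdVec j) (dirDeriv (stdVec m) (dirDeriv (stdVec i) f)) y := by
    rw [dirDeriv_congr hf.isOpen
        (fun z hz => dirDeriv_comm hf.isOpen hf.smooth (stdVec j) (stdVec m) hz) _ hy,
      dirDeriv_congr hf.isOpen
        (fun z hz => dirDeriv_comm hf.isOpen hf.smooth (stdVec i) (stdVec m) hz) _ hy,
      dirDeriv_comm hf.isOpen (contDiffOn_dirDeriv hf.isOpen hf.smooth _) _ _ hy]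
  rw [h3, h2] at h1
  simp only [tangentCoeff_dirDeriv_dual] at h1
  have h4 : ∀ a b, christoffel (gramMatrix f) l a b y = christoffel (gramMatrix f) l b a y :=
    hf.christoffel_comm hy l
  simp only [curvature, h4 i, h4 j, Finset.sum_sub_distrib]
  simp only [mul_comm (christoffel (gramMatrix f) _ _ j y),
    mul_comm (christoffel (gramMatrix f) _ _ i y)] at h1 ⊢
  simp only [dualGram, Matrix.of_apply]
  linarith

theorem gramMatrix_mul_shapeMatrix (hf : LightconePatch U f k) (hy : y ∈ U) :
    gramMatrix f y * shapeMatrix f k y = dualGram f k y := by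
  rw [shapeMatrix, ← Matrix.mul_assoc, Matrix.mul_nonsing_inv _
    (gramMatrix_posDef (hf.spacelike y hy)).det_pos.ne'.isUnit, Matrix.one_mul]

/-- The Ricci tensor is a combination of `⟨df, dk⟩` and the metric. -/
theorem ricci_eq (hf : LightconePatch U f k) (hy : y ∈ U) (i j : Fin n) :
    ricci (gramMatrix f) i j y
      = (n - 2 : ℝ) * dualGram f k y i j + (shapeMatrix f k y).trace * gramMatrix f y i j := by
  have h1 : ∑ a, gramMatrix f y a j * shapeMatrix f k y a i = dualGram f k y i j := by
    have h2 := congrFun (congrFun (hf.gramMatrix_mul_shapeMatrix hy) j) i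
    rw [Matrix.mul_apply] at h2
    rw [show dualGram f k y i j = dualGram f k y j i from
      hf.lorentz_dirDeriv_dual_comm hy _ _, ← h2]
    exact Finset.sum_congr rfl fun a _ => by rw [(gramMatrix_isSymm f y).apply]
  simp only [ricci, hf.curvature_eq hy, Finset.sum_sub_distrib, Finset.sum_add_distrib, h1]
  simp [Matrix.one_apply, Matrix.trace, ← Finset.mul_sum]
  ring

/-- The scalar curvature is `2 (n - 1)` times the trace of the shape operator. -/
theorem sum_inv_mul_ricci (hf : LightconePatch U f k) (hy : y ∈ U) :
    ∑ i, ∑ j, (gramMatrix f y)⁻¹ i j * ricci (gramMatrix f) i j y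
      = 2 * (n - 1 : ℝ) * (shapeMatrix f k y).trace := by
  have h1 : ∑ i, ∑ j, (gramMatrix f y)⁻¹ i j * dualGram f k y i j
      = (shapeMatrix f k y).trace := by
    simp only [shapeMatrix, Matrix.trace, Matrix.diag_apply, Matrix.mul_apply]
    refine Finset.sum_congr rfl fun i _ => Finset.sum_congr rfl fun j _ => ?_
    rw [show dualGram f k y i j = dualGram f k y j i from hf.lorentz_dirDeriv_dual_comm hy _ _]
  have h2 : ∑ i, ∑ j, (gramMatrix f y)⁻¹ i j * gramMatrix f y i j = n := by
    have h3 := congrArg Matrix.trace (hf.inv_mul_gramMatrix hy)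
    simp only [Matrix.trace_one, Fintype.card_fin] at h3
    rw [← h3]
    simp only [Matrix.trace, Matrix.diag_apply, Matrix.mul_apply]
    refine Finset.sum_congr rfl fun i _ => Finset.sum_congr rfl fun j _ => ?_
    rw [(gramMatrix_isSymm f y).apply]
  have h4 : ∀ i j, (gramMatrix f y)⁻¹ i j * ricci (gramMatrix f) i j y
      = (n - 2 : ℝ) * ((gramMatrix f y)⁻¹ i j * dualGram f k y i j)
        + (shapeMatrix f k y).trace * ((gramMatrix f y)⁻¹ i j * gramMatrix f y i j) :=
    fun i j => by rw [hf.ricci_eq hy]; ring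
  simp only [h4, Finset.sum_add_distrib, ← Finset.mul_sum, h1, h2]
  ring

end LightconePatch

/-- The Ricci tensor depends only on the germ of the metric. -/
theorem ricci_congr {G G' : EuclideanSpace ℝ (Fin n) → Matrix (Fin n) (Fin n) ℝ} (hU : IsOpen U)
    (h : ∀ y ∈ U, G y = G' y) {y : EuclideanSpace ℝ (Fin n)} (hy : y ∈ U) (i j : Fin n) :
    ricci G i j y = ricci G' i j y := by
  have h1 : ∀ a b c, ∀ z ∈ U, christoffel G a b c z = christoffel G' a b c z := by
    intro a b c z hz
    have h2 : ∀ d i j, partialDeriv d (fun z => G z i j) z = partialDeriv d (fun z => G' z i j) z :=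
      fun d i j => dirDeriv_congr hU (fun w hw => by rw [h w hw]) _ hz
    simp only [christoffel, h z hz, h2]
  have h3 : ∀ d a b c, partialDeriv d (christoffel G a b c) y
      = partialDeriv d (christoffel G' a b c) y :=
    fun d a b c => dirDeriv_congr hU (h1 a b c) _ hy
  simp only [ricci, curvature, h3, fun a b c => h1 a b c y hy]

end Coordinates

/-! ### Smooth functions of a time parameter and a point -/

section Parametric

variable {n : ℕ} {M : Type*} [TopologicalSpace M] [ChartedSpace (EuclideanSpace ℝ (Fin n)) M]
  {e : OpenPartialHomeomorph M (EuclideanSpace ℝ (Fin n))}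

theorem contMDiffOn_prodMk_chart_symm (he : e ∈ IsManifold.maximalAtlas (𝓡 n) ∞ M) :
    ContMDiffOn 𝓘(ℝ, ℝ × EuclideanSpace ℝ (Fin n)) (𝓘(ℝ, ℝ).prod (𝓡 n)) ∞
      (fun z : ℝ × EuclideanSpace ℝ (Fin n) => (z.1, e.symm z.2)) (univ ×ˢ e.target) :=
  contDiff_fst.contMDiff.contMDiffOn.prodMk
    ((contMDiffOn_symm_of_mem_maximalAtlas he).comp contDiff_snd.contMDiff.contMDiffOn
      fun _ hz => hz.2)

theorem contMDiffAt_prodMk_chart (he : e ∈ IsManifold.maximalAtlas (𝓡 n) ∞ M) {z : ℝ × M}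
    (hz : z.2 ∈ e.source) :
    ContMDiffAt (𝓘(ℝ, ℝ).prod (𝓡 n)) 𝓘(ℝ, ℝ × EuclideanSpace ℝ (Fin n)) ∞
      (fun z : ℝ × M => (z.1, e z.2)) z :=
  contMDiffAt_fst.prodMk_space ((contMDiffAt_of_mem_maximalAtlas he hz).comp z contMDiffAt_snd)

variable {J : Set ℝ} {H : ℝ × M → ℝ}

theorem differentiableAt_of_contMDiffOn (hJ : IsOpen J)
    (hH : ContMDiffOn (𝓘(ℝ, ℝ).prod (𝓡 n)) 𝓘(ℝ, ℝ) ∞ H (J ×ˢ univ)) {t : ℝ} (ht : t ∈ J) (x : M) :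
    DifferentiableAt ℝ (fun s => H (s, x)) t := by
  have h1 : ContMDiffAt (𝓘(ℝ, ℝ).prod (𝓡 n)) 𝓘(ℝ, ℝ) ∞ H (t, x) :=
    hH.contMDiffAt ((hJ.prod isOpen_univ).mem_nhds ⟨ht, mem_univ _⟩)
  have h2 : ContMDiffAt 𝓘(ℝ, ℝ) 𝓘(ℝ, ℝ) ∞ (fun s => H (s, x)) t :=
    h1.comp t (contMDiffAt_id.prodMk contMDiffAt_const)
  exact h2.contDiffAt.differentiableAt (by simp)

variable [IsManifold (𝓡 n) ∞ M]

/-- The derivative in the time parameter of a smooth function is smooth. -/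
theorem contMDiffOn_deriv (hJ : IsOpen J)
    (hH : ContMDiffOn (𝓘(ℝ, ℝ).prod (𝓡 n)) 𝓘(ℝ, ℝ) ∞ H (J ×ˢ univ)) :
    ContMDiffOn (𝓘(ℝ, ℝ).prod (𝓡 n)) 𝓘(ℝ, ℝ) ∞
      (fun z : ℝ × M => deriv (fun s => H (s, z.2)) z.1) (J ×ˢ univ) := by
  rintro ⟨t, x⟩ ⟨ht, -⟩
  apply ContMDiffAt.contMDiffWithinAt
  set e := chartAt (EuclideanSpace ℝ (Fin n)) x
  have he : e ∈ IsManifold.maximalAtlas (𝓡 n) ∞ M := IsManifold.chart_mem_maximalAtlas x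
  have hx : x ∈ e.source := mem_chart_source _ x
  have hopen : IsOpen (J ×ˢ e.target) := hJ.prod e.open_target
  set h : ℝ × EuclideanSpace ℝ (Fin n) → ℝ := fun z => H (z.1, e.symm z.2)
  have hh : ContDiffOn ℝ ∞ h (J ×ˢ e.target) :=
    contMDiffOn_iff_contDiffOn.1 (hH.comp ((contMDiffOn_prodMk_chart_symm he).mono
      (prod_mono (subset_univ _) subset_rfl)) fun z hz => ⟨hz.1, mem_univ _⟩)
  have hd : ContDiffOn ℝ ∞ (fun z => fderiv ℝ h z ((1 : ℝ), (0 : EuclideanSpace ℝ (Fin n))))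
      (J ×ˢ e.target) :=
    (hh.fderiv_of_isOpen hopen (m := ∞) (by simp)).clm_apply contDiffOn_const
  have h1 := (hd.contDiffAt (hopen.mem_nhds ⟨ht, e.map_source hx⟩)).contMDiffAt.comp (t, x)
    (contMDiffAt_prodMk_chart he (z := (t, x)) hx)
  refine h1.congr_of_eventuallyEq ?_
  filter_upwards [(hJ.prod e.open_source).mem_nhds (show (t, x) ∈ J ×ˢ e.source from ⟨ht, hx⟩)]
    with z hz
  have h2 : HasFDerivAt h (fderiv ℝ h (z.1, e z.2)) (z.1, e z.2) :=
    ((hh.contDiffAt (hopen.mem_nhds ⟨hz.1, e.map_source hz.2⟩)).differentiableAt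
      (by simp)).hasFDerivAt
  have h3 : HasDerivAt (fun s : ℝ => (s, e z.2)) ((1 : ℝ), (0 : EuclideanSpace ℝ (Fin n))) z.1 :=
    (hasDerivAt_id z.1).prodMk (hasDerivAt_const _ _)
  have h4 := h2.comp_hasDerivAt z.1 h3
  have h5 : (fun s => H (s, z.2)) = h ∘ fun s : ℝ => (s, e z.2) := by
    funext s
    simp [h, e.left_inv hz.2]
  simp only [h5, h4.deriv, Function.comp_apply]

variable [MeasurableSpace M] [BorelSpace M] [T2Space M]

/-- Differentiation under the integral sign over a compact set. -/
theorem hasDerivAt_setIntegral (μ : Measure M) [IsLocallyFiniteMeasure μ] {K : Set M}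
    (hK : IsCompact K) (hJ : IsOpen J)
    (hH : ContMDiffOn (𝓘(ℝ, ℝ).prod (𝓡 n)) 𝓘(ℝ, ℝ) ∞ H (J ×ˢ univ)) {t : ℝ} (ht : t ∈ J) :
    HasDerivAt (fun s => ∫ x in K, H (s, x) ∂μ)
      (∫ x in K, deriv (fun s => H (s, x)) t ∂μ) t := by
  have hcont : ∀ F : ℝ × M → ℝ, ContMDiffOn (𝓘(ℝ, ℝ).prod (𝓡 n)) 𝓘(ℝ, ℝ) ∞ F (J ×ˢ univ) →
      ∀ s ∈ J, Continuous fun x => F (s, x) := fun F hF s hs =>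
    hF.continuousOn.comp_continuous (Continuous.prodMk_right s) fun x => ⟨hs, mem_univ _⟩
  have hH' := contMDiffOn_deriv hJ hH
  obtain ⟨r, hr, hrJ⟩ := Metric.nhds_basis_closedBall.mem_iff.1 (hJ.mem_nhds ht)
  have hcomp : IsCompact (Metric.closedBall t r ×ˢ K) :=
    (isCompact_closedBall t r).prod hK
  obtain ⟨C, hC⟩ := hcomp.exists_bound_of_continuousOn
    (hH'.continuousOn.mono (prod_mono hrJ (subset_univ K)))
  have hfin : μ K < ⊤ := hK.measure_lt_top
  have hKm : MeasurableSet K := hK.isClosed.measurableSet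
  refine (hasDerivAt_integral_of_dominated_loc_of_deriv_le (μ := μ.restrict K)
    (F := fun s x => H (s, x)) (F' := fun s x => deriv (fun s => H (s, x)) s) (bound := fun _ => C)
    (Metric.closedBall_mem_nhds t hr) ?_ ?_ ?_ ?_ ?_ ?_).2
  · filter_upwards [hJ.mem_nhds ht] with s hs
    exact (hcont H hH s hs).aestronglyMeasurable
  · exact (hcont H hH t ht).continuousOn.integrableOn_compact hK
  · exact (hcont _ hH' t ht).aestronglyMeasurable
  · filter_upwards [ae_restrict_mem hKm] with x hx s hs
    exact hC (s, x) ⟨hs, hx⟩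
  · exact integrableOn_const hfin.ne
  · exact Filter.Eventually.of_forall fun x s hs =>
      (differentiableAt_of_contMDiffOn hJ hH (hrJ hs) x).hasDerivAt

end Parametric

/-! ### Smoothness of the dual map -/

section DualSmooth

variable {n : ℕ} {U : Set (EuclideanSpace ℝ (Fin n))}

/-- A vector field along `f` with `⟨f, ·⟩ = 1`, orthogonal to the tangent spaces: the projection of
a multiple of the time direction. -/
def auxNormal (f : EuclideanSpace ℝ (Fin n) → Minkowski n) (y : EuclideanSpace ℝ (Fin n)) :
    Minkowski n :=
  -(f y 0)⁻¹ • EuclideanSpace.single 0 1 - ∑ i, (∑ j, (gramMatrix f y)⁻¹ i j *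
    lorentz (dirDeriv (stdVec j) f y) (-(f y 0)⁻¹ • EuclideanSpace.single 0 1)) •
      dirDeriv (stdVec i) f y

/-- An explicit expression for the dual map. -/
def dualFormula (f : EuclideanSpace ℝ (Fin n) → Minkowski n) (y : EuclideanSpace ℝ (Fin n)) :
    Minkowski n :=
  auxNormal f y - (lorentz (auxNormal f y) (auxNormal f y) / 2) • f y

/-- A nonzero null vector has a nonzero time component. -/
theorem apply_zero_ne_zero {v : Minkowski n} (hv : v ≠ 0) (h : lorentz v v = 0) : v 0 ≠ 0 := by
  intro h0
  apply hv
  simp only [lorentz, h0, mul_zero, neg_zero, zero_add] at h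
  rw [Finset.sum_eq_zero_iff_of_nonneg fun i _ => mul_self_nonneg _] at h
  ext i
  refine Fin.cases h0 (fun j => ?_) i
  simpa using h j (Finset.mem_univ _)

theorem contDiffOn_dualFormula (hU : IsOpen U) {f : EuclideanSpace ℝ (Fin n) → Minkowski n}
    (hf : ContDiffOn ℝ ∞ f U) (h0 : ∀ y ∈ U, f y 0 ≠ 0)
    (hpos : ∀ y ∈ U, ∀ v, v ≠ 0 → 0 < lorentz (dirDeriv v f y) (dirDeriv v f y)) :
    ContDiffOn ℝ ∞ (dualFormula f) U := by
  have hf0 : ContDiffOn ℝ ∞ (fun y => f y 0) U :=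
    (EuclideanSpace.proj (𝕜 := ℝ) (0 : Fin (n + 2)) : Minkowski n →L[ℝ] ℝ).contDiff.comp_contDiffOn
      hf
  have hu : ContDiffOn ℝ ∞ (fun y => -(f y 0)⁻¹ • (EuclideanSpace.single 0 1 : Minkowski n)) U :=
    (hf0.inv h0).neg.smul contDiffOn_const
  have hw : ContDiffOn ℝ ∞ (auxNormal f) U := by
    refine hu.sub (ContDiffOn.sum fun i _ => ContDiffOn.fun_smul (ContDiffOn.sum fun j _ => ?_)
      (contDiffOn_dirDeriv hU hf _))
    exact (contDiffOn_matrix_inv (contDiffOn_gramMatrix hU hf)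
      (fun y hy => (gramMatrix_posDef (hpos y hy)).det_pos.ne') i j).mul
        (contDiffOn_lorentz (contDiffOn_dirDeriv hU hf _) hu)
  exact hw.sub (((contDiffOn_lorentz hw hw).div_const 2).smul hf)

theorem dualFormula_spec {f : EuclideanSpace ℝ (Fin n) → Minkowski n}
    {y : EuclideanSpace ℝ (Fin n)} (h0 : f y 0 ≠ 0) (hnull : lorentz (f y) (f y) = 0)
    (htan : ∀ v, lorentz (dirDeriv v f y) (f y) = 0)
    (hpos : ∀ v, v ≠ 0 → 0 < lorentz (dirDeriv v f y) (dirDeriv v f y)) :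
    lorentz (dualFormula f y) (dualFormula f y) = 0 ∧ lorentz (f y) (dualFormula f y) = 1 ∧
      ∀ v, lorentz (dirDeriv v f y) (dualFormula f y) = 0 := by
  set u : Minkowski n := -(f y 0)⁻¹ • EuclideanSpace.single 0 1 with hu
  have hfu : lorentz (f y) u = 1 := by
    rw [hu]
    simp [lorentz, h0]
  have hfw : lorentz (f y) (auxNormal f y) = 1 := by
    rw [auxNormal, lorentz_sub_right, hfu, lorentz_sum_right]
    simp only [lorentz_comm (f y), lorentz_smul_left, htan, mul_zero, Finset.sum_const_zero,
      sub_zero]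
  have hdw : ∀ v, lorentz (dirDeriv v f y) (auxNormal f y) = 0 := by
    have hl : ∀ l, lorentz (dirDeriv (stdVec l) f y) (auxNormal f y) = 0 := by
      intro l
      have h1 : gramMatrix f y * (gramMatrix f y)⁻¹ = 1 :=
        Matrix.mul_nonsing_inv _ (gramMatrix_posDef hpos).det_pos.ne'.isUnit
      rw [auxNormal, ← hu, lorentz_sub_right, lorentz_sum_right]
      simp only [lorentz_smul_right, Finset.sum_mul]
      rw [Finset.sum_comm, sub_eq_zero]
      have h2 : ∀ j, ∑ i, (gramMatrix f y)⁻¹ i j * lorentz (dirDeriv (stdVec j) f y) u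
          * lorentz (dirDeriv (stdVec l) f y) (dirDeriv (stdVec i) f y)
          = (1 : Matrix (Fin n) (Fin n) ℝ) l j * lorentz (dirDeriv (stdVec j) f y) u := by
        intro j
        rw [← h1, Matrix.mul_apply, Finset.sum_mul]
        refine Finset.sum_congr rfl fun i _ => ?_
        rw [gramMatrix_apply]
        ring
      simp [h2, Matrix.one_apply]
    intro v
    rw [dirDeriv_eq_sum, lorentz_sum_left]
    simp [lorentz_smul_left, hl]
  refine ⟨?_, ?_, fun v => ?_⟩
  · simp only [dualFormula, lorentz_sub_left, lorentz_sub_right, lorentz_smul_left,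
      lorentz_smul_right, hnull, hfw, lorentz_comm (auxNormal f y) (f y)]
    ring
  · rw [dualFormula, lorentz_sub_right, lorentz_smul_right, hfw, hnull]
    ring
  · rw [dualFormula, lorentz_sub_right, lorentz_smul_right, hdw, htan]
    ring

variable {M : Type*} [TopologicalSpace M] [ChartedSpace (EuclideanSpace ℝ (Fin n)) M]
  {W : Type*} [NormedAddCommGroup W] [NormedSpace ℝ W]
  {e : OpenPartialHomeomorph M (EuclideanSpace ℝ (Fin n))} {y : EuclideanSpace ℝ (Fin n)}

theorem contDiffOn_comp_symm (he : e ∈ IsManifold.maximalAtlas (𝓡 n) ∞ M) {F : M → W}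
    (hF : ContMDiff (𝓡 n) 𝓘(ℝ, W) ∞ F) : ContDiffOn ℝ ∞ (F ∘ e.symm) e.target :=
  contMDiffOn_iff_contDiffOn.1 (hF.comp_contMDiffOn (contMDiffOn_symm_of_mem_maximalAtlas he))

theorem dirDeriv_comp_symm (he : e ∈ IsManifold.maximalAtlas (𝓡 n) ∞ M) (hy : y ∈ e.target)
    {F : M → W} (hF : MDifferentiableAt (𝓡 n) 𝓘(ℝ, W) F (e.symm y))
    (v : EuclideanSpace ℝ (Fin n)) :
    dirDeriv v (F ∘ e.symm) y = mfderiv (𝓡 n) 𝓘(ℝ, W) F (e.symm y) (chartFrame e y v) := by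
  have h1 := mfderiv_comp y hF
    ((contMDiffAt_symm_of_mem_maximalAtlas he hy).mdifferentiableAt (by simp))
  rw [mfderiv_eq_fderiv] at h1
  exact congrArg (fun T : EuclideanSpace ℝ (Fin n) →L[ℝ] W => T v) h1

theorem chartFrame_bijective (he : e ∈ IsManifold.maximalAtlas (𝓡 n) ∞ M) (hy : y ∈ e.target) :
    Function.Bijective (chartFrame e y) := by
  have h1 := mfderiv_comp y (g := e) (f := e.symm)
    ((contMDiffAt_of_mem_maximalAtlas he (e.map_target hy)).mdifferentiableAt (by simp))
    ((contMDiffAt_symm_of_mem_maximalAtlas he hy).mdifferentiableAt (by simp))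
  have h2 : e ∘ e.symm =ᶠ[𝓝 y] id := by
    filter_upwards [e.open_target.mem_nhds hy] with z hz
    exact e.right_inv hz
  rw [h2.mfderiv_eq, mfderiv_id] at h1
  have hinj : Function.Injective (chartFrame e y) := by
    refine Function.LeftInverse.injective
      (g := (mfderiv (𝓡 n) (𝓡 n) e (e.symm y) : EuclideanSpace ℝ (Fin n) → _)) fun v => ?_
    exact (congrArg (fun T : EuclideanSpace ℝ (Fin n) →L[ℝ] EuclideanSpace ℝ (Fin n) => T v)
      h1).symm
  exact ⟨hinj, LinearMap.injective_iff_surjective (f := (chartFrame e y).toLinearMap) |>.1 hinj⟩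

variable [IsManifold (𝓡 n) ∞ M] {g : SmoothMetric n M} {p : M → Minkowski n}

theorem contMDiff_of_contDiffOn_comp_symm {F : M → W}
    (hF : ∀ x, ContDiffOn ℝ ∞ (F ∘ (chartAt (EuclideanSpace ℝ (Fin n)) x).symm)
      (chartAt (EuclideanSpace ℝ (Fin n)) x).target) : ContMDiff (𝓡 n) 𝓘(ℝ, W) ∞ F := by
  intro x
  set e := chartAt (EuclideanSpace ℝ (Fin n)) x
  have hx : x ∈ e.source := mem_chart_source _ x
  have h1 : ContMDiffAt (𝓡 n) 𝓘(ℝ, W) ∞ ((F ∘ e.symm) ∘ e) x :=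
    ContMDiffAt.comp x ((hF x).contDiffAt (e.open_target.mem_nhds (e.map_source hx))).contMDiffAt
      (contMDiffAt_of_mem_maximalAtlas (IsManifold.chart_mem_maximalAtlas x) hx)
  refine h1.congr_of_eventuallyEq ?_
  filter_upwards [e.open_source.mem_nhds hx] with z hz
  simp [e.left_inv hz]

theorem IsIsometricImmersion.lorentz_mfderiv (hp : IsIsometricImmersion g p) (x : M)
    (v w : EuclideanSpace ℝ (Fin n)) :
    lorentz (n := n) (mfderiv (𝓡 n) 𝓘(ℝ, Minkowski n) p x v)
      (mfderiv (𝓡 n) 𝓘(ℝ, Minkowski n) p x w) = g.inner x v w :=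
  congrFun (congrFun (congrFun hp.isometric x) v) w

theorem IsIsometricImmersion.mdifferentiableAt (hp : IsIsometricImmersion g p) (x : M) :
    MDifferentiableAt (𝓡 n) 𝓘(ℝ, Minkowski n) p x :=
  hp.smooth.mdifferentiableAt (by simp)

theorem IsIsometricImmersion.spacelike_comp_symm (hp : IsIsometricImmersion g p)
    (he : e ∈ IsManifold.maximalAtlas (𝓡 n) ∞ M) (hy : y ∈ e.target)
    (v : EuclideanSpace ℝ (Fin n)) (hv : v ≠ 0) :
    0 < lorentz (dirDeriv v (p ∘ e.symm) y) (dirDeriv v (p ∘ e.symm) y) := by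
  rw [dirDeriv_comp_symm he hy (hp.mdifferentiableAt _)]
  refine lt_of_lt_of_eq (g.pos (e.symm y) (chartFrame e y v) fun h => hv ?_)
    (hp.lorentz_mfderiv _ _ _).symm
  exact (chartFrame_bijective he hy).1 (h.trans (map_zero (chartFrame e y)).symm)

/-- In a chart, the dual map is given by the explicit expression `dualFormula`. -/
theorem dualMap_comp_symm (hn : 1 ≤ n) (hp : IsIsometricImmersion g p)
    (he : e ∈ IsManifold.maximalAtlas (𝓡 n) ∞ M) (hy : y ∈ e.target) :
    (p ∘ e.symm) y 0 ≠ 0 ∧ dualMap p (e.symm y) = dualFormula (p ∘ e.symm) y := by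
  have hsm := contDiffOn_comp_symm he hp.smooth
  have hd : DifferentiableAt ℝ (p ∘ e.symm) y :=
    ContDiffOn.differentiableAt_of_isOpen e.open_target hsm hy
  have hdual := isDualVector_dualMap hn hp (e.symm y)
  have h0 : (p ∘ e.symm) y 0 ≠ 0 := by
    refine apply_zero_ne_zero (fun h => ?_) (hp.mem_lightCone _)
    have := hdual.inner_self
    rw [show p (e.symm y) = 0 from h, lorentz_zero_left] at this
    exact zero_ne_one this
  have htan : ∀ v, lorentz (dirDeriv v (p ∘ e.symm) y) ((p ∘ e.symm) y) = 0 := fun v => by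
    have := LightconePatch.add_eq_zero_of_lorentz_const e.open_target
      (F := p ∘ e.symm) (F' := p ∘ e.symm) (fun z _ => hp.mem_lightCone (e.symm z)) hy hd hd v
    rw [lorentz_comm ((p ∘ e.symm) y)] at this
    linarith
  obtain ⟨h1, h2, h3⟩ := dualFormula_spec h0 (hp.mem_lightCone (e.symm y)) htan
    (hp.spacelike_comp_symm he hy)
  refine ⟨h0, (existsUnique_isDualVector hn hp (e.symm y)).unique hdual ⟨h1, h2, fun v => ?_⟩⟩
  obtain ⟨v', rfl⟩ := (chartFrame_bijective he hy).2 v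
  rw [← h3 v', dirDeriv_comp_symm he hy (hp.mdifferentiableAt _)]

theorem contMDiff_dualMap (hn : 1 ≤ n) (hp : IsIsometricImmersion g p) :
    ContMDiff (𝓡 n) 𝓘(ℝ, Minkowski n) ∞ (dualMap p) := by
  refine contMDiff_of_contDiffOn_comp_symm fun x => ?_
  have he : chartAt (EuclideanSpace ℝ (Fin n)) x ∈ IsManifold.maximalAtlas (𝓡 n) ∞ M :=
    IsManifold.chart_mem_maximalAtlas x
  refine ContDiffOn.congr ?_ fun y hy => (dualMap_comp_symm hn hp he hy).2
  exact contDiffOn_dualFormula (chartAt _ x).open_target (contDiffOn_comp_symm he hp.smooth)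
    (fun y hy => (dualMap_comp_symm hn hp he hy).1) fun y hy => hp.spacelike_comp_symm he hy

theorem lightconePatch (hn : 1 ≤ n) (hp : IsIsometricImmersion g p)
    (he : e ∈ IsManifold.maximalAtlas (𝓡 n) ∞ M) :
    LightconePatch e.target (p ∘ e.symm) (dualMap p ∘ e.symm) where
  isOpen := e.open_target
  smooth := contDiffOn_comp_symm he hp.smooth
  smooth_dual := contDiffOn_comp_symm he (contMDiff_dualMap hn hp)
  null y _ := hp.mem_lightCone _
  null_dual y _ := (isDualVector_dualMap hn hp _).mem_lightCone
  inner_dual y _ := (isDualVector_dualMap hn hp _).inner_self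
  tangent_dual y hy v := by
    rw [dirDeriv_comp_symm he hy (hp.mdifferentiableAt _)]
    exact (isDualVector_dualMap hn hp _).inner_tangent _
  spacelike y hy := hp.spacelike_comp_symm he hy

end DualSmooth

/-! ### The shape operator -/

section ShapeOperator

variable {n : ℕ} {M : Type*} [TopologicalSpace M] [ChartedSpace (EuclideanSpace ℝ (Fin n)) M]

/-- The shape operator of `p` with respect to its dual map `q`: the endomorphism `A` of the tangent
space with `dq = dp ∘ A`. For isometric immersions into the light-cone it exists
(`mfderiv_dualMap`), and it is unique because `dp` is injective. -/
def shapeOperator (p : M → Minkowski n) (x : M) :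
    EuclideanSpace ℝ (Fin n) →ₗ[ℝ] EuclideanSpace ℝ (Fin n) :=
  Classical.epsilon fun A => ∀ v : EuclideanSpace ℝ (Fin n),
    mfderiv (𝓡 n) 𝓘(ℝ, Minkowski n) (dualMap p) x v
      = mfderiv (𝓡 n) 𝓘(ℝ, Minkowski n) p x (A v)

variable [IsManifold (𝓡 n) ∞ M] {g : SmoothMetric n M} {p : M → Minkowski n}
  {e : OpenPartialHomeomorph M (EuclideanSpace ℝ (Fin n))} {y : EuclideanSpace ℝ (Fin n)}

theorem mfderiv_injective (hp : IsIsometricImmersion g p) (x : M) :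
    Function.Injective (mfderiv (𝓡 n) 𝓘(ℝ, Minkowski n) p x) := by
  rw [injective_iff_map_eq_zero]
  intro v hv
  by_contra hv0
  have h1 := g.pos x v hv0
  rw [← hp.lorentz_mfderiv x v v] at h1
  have h2 : lorentz (n := n) (mfderiv (𝓡 n) 𝓘(ℝ, Minkowski n) p x v)
      (mfderiv (𝓡 n) 𝓘(ℝ, Minkowski n) p x v) = 0 := by
    erw [hv]
    exact lorentz_zero_left _
  exact h1.ne' h2

theorem mdifferentiableAt_dualMap (hn : 1 ≤ n) (hp : IsIsometricImmersion g p) (x : M) :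
    MDifferentiableAt (𝓡 n) 𝓘(ℝ, Minkowski n) (dualMap p) x :=
  (contMDiff_dualMap hn hp).mdifferentiableAt (by simp)

theorem mfderiv_dualMap (hn : 1 ≤ n) (hp : IsIsometricImmersion g p) (x : M)
    (v : EuclideanSpace ℝ (Fin n)) :
    mfderiv (𝓡 n) 𝓘(ℝ, Minkowski n) (dualMap p) x v
      = mfderiv (𝓡 n) 𝓘(ℝ, Minkowski n) p x (shapeOperator p x v) := by
  set e := chartAt (EuclideanSpace ℝ (Fin n)) x
  have he : e ∈ IsManifold.maximalAtlas (𝓡 n) ∞ M := IsManifold.chart_mem_maximalAtlas x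
  have hx : x ∈ e.source := mem_chart_source _ x
  have hy : e x ∈ e.target := e.map_source hx
  have hpatch := lightconePatch hn hp he
  obtain ⟨D, hD⟩ : ∃ D : EuclideanSpace ℝ (Fin n) →ₗ[ℝ] Minkowski n,
      ∀ v : EuclideanSpace ℝ (Fin n), D v = mfderiv (𝓡 n) 𝓘(ℝ, Minkowski n) p x v :=
    ⟨(mfderiv (𝓡 n) 𝓘(ℝ, Minkowski n) p x).toLinearMap, fun _ => rfl⟩
  obtain ⟨Q, hQ⟩ : ∃ Q : EuclideanSpace ℝ (Fin n) →ₗ[ℝ] Minkowski n,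
      ∀ v : EuclideanSpace ℝ (Fin n),
        Q v = mfderiv (𝓡 n) 𝓘(ℝ, Minkowski n) (dualMap p) x v :=
    ⟨(mfderiv (𝓡 n) 𝓘(ℝ, Minkowski n) (dualMap p) x).toLinearMap, fun _ => rfl⟩
  have hDinj : Function.Injective D := fun a b hab => by
    rw [hD, hD] at hab
    exact mfderiv_injective hp x hab
  obtain ⟨r, hr⟩ := D.exists_leftInverse_of_injective (LinearMap.ker_eq_bot.2 hDinj)
  have hrD : ∀ u, r (D u) = u := fun u => LinearMap.congr_fun hr u
  have hrange : ∀ v, ∃ u, Q v = D u := by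
    intro v
    obtain ⟨v', rfl⟩ := (chartFrame_bijective he hy).2 v
    have h1 := dirDeriv_comp_symm he hy (mdifferentiableAt_dualMap hn hp _) v'
    have h2 := dirDeriv_eq_sum (dualMap p ∘ e.symm) v' (e x)
    have h3 : ∀ i, dirDeriv (stdVec i) (p ∘ e.symm) (e x) = D (chartFrame e (e x) (stdVec i)) := by
      intro i
      rw [hD, dirDeriv_comp_symm he hy (hp.mdifferentiableAt _), e.left_inv hx]
    rw [e.left_inv hx] at h1
    rw [hQ, ← h1, h2]
    simp only [hpatch.dirDeriv_dual_eq hy, h3]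
    simp only [← map_smul, ← map_sum]
    exact ⟨_, rfl⟩
  have hex : ∃ A : EuclideanSpace ℝ (Fin n) →ₗ[ℝ] EuclideanSpace ℝ (Fin n),
      ∀ v : EuclideanSpace ℝ (Fin n), mfderiv (𝓡 n) 𝓘(ℝ, Minkowski n) (dualMap p) x v
        = mfderiv (𝓡 n) 𝓘(ℝ, Minkowski n) p x (A v) := by
    refine ⟨r ∘ₗ Q, fun v => ?_⟩
    obtain ⟨u, hu⟩ := hrange v
    rw [← hQ, ← hD, LinearMap.comp_apply, hu, hrD]
  exact Classical.epsilon_spec hex v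

/-- In a chart, the metric is the Gram matrix of the coordinate expression of `p`. -/
theorem chartMatrix_form (hp : IsIsometricImmersion g p)
    (he : e ∈ IsManifold.maximalAtlas (𝓡 n) ∞ M) (hy : y ∈ e.target) :
    chartMatrix g.form e y = gramMatrix (p ∘ e.symm) y := by
  ext i j
  rw [gramMatrix_apply, dirDeriv_comp_symm he hy (hp.mdifferentiableAt _),
    dirDeriv_comp_symm he hy (hp.mdifferentiableAt _)]
  exact (hp.lorentz_mfderiv _ _ _).symm

/-- In the coordinate frame of a chart, the matrix of the shape operator is `G⁻¹ ⟨df, dk⟩`. -/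
theorem exists_basis_toMatrix_shapeOperator (hn : 1 ≤ n) (hp : IsIsometricImmersion g p)
    (he : e ∈ IsManifold.maximalAtlas (𝓡 n) ∞ M) (hy : y ∈ e.target) :
    ∃ b : Module.Basis (Fin n) ℝ (EuclideanSpace ℝ (Fin n)),
      LinearMap.toMatrix b b (shapeOperator p (e.symm y))
        = LightconePatch.shapeMatrix (p ∘ e.symm) (dualMap p ∘ e.symm) y := by
  let b := (stdBasis n).map
    (LinearEquiv.ofBijective (chartFrame e y).toLinearMap (chartFrame_bijective he hy))
  have hb : ∀ i, b i = chartFrame e y (stdVec i) := fun i => by simp [b]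
  have hpatch := lightconePatch hn hp he
  obtain ⟨D, hD⟩ : ∃ D : EuclideanSpace ℝ (Fin n) →ₗ[ℝ] Minkowski n,
      ∀ v : EuclideanSpace ℝ (Fin n), D v = mfderiv (𝓡 n) 𝓘(ℝ, Minkowski n) p (e.symm y) v :=
    ⟨(mfderiv (𝓡 n) 𝓘(ℝ, Minkowski n) p (e.symm y)).toLinearMap, fun _ => rfl⟩
  have hDb : ∀ i, dirDeriv (stdVec i) (p ∘ e.symm) y = D (b i) := fun i => by
    rw [hD, dirDeriv_comp_symm he hy (hp.mdifferentiableAt _), hb]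
  have hA : ∀ j, shapeOperator p (e.symm y) (b j) = ∑ i,
      LightconePatch.shapeMatrix (p ∘ e.symm) (dualMap p ∘ e.symm) y i j • b i := by
    intro j
    apply mfderiv_injective hp (e.symm y)
    rw [← mfderiv_dualMap hn hp, ← hD, hb j,
      ← dirDeriv_comp_symm he hy (mdifferentiableAt_dualMap hn hp _), hpatch.dirDeriv_dual_eq hy]
    simp only [hDb, map_sum, map_smul]
    rfl
  refine ⟨b, ?_⟩
  ext i j
  rw [LinearMap.toMatrix_apply, hA]
  simp [Finsupp.single_apply]

theorem det_one_add_smul_shapeOperator (hn : 1 ≤ n) (hp : IsIsometricImmersion g p)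
    (he : e ∈ IsManifold.maximalAtlas (𝓡 n) ∞ M) (hy : y ∈ e.target) (s : ℝ) :
    LinearMap.det (1 + s • shapeOperator p (e.symm y))
      = (1 + s • LightconePatch.shapeMatrix (p ∘ e.symm) (dualMap p ∘ e.symm) y).det := by
  obtain ⟨b, hb⟩ := exists_basis_toMatrix_shapeOperator hn hp he hy
  rw [← hb, ← LinearMap.det_toMatrix b, map_add, map_smul, LinearMap.toMatrix_one]

theorem trace_shapeOperator (hn : 1 ≤ n) (hp : IsIsometricImmersion g p)
    (he : e ∈ IsManifold.maximalAtlas (𝓡 n) ∞ M) (hy : y ∈ e.target) :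
    LinearMap.trace ℝ _ (shapeOperator p (e.symm y))
      = (LightconePatch.shapeMatrix (p ∘ e.symm) (dualMap p ∘ e.symm) y).trace := by
  obtain ⟨b, hb⟩ := exists_basis_toMatrix_shapeOperator hn hp he hy
  rw [← hb, LinearMap.trace_eq_matrix_trace ℝ b]

/-- The scalar curvature is a multiple of the trace of the shape operator. -/
theorem scalarCurvature_eq (hn : 1 ≤ n) (hp : IsIsometricImmersion g p) (x : M) :
    scalarCurvature g.form x
      = 2 * (n - 1 : ℝ) * LinearMap.trace ℝ _ (shapeOperator p x) := by
  set e := chartAt (EuclideanSpace ℝ (Fin n)) x with hedef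
  have he : e ∈ IsManifold.maximalAtlas (𝓡 n) ∞ M := IsManifold.chart_mem_maximalAtlas x
  have hx : x ∈ e.source := mem_chart_source _ x
  have hy : e x ∈ e.target := e.map_source hx
  have h1 := trace_shapeOperator hn hp he hy
  rw [e.left_inv hx] at h1
  rw [h1, ← (lightconePatch hn hp he).sum_inv_mul_ricci hy]
  simp only [scalarCurvature, ← hedef, chartMatrix_form hp he hy]
  refine Finset.sum_congr rfl fun i _ => Finset.sum_congr rfl fun j _ => ?_
  rw [ricci_congr e.open_target (fun z hz => chartMatrix_form hp he hz) hy]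

/-- The shape operator is self-adjoint. -/
theorem inner_shapeOperator_comm (hn : 1 ≤ n) (hp : IsIsometricImmersion g p) (x : M)
    (v w : EuclideanSpace ℝ (Fin n)) :
    g.inner x (shapeOperator p x v) w = g.inner x v (shapeOperator p x w) := by
  set e := chartAt (EuclideanSpace ℝ (Fin n)) x with hedef
  have he : e ∈ IsManifold.maximalAtlas (𝓡 n) ∞ M := IsManifold.chart_mem_maximalAtlas x
  have hx : x ∈ e.source := mem_chart_source _ x
  have hy : e x ∈ e.target := e.map_source hx
  obtain ⟨v', rfl⟩ := (chartFrame_bijective he hy).2 v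
  obtain ⟨w', rfl⟩ := (chartFrame_bijective he hy).2 w
  have h1 := (lightconePatch hn hp he).lorentz_dirDeriv_dual_comm hy v' w'
  rw [dirDeriv_comp_symm he hy (hp.mdifferentiableAt _),
    dirDeriv_comp_symm he hy (hp.mdifferentiableAt _),
    dirDeriv_comp_symm he hy (mdifferentiableAt_dualMap hn hp _),
    dirDeriv_comp_symm he hy (mdifferentiableAt_dualMap hn hp _), e.left_inv hx,
    mfderiv_dualMap hn hp, mfderiv_dualMap hn hp] at h1
  rw [← hp.lorentz_mfderiv, ← hp.lorentz_mfderiv, h1]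
  exact lorentz_comm _ _

/-- The metric at `x` as a bilinear form on the model space, to which the tangent space is
definitionally equal. -/
def metricBilin (g : SmoothMetric n M) (x : M) :
    LinearMap.BilinForm ℝ (EuclideanSpace ℝ (Fin n)) :=
  LinearMap.mk₂ ℝ (fun v w => g.inner x v w)
    (fun u v w => by exact congrArg (fun T => T w) (map_add (g.inner x) u v))
    (fun c v w => by exact congrArg (fun T => T w) (map_smul (g.inner x) c v))
    (fun u v w => map_add (g.inner x u) v w) (fun c v w => map_smul (g.inner x v) c w)

theorem trace_shapeOperator_mul_self_nonneg (hn : 1 ≤ n) (hp : IsIsometricImmersion g p) (x : M) :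
    0 ≤ LinearMap.trace ℝ _ (shapeOperator p x * shapeOperator p x) := by
  exact trace_mul_self_nonneg (metricBilin g x) (fun v w => g.symm x v w)
    (fun v hv => g.pos x v hv) _ fun v w => inner_shapeOperator_comm hn hp x v w

/-- The function `(s, x) ↦ det (1 + s A_x)` is smooth. -/
theorem contMDiff_det_one_add_smul (hn : 1 ≤ n) (hp : IsIsometricImmersion g p) :
    ContMDiff (𝓘(ℝ, ℝ).prod (𝓡 n)) 𝓘(ℝ, ℝ) ∞
      (fun z : ℝ × M => LinearMap.det (1 + z.1 • shapeOperator p z.2)) := by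
  rintro ⟨s, x⟩
  set e := chartAt (EuclideanSpace ℝ (Fin n)) x with hedef
  have he : e ∈ IsManifold.maximalAtlas (𝓡 n) ∞ M := IsManifold.chart_mem_maximalAtlas x
  have hx : x ∈ e.source := mem_chart_source _ x
  have hy : e x ∈ e.target := e.map_source hx
  have hpatch := lightconePatch hn hp he
  set 𝒜 := LightconePatch.shapeMatrix (p ∘ e.symm) (dualMap p ∘ e.symm)
  have h1 : ContDiffOn ℝ ∞ (fun z : ℝ × EuclideanSpace ℝ (Fin n) => (1 + z.1 • 𝒜 z.2).det)
      (univ ×ˢ e.target) := by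
    refine contDiffOn_matrix_det fun i j => ?_
    simp only [Matrix.add_apply, Matrix.smul_apply, smul_eq_mul]
    exact contDiffOn_const.add (contDiff_fst.contDiffOn.mul
      ((hpatch.contDiffOn_shapeMatrix i j).comp contDiff_snd.contDiffOn fun z hz => hz.2))
  have h2 : ContDiffAt ℝ ∞ (fun z : ℝ × EuclideanSpace ℝ (Fin n) => (1 + z.1 • 𝒜 z.2).det)
      (s, e x) :=
    h1.contDiffAt ((isOpen_univ.prod e.open_target).mem_nhds ⟨mem_univ _, hy⟩)
  refine (ContMDiffAt.comp (s, x) h2.contMDiffAt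
    (contMDiffAt_prodMk_chart he (z := (s, x)) hx)).congr_of_eventuallyEq ?_
  have h4 : ∀ᶠ z : ℝ × M in 𝓝 (s, x), z.2 ∈ e.source :=
    continuousAt_snd.eventually (e.open_source.mem_nhds hx)
  filter_upwards [h4] with z hz
  have h5 := det_one_add_smul_shapeOperator hn hp he (e.map_source hz) z.1
  rw [e.left_inv hz] at h5
  exact h5

theorem contMDiff_trace_shapeOperator (hn : 1 ≤ n) (hp : IsIsometricImmersion g p) :
    ContMDiff (𝓡 n) 𝓘(ℝ, ℝ) ∞ (fun x => LinearMap.trace ℝ _ (shapeOperator p x)) := by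
  refine contMDiff_of_contDiffOn_comp_symm fun x => ?_
  have he : chartAt (EuclideanSpace ℝ (Fin n)) x ∈ IsManifold.maximalAtlas (𝓡 n) ∞ M :=
    IsManifold.chart_mem_maximalAtlas x
  refine ContDiffOn.congr ?_ fun y hy => trace_shapeOperator hn hp he hy
  exact ContDiffOn.sum fun i _ => (lightconePatch hn hp he).contDiffOn_shapeMatrix i i

end ShapeOperator

/-! ### The null-space and the metrics induced by maps into it -/

section NullForm

variable {n : ℕ} {M : Type*} [TopologicalSpace M] [ChartedSpace (EuclideanSpace ℝ (Fin n)) M]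

/-- The differential of a vector-valued map, with the tangent spaces replaced by the model space
and the target, to which they are definitionally equal. -/
def vecDeriv (F : M → Minkowski n) (x : M) : EuclideanSpace ℝ (Fin n) →L[ℝ] Minkowski n :=
  mfderiv (𝓡 n) 𝓘(ℝ, Minkowski n) F x

theorem ruledMap_zero (p : M → Minkowski n) (x : M) : ruledMap p (0, x) = p x := by
  simp [ruledMap]

variable [IsManifold (𝓡 n) ∞ M] {g : SmoothMetric n M} {p : M → Minkowski n}

theorem isSmoothEmbedding_zero_prodMk : Manifold.IsSmoothEmbedding (𝓡 n)
    (𝓘(ℝ, ℝ).prod (𝓡 n)) ∞ (fun x : M => ((0 : ℝ), x)) := by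
  refine ⟨?_, ?_⟩
  · have h : Manifold.IsImmersionOfComplement ℝ (𝓡 n) (𝓘(ℝ, ℝ).prod (𝓡 n)) ∞
        (fun x : M => ((0 : ℝ), x)) := fun x => by
      refine Manifold.IsImmersionAtOfComplement.mk_of_continuousAt
        (Continuous.prodMk_right (0 : ℝ)).continuousAt
        (ContinuousLinearEquiv.prodComm ℝ (EuclideanSpace ℝ (Fin n)) ℝ)
        (chartAt (EuclideanSpace ℝ (Fin n)) x)
        (chartAt (ModelProd ℝ (EuclideanSpace ℝ (Fin n))) ((0 : ℝ), x))
        (mem_chart_source _ x) (mem_chart_source _ _) (IsManifold.chart_mem_maximalAtlas x)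
        (IsManifold.chart_mem_maximalAtlas _) ?_
      intro y hy
      have hy' : y ∈ (chartAt (EuclideanSpace ℝ (Fin n)) x).target := by simpa using hy
      simp [hy']
      rfl
    exact h.isImmersion
  · exact isEmbedding_prodMkRight (0 : ℝ)

theorem mfderiv_ruledMap (hn : 1 ≤ n) (hp : IsIsometricImmersion g p) (z : ℝ × M)
    (a : ℝ × EuclideanSpace ℝ (Fin n)) :
    mfderiv (𝓘(ℝ, ℝ).prod (𝓡 n)) 𝓘(ℝ, Minkowski n) (ruledMap p) z a
      = vecDeriv p z.2 ((1 + z.1 • shapeOperator p z.2) a.2) + a.1 • dualMap p z.2 := by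
  have hsm : ContMDiff (𝓘(ℝ, ℝ).prod (𝓡 n)) 𝓘(ℝ, Minkowski n) ∞ (ruledMap p) :=
    (hp.smooth.comp contMDiff_snd).add
      (contMDiff_fst.smul ((contMDiff_dualMap hn hp).comp contMDiff_snd))
  have h1 := mfderiv_prod_eq_add_apply (v := a) (hsm.mdifferentiableAt (x := z) (by simp))
  have h2 : mfderiv 𝓘(ℝ, ℝ) 𝓘(ℝ, Minkowski n) (fun s : ℝ => ruledMap p (s, z.2)) z.1 a.1
      = a.1 • dualMap p z.2 := by
    have h3 : HasFDerivAt (fun s : ℝ => ruledMap p (s, z.2))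
        (ContinuousLinearMap.toSpanSingleton ℝ (dualMap p z.2)) z.1 :=
      ((ContinuousLinearMap.toSpanSingleton ℝ (dualMap p z.2)).hasFDerivAt).const_add (p z.2)
    rw [mfderiv_eq_fderiv, h3.fderiv]
    rfl
  have h4 : vecDeriv (fun x : M => ruledMap p (z.1, x)) z.2 a.2
      = vecDeriv p z.2 ((1 + z.1 • shapeOperator p z.2) a.2) := by
    have hq := mdifferentiableAt_dualMap hn hp z.2
    have h5 : vecDeriv (fun x : M => ruledMap p (z.1, x)) z.2
        = vecDeriv p z.2 + z.1 • vecDeriv (dualMap p) z.2 := by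
      have h6 := mfderiv_add (hp.mdifferentiableAt z.2) (hq.const_smul z.1)
      rw [const_smul_mfderiv hq] at h6
      exact h6
    have h7 : vecDeriv (dualMap p) z.2 a.2 = vecDeriv p z.2 (shapeOperator p z.2 a.2) :=
      mfderiv_dualMap hn hp z.2 a.2
    rw [h5, add_apply, smul_apply, h7, LinearMap.add_apply, LinearMap.smul_apply, map_add, map_smul]
    rfl
  exact h1.trans ((add_comm _ _).trans (congrArg₂ (· + ·) h4 h2))

/-- The metric of the null-space is degenerate along the rulings: only the components tangent to
`M` contribute. -/
theorem nullForm_apply (hn : 1 ≤ n) (hp : IsIsometricImmersion g p) (z : ℝ × M)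
    (a b : ℝ × EuclideanSpace ℝ (Fin n)) :
    nullForm p z a b = g.inner z.2 ((1 + z.1 • shapeOperator p z.2) a.2)
      ((1 + z.1 • shapeOperator p z.2) b.2) := by
  have hdual := isDualVector_dualMap hn hp z.2
  refine Eq.trans ?_ (hp.lorentz_mfderiv z.2 _ _)
  have htan : ∀ v, lorentz (vecDeriv p z.2 v) (dualMap p z.2) = 0 := hdual.inner_tangent
  refine (congrArg₂ lorentz (mfderiv_ruledMap hn hp z a) (mfderiv_ruledMap hn hp z b)).trans ?_
  rw [lorentz_add_left, lorentz_add_right, lorentz_add_right, lorentz_smul_left, lorentz_smul_left,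
    lorentz_smul_right, lorentz_smul_right, lorentz_comm (dualMap p z.2), htan,
    htan, show lorentz (dualMap p z.2) (dualMap p z.2) = 0 from hdual.mem_lightCone]
  simp only [mul_zero, add_zero]
  rfl

/-- The metric `g((1 + s A) ·, (1 + s A) ·)` for a height function `s` on `M`. -/
def heightForm (g : SmoothMetric n M) (p : M → Minkowski n) (s : M → ℝ) : FormField (𝓡 n) M :=
  fun x v w => g.inner x ((1 + s x • shapeOperator p x) v) ((1 + s x • shapeOperator p x) w)

theorem inducedForm_apply (hn : 1 ≤ n) (hp : IsIsometricImmersion g p) {f : M → ℝ × M} {x : M}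
    (hf : MDifferentiableAt (𝓡 n) (𝓘(ℝ, ℝ).prod (𝓡 n)) f x) (v w : EuclideanSpace ℝ (Fin n)) :
    inducedForm p f x v w = g.inner (f x).2
      ((1 + (f x).1 • shapeOperator p (f x).2) (mfderiv (𝓡 n) (𝓡 n) (fun x => (f x).2) x v))
      ((1 + (f x).1 • shapeOperator p (f x).2) (mfderiv (𝓡 n) (𝓡 n) (fun x => (f x).2) x w)) := by
  have h1 : ∀ v : EuclideanSpace ℝ (Fin n),
      (mfderiv (𝓡 n) (𝓘(ℝ, ℝ).prod (𝓡 n)) f x v : ℝ × EuclideanSpace ℝ (Fin n)).2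
        = mfderiv (𝓡 n) (𝓡 n) (fun x => (f x).2) x v := by
    intro v
    have h2 := mfderiv_prodMk hf.fst hf.snd
    exact congrArg (fun T : EuclideanSpace ℝ (Fin n) →L[ℝ] ℝ × EuclideanSpace ℝ (Fin n) =>
      (T v).2) h2
  refine (nullForm_apply hn hp (f x) _ _).trans ?_
  rw [h1, h1]

theorem inducedForm_zero_prodMk (hn : 1 ≤ n) (hp : IsIsometricImmersion g p) :
    inducedForm p (fun x : M => ((0 : ℝ), x)) = g.form := by
  funext x v w
  have hf : MDifferentiableAt (𝓡 n) (𝓘(ℝ, ℝ).prod (𝓡 n)) (fun x : M => ((0 : ℝ), x)) x :=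
    mdifferentiableAt_const.prodMk mdifferentiableAt_id
  refine (inducedForm_apply hn hp hf v w).trans ?_
  have h1 : mfderiv (𝓡 n) (𝓡 n) (fun x : M => x) x = ContinuousLinearMap.id ℝ _ := mfderiv_id
  simp only [h1, zero_smul, add_zero]
  rfl

/-- A map into the null-space induces the pullback of a metric `heightForm`. -/
theorem inducedForm_eq_pullbackForm (hn : 1 ≤ n) (hp : IsIsometricImmersion g p) {f : M → ℝ × M}
    (hf : MDifferentiable (𝓡 n) (𝓘(ℝ, ℝ).prod (𝓡 n)) f) {s : M → ℝ}
    (hs : ∀ x, s (f x).2 = (f x).1) :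
    inducedForm p f = pullbackForm (𝓡 n) (𝓡 n) (fun x => (f x).2) (heightForm g p s) := by
  funext x v w
  refine (inducedForm_apply hn hp (hf x) v w).trans ?_
  simp only [pullbackForm, heightForm, hs]

/-- The horizontal part of a spacelike immersion into the null-space is an immersion, because the
rulings are degenerate. -/
theorem mfderiv_snd_injective (hn : 1 ≤ n) (hp : IsIsometricImmersion g p) {f : M → ℝ × M} {x : M}
    (hf : MDifferentiableAt (𝓡 n) (𝓘(ℝ, ℝ).prod (𝓡 n)) f x)
    (hpos : ∀ v : TangentSpace (𝓡 n) x, v ≠ 0 → 0 < inducedForm p f x v v) :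
    Function.Injective (mfderiv (𝓡 n) (𝓡 n) (fun x => (f x).2) x) := by
  rw [injective_iff_map_eq_zero]
  intro v hv
  by_contra hv0
  refine (hpos v hv0).ne' ((inducedForm_apply hn hp hf v v).trans ?_)
  have h1 : (1 + (f x).1 • shapeOperator p (f x).2)
      (mfderiv (𝓡 n) (𝓡 n) (fun x => (f x).2) x v) = 0 :=
    (congrArg _ hv).trans (map_zero _)
  rw [h1]
  exact map_zero (g.inner (f x).2 0)

/-! ### The volume of a metric `g((1 + s A) ·, (1 + s A) ·)` -/

theorem form_isBilinear (g : SmoothMetric n M) : g.form.IsBilinear := fun x =>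
  ⟨metricBilin g x, fun _ _ => rfl⟩

theorem heightForm_isBilinear (s : M → ℝ) : (heightForm g p s).IsBilinear :=
  (form_isBilinear g).comp (fun x => x) (fun x => 1 + s x • shapeOperator p x) fun _ _ _ => rfl

theorem continuousOn_det_chartMatrix (hp : IsIsometricImmersion g p) (x : M) :
    ContinuousOn (fun y => (chartMatrix g.form (chartAt (EuclideanSpace ℝ (Fin n)) x) y).det)
      (chartAt (EuclideanSpace ℝ (Fin n)) x).target := by
  have he : chartAt (EuclideanSpace ℝ (Fin n)) x ∈ IsManifold.maximalAtlas (𝓡 n) ∞ M :=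
    IsManifold.chart_mem_maximalAtlas x
  refine (contDiffOn_matrix_det (contDiffOn_gramMatrix (chartAt _ x).open_target
    (contDiffOn_comp_symm he hp.smooth))).continuousOn.congr fun y hy => ?_
  exact congrArg _ (chartMatrix_form hp he hy)

theorem det_chartMatrix_pos (hp : IsIsometricImmersion g p) (x : M) :
    ∀ y ∈ (chartAt (EuclideanSpace ℝ (Fin n)) x).target,
      0 < (chartMatrix g.form (chartAt (EuclideanSpace ℝ (Fin n)) x) y).det := by
  intro y hy
  have he : chartAt (EuclideanSpace ℝ (Fin n)) x ∈ IsManifold.maximalAtlas (𝓡 n) ∞ M :=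
    IsManifold.chart_mem_maximalAtlas x
  rw [chartMatrix_form hp he hy]
  exact (gramMatrix_posDef (hp.spacelike_comp_symm he hy)).det_pos

/-- The volume induced by a map into the null-space whose horizontal part is a diffeomorphism
preserving `K`. -/
theorem vol_inducedForm [MeasurableSpace M] [BorelSpace M] [SecondCountableTopology M]
    (hn : 1 ≤ n) (hp : IsIsometricImmersion g p) {f : M → ℝ × M}
    (hf : MDifferentiable (𝓡 n) (𝓘(ℝ, ℝ).prod (𝓡 n)) f) {s : M → ℝ} (hsc : Continuous s)
    (hs : ∀ x, s (f x).2 = (f x).1) (φ : M ≃ₜ M) (hφ : ∀ x, φ x = (f x).2) {K : Set M}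
    (hKm : MeasurableSet K) (hK : φ '' K = K) :
    vol (inducedForm p f) K
      = ∫ x in K, |LinearMap.det (1 + s x • shapeOperator p x)| ∂(volumeMeasure g.form) := by
  have hφ' : (fun x => (f x).2) = φ := funext fun x => (hφ x).symm
  have hdet : Continuous fun x => LinearMap.det (1 + s x • shapeOperator p x) :=
    (contMDiff_det_one_add_smul hn hp).continuous.comp (hsc.prodMk continuous_id)
  rw [vol, inducedForm_eq_pullbackForm hn hp hf hs, hφ',
    volumeMeasure_pullback (heightForm_isBilinear s) φ (fun x => by
      rw [← hφ']
      exact (hf x).snd) K, hK,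
    volumeMeasure_comp (h' := heightForm g p s) (form_isBilinear g)
      (continuousOn_det_chartMatrix hp)
      (fun x => 1 + s x • shapeOperator p x) (fun _ _ _ => rfl)
      hdet.measurable, withDensity_apply _ hKm,
    integral_eq_lintegral_of_nonneg_ae (Filter.Eventually.of_forall fun x => abs_nonneg _)
      hdet.abs.measurable.aestronglyMeasurable]

end NullForm

/-! ### Families of local diffeomorphisms -/

section Inverse

variable {n : ℕ} {M : Type*} [TopologicalSpace M] [ChartedSpace (EuclideanSpace ℝ (Fin n)) M]
  {J : Set ℝ} {F : ℝ × M → M}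

theorem mdifferentiable_of_contMDiffOn (hJ : IsOpen J)
    (hF : ContMDiffOn (𝓘(ℝ, ℝ).prod (𝓡 n)) (𝓡 n) ∞ F (J ×ˢ univ)) {t : ℝ} (ht : t ∈ J) :
    MDifferentiable (𝓡 n) (𝓡 n) fun x => F (t, x) := fun x => by
  have h1 : ContMDiffAt (𝓘(ℝ, ℝ).prod (𝓡 n)) (𝓡 n) ∞ F (t, x) :=
    hF.contMDiffAt ((hJ.prod isOpen_univ).mem_nhds ⟨ht, mem_univ _⟩)
  have h2 : ContMDiffAt (𝓡 n) (𝓡 n) ∞ (fun x => F (t, x)) x :=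
    h1.comp x (contMDiffAt_const.prodMk contMDiffAt_id)
  exact h2.mdifferentiableAt (by simp)

variable [IsManifold (𝓡 n) ∞ M]

/-- Inverse function theorem for `(t, x) ↦ (t, F (t, x))`. -/
theorem exists_local_inverse (hJ : IsOpen J)
    (hF : ContMDiffOn (𝓘(ℝ, ℝ).prod (𝓡 n)) (𝓡 n) ∞ F (J ×ˢ univ)) {t : ℝ} (ht : t ∈ J) (x : M)
    (hinj : Function.Injective (mfderiv (𝓡 n) (𝓡 n) (fun x => F (t, x)) x)) :
    ∃ L : ℝ × M → ℝ × M,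
      ContMDiffAt (𝓘(ℝ, ℝ).prod (𝓡 n)) (𝓘(ℝ, ℝ).prod (𝓡 n)) ∞ L (t, F (t, x)) ∧
      (∀ᶠ z : ℝ × M in 𝓝 (t, x), L (z.1, F z) = z) ∧
      ∀ᶠ w : ℝ × M in 𝓝 (t, F (t, x)), ((L w).1, F (L w)) = w := by
  set e := chartAt (EuclideanSpace ℝ (Fin n)) x
  set e' := chartAt (EuclideanSpace ℝ (Fin n)) (F (t, x))
  have he : e ∈ IsManifold.maximalAtlas (𝓡 n) ∞ M := IsManifold.chart_mem_maximalAtlas x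
  have he' : e' ∈ IsManifold.maximalAtlas (𝓡 n) ∞ M := IsManifold.chart_mem_maximalAtlas _
  have hx : x ∈ e.source := mem_chart_source _ x
  have hy : e x ∈ e.target := e.map_source hx
  have hx' : F (t, x) ∈ e'.source := mem_chart_source _ _
  have hFat : ContMDiffAt (𝓘(ℝ, ℝ).prod (𝓡 n)) (𝓡 n) ∞ F (t, x) :=
    hF.contMDiffAt ((hJ.prod isOpen_univ).mem_nhds ⟨ht, mem_univ _⟩)
  -- the map in charts
  set ψ : ℝ × EuclideanSpace ℝ (Fin n) → ℝ × EuclideanSpace ℝ (Fin n) :=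
    fun z => (z.1, e' (F (z.1, e.symm z.2))) with hψdef
  have hsymmAt : ContMDiffAt 𝓘(ℝ, ℝ × EuclideanSpace ℝ (Fin n)) (𝓘(ℝ, ℝ).prod (𝓡 n)) ∞
      (fun z : ℝ × EuclideanSpace ℝ (Fin n) => (z.1, e.symm z.2)) (t, e x) :=
    (contMDiffOn_prodMk_chart_symm he).contMDiffAt
      ((isOpen_univ.prod e.open_target).mem_nhds ⟨mem_univ _, hy⟩)
  have hback : ((t, e.symm (e x)) : ℝ × M) = (t, x) := by rw [e.left_inv hx]
  have hFψ : ContMDiffAt 𝓘(ℝ, ℝ × EuclideanSpace ℝ (Fin n)) (𝓡 n) ∞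
      (fun z : ℝ × EuclideanSpace ℝ (Fin n) => F (z.1, e.symm z.2)) (t, e x) :=
    ContMDiffAt.comp (t, e x) (g := F) (by rw [hback]; exact hFat) hsymmAt
  have hψ : ContDiffAt ℝ ∞ ψ (t, e x) := by
    have h1 : ContMDiffAt 𝓘(ℝ, ℝ × EuclideanSpace ℝ (Fin n)) (𝓡 n) ∞
        (fun z : ℝ × EuclideanSpace ℝ (Fin n) => e' (F (z.1, e.symm z.2))) (t, e x) := by
      refine ContMDiffAt.comp (t, e x) (g := e') ?_ hFψ
      refine contMDiffAt_of_mem_maximalAtlas he' ?_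
      rw [hback]
      exact hx'
    exact contDiffAt_fst.prodMk h1.contDiffAt
  have hψd : DifferentiableAt ℝ ψ (t, e x) := hψ.differentiableAt (by simp)
  -- the differential in charts is injective
  have hψinj : Function.Injective (fderiv ℝ ψ (t, e x)) := by
    rw [injective_iff_map_eq_zero]
    rintro ⟨a, v⟩ hav
    have h1 : fderiv ℝ (fun z => (ψ z).1) (t, e x) (a, v) = a := by
      have : (fun z => (ψ z).1) = fun z : ℝ × EuclideanSpace ℝ (Fin n) => z.1 := rfl
      rw [this, fderiv_fst]
      rfl
    have ha : a = 0 := by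
      rw [← h1, fderiv.fst hψd]
      simp [hav]
    subst ha
    have h2 : HasFDerivAt (fun y => ψ (t, y))
        ((fderiv ℝ ψ (t, e x)).comp (ContinuousLinearMap.inr ℝ ℝ (EuclideanSpace ℝ (Fin n))))
        (e x) :=
      HasFDerivAt.comp (e x) (g := ψ) hψd.hasFDerivAt (hasFDerivAt_prodMk_right t (e x))
    have h3 : fderiv ℝ (fun z => e' (F (t, e.symm z))) (e x) v = 0 := by
      have h4 : HasFDerivAt (fun z => e' (F (t, e.symm z))) _ (e x) := h2.snd
      rw [h4.fderiv]
      simp [hav]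
    have h5 := mfderiv_comp_chartFrame he he' (f := fun x => F (t, x)) hy
      (mdifferentiable_of_contMDiffOn hJ hF ht _) (by rw [e.left_inv hx]; exact hx')
    have h6 : mfderiv (𝓡 n) (𝓡 n) (fun x => F (t, x)) (e.symm (e x)) (chartFrame e (e x) v)
        = (0 : EuclideanSpace ℝ (Fin n)) := by
      have h7 := congrArg
        (fun T : EuclideanSpace ℝ (Fin n) →L[ℝ] EuclideanSpace ℝ (Fin n) => T v) h5
      refine h7.trans ?_
      rw [ContinuousLinearMap.comp_apply, h3, map_zero]
    rw [e.left_inv hx] at h6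
    have h8 : chartFrame e (e x) v = 0 := hinj (h6.trans (map_zero _).symm)
    have h9 : v = 0 := (chartFrame_bijective he hy).1 (h8.trans (map_zero _).symm)
    rw [h9]
    rfl
  let f' : (ℝ × EuclideanSpace ℝ (Fin n)) ≃L[ℝ] (ℝ × EuclideanSpace ℝ (Fin n)) :=
    (LinearEquiv.ofInjectiveEndo (fderiv ℝ ψ (t, e x)).toLinearMap hψinj).toContinuousLinearEquiv
  have hf' : HasFDerivAt ψ (f' : _ →L[ℝ] _) (t, e x) := by
    have : (f' : (ℝ × EuclideanSpace ℝ (Fin n)) →L[ℝ] (ℝ × EuclideanSpace ℝ (Fin n)))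
        = fderiv ℝ ψ (t, e x) := by
      ext z <;> rfl
    rw [this]
    exact hψd.hasFDerivAt
  let Φ := hψ.toOpenPartialHomeomorph ψ hf' (by simp)
  have hΦ : ∀ z, Φ z = ψ z := fun z => rfl
  have hΦs : (t, e x) ∈ Φ.source := hψ.mem_toOpenPartialHomeomorph_source hf' (by simp)
  have hψx : ψ (t, e x) = (t, e' (F (t, x))) := by simp only [hψdef, hback]
  have hΦt : (t, e' (F (t, x))) ∈ Φ.target := by
    rw [← hψx]
    exact hψ.image_mem_toOpenPartialHomeomorph_target hf' (by simp)
  have hΦsymm : Φ.symm (t, e' (F (t, x))) = (t, e x) := by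
    rw [← hψx]
    exact Φ.left_inv hΦs
  have hΦsm : ContDiffAt ℝ ∞ Φ.symm (t, e' (F (t, x))) := by
    rw [← hψx]
    exact hψ.to_localInverse hf' (by simp)
  refine ⟨fun w => ((Φ.symm (w.1, e' w.2)).1, e.symm (Φ.symm (w.1, e' w.2)).2), ?_, ?_, ?_⟩
  · have h1 : ContMDiffAt (𝓘(ℝ, ℝ).prod (𝓡 n)) 𝓘(ℝ, ℝ × EuclideanSpace ℝ (Fin n)) ∞
        (fun w : ℝ × M => Φ.symm (w.1, e' w.2)) (t, F (t, x)) :=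
      ContMDiffAt.comp (t, F (t, x)) hΦsm.contMDiffAt
        (contMDiffAt_prodMk_chart he' (z := (t, F (t, x))) hx')
    exact ContMDiffAt.comp (t, F (t, x))
      (g := fun z : ℝ × EuclideanSpace ℝ (Fin n) => (z.1, e.symm z.2))
      (by rw [hΦsymm]; exact hsymmAt) h1
  · have h1 : ContinuousAt (fun z : ℝ × M => (z.1, e z.2)) (t, x) :=
      (contMDiffAt_prodMk_chart he (z := (t, x)) hx).continuousAt
    filter_upwards [h1.preimage_mem_nhds (Φ.open_source.mem_nhds hΦs),
      continuousAt_snd.preimage_mem_nhds (e.open_source.mem_nhds hx)] with z hz hze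
    have h2 : Φ.symm (ψ (z.1, e z.2)) = (z.1, e z.2) := Φ.left_inv hz
    have hze' : e.symm (e z.2) = z.2 := e.left_inv hze
    simp only [hψdef, hze'] at h2
    rw [h2, hze']
  · have h1 : ContinuousAt (fun w : ℝ × M => (w.1, e' w.2)) (t, F (t, x)) :=
      (contMDiffAt_prodMk_chart he' (z := (t, F (t, x))) hx').continuousAt
    have h2 : ContinuousAt (fun w : ℝ × M => Φ.symm (w.1, e' w.2)) (t, F (t, x)) :=
      ContinuousAt.comp (g := Φ.symm) hΦsm.continuousAt h1
    have h3 : ContinuousAt (fun w : ℝ × M => F ((Φ.symm (w.1, e' w.2)).1,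
        e.symm (Φ.symm (w.1, e' w.2)).2)) (t, F (t, x)) := by
      refine ContinuousAt.comp (g := fun z : ℝ × EuclideanSpace ℝ (Fin n) =>
        F (z.1, e.symm z.2)) ?_ h2
      rw [hΦsymm]
      exact hFψ.continuousAt
    have h4 : F ((Φ.symm (t, e' (F (t, x)))).1, e.symm (Φ.symm (t, e' (F (t, x)))).2)
        ∈ e'.source := by
      rw [hΦsymm, hback]
      exact hx'
    filter_upwards [h1.preimage_mem_nhds (Φ.open_target.mem_nhds hΦt),
      h3.preimage_mem_nhds (e'.open_source.mem_nhds h4),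
      continuousAt_snd.preimage_mem_nhds (e'.open_source.mem_nhds hx')] with w hw hwF hwe
    have h5 : ψ (Φ.symm (w.1, e' w.2)) = (w.1, e' w.2) := Φ.right_inv hw
    have h6 := congrArg Prod.fst h5
    have h7 := congrArg Prod.snd h5
    exact Prod.ext h6 (e'.injOn hwF hwe h7)

variable [T2Space M]

/-- A smooth family of local diffeomorphisms that starts at the identity, and is the identity
outside of a compact set, consists of bijections for small times. -/
theorem eventually_bijective (hJ : IsOpen J) (h0J : (0 : ℝ) ∈ J)
    (hF : ContMDiffOn (𝓘(ℝ, ℝ).prod (𝓡 n)) (𝓡 n) ∞ F (J ×ˢ univ))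
    (hinj : ∀ t ∈ J, ∀ x, Function.Injective (mfderiv (𝓡 n) (𝓡 n) (fun x => F (t, x)) x))
    (h0 : ∀ x, F (0, x) = x) {K : Set M} (hK : IsCompact K)
    (hFK : ∀ t ∈ J, ∀ x ∉ K, F (t, x) = x) :
    ∀ᶠ t in 𝓝 (0 : ℝ), Function.Bijective fun x => F (t, x) := by
  have : LocallyCompactSpace M := ChartedSpace.locallyCompactSpace (EuclideanSpace ℝ (Fin n)) M
  have hcont : ∀ x, ContinuousAt F (0, x) := fun x =>
    (hF.contMDiffAt ((hJ.prod isOpen_univ).mem_nhds ⟨h0J, mem_univ x⟩)).continuousAt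
  have hJ0 : ∀ᶠ t in 𝓝 (0 : ℝ), t ∈ J := hJ.mem_nhds h0J
  -- surjectivity onto `K`
  have hsurj : ∀ᶠ t in 𝓝 (0 : ℝ), ∀ y ∈ K, ∃ x, F (t, x) = y := by
    refine hK.eventually_forall_of_forall_eventually fun y _ => ?_
    obtain ⟨L, -, -, hL⟩ := exists_local_inverse hJ hF h0J y (hinj 0 h0J y)
    rw [h0] at hL
    filter_upwards [hL] with w hw
    have h1 := congrArg Prod.fst hw
    have h2 := congrArg Prod.snd hw
    exact ⟨(L w).2, by simpa [← h1] using h2⟩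
  -- injectivity on a neighbourhood `K'` of `K`
  obtain ⟨K', hK', hKK'⟩ := exists_compact_superset hK
  have hstay : ∀ᶠ t in 𝓝 (0 : ℝ), ∀ x ∈ K, F (t, x) ∈ interior K' := by
    refine hK.eventually_forall_of_forall_eventually fun x hx => ?_
    refine (hcont x).eventually (isOpen_interior.mem_nhds ?_)
    rw [h0]
    exact hKK' hx
  have hinj' : ∀ᶠ t in 𝓝 (0 : ℝ), ∀ z ∈ K' ×ˢ K', F (t, z.1) = F (t, z.2) → z.1 = z.2 := by
    refine (hK'.prod hK').eventually_forall_of_forall_eventually fun z _ => ?_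
    obtain ⟨x, x'⟩ := z
    have hc1 : ContinuousAt (fun w : ℝ × M × M => (w.1, w.2.1)) (0, (x, x')) := by fun_prop
    have hc2 : ContinuousAt (fun w : ℝ × M × M => (w.1, w.2.2)) (0, (x, x')) := by fun_prop
    by_cases hxx : x = x'
    · subst hxx
      obtain ⟨L, -, hL, -⟩ := exists_local_inverse hJ hF h0J x (hinj 0 h0J x)
      filter_upwards [hc1.eventually hL, hc2.eventually hL] with w hw1 hw2 hw
      have h1 : L (w.1, F (w.1, w.2.1)) = (w.1, w.2.1) := hw1
      have h2 : L (w.1, F (w.1, w.2.2)) = (w.1, w.2.2) := hw2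
      rw [hw, h2] at h1
      exact (congrArg Prod.snd h1).symm
    · have hc : ContinuousAt (fun w : ℝ × M × M => (F (w.1, w.2.1), F (w.1, w.2.2)))
          (0, (x, x')) :=
        (ContinuousAt.comp (g := F) (f := fun w : ℝ × M × M => (w.1, w.2.1))
          (x := (0, (x, x'))) (hcont x) hc1).prodMk
          (ContinuousAt.comp (g := F) (f := fun w : ℝ × M × M => (w.1, w.2.2))
            (x := (0, (x, x'))) (hcont x') hc2)
      have hne : ((F (0, x), F (0, x')) : M × M) ∈ (diagonal M)ᶜ := by
        rw [h0, h0]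
        exact hxx
      filter_upwards [hc.preimage_mem_nhds (isClosed_diagonal.isOpen_compl.mem_nhds hne)]
        with w hw hw'
      exact absurd hw' hw
  filter_upwards [hJ0, hsurj, hstay, hinj'] with t ht hs hst hi
  have hKsub : K ⊆ K' := hKK'.trans interior_subset
  have hmem : ∀ x ∈ K, ∀ x', F (t, x) = F (t, x') → x = x' := by
    intro x hx x' hxx'
    refine hi (x, x') ⟨hKsub hx, ?_⟩ hxx'
    by_cases hx' : x' ∈ K
    · exact hKsub hx'
    · rw [← hFK t ht x' hx', ← hxx']
      exact interior_subset (hst x hx)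
  refine ⟨fun x x' hxx' => ?_, fun y => ?_⟩
  · by_cases hx : x ∈ K
    · exact hmem x hx x' hxx'
    by_cases hx' : x' ∈ K
    · exact (hmem x' hx' x hxx'.symm).symm
    · simpa [hFK t ht x hx, hFK t ht x' hx'] using hxx'
  · by_cases hy : y ∈ K
    · exact hs y hy
    · exact ⟨y, hFK t ht y hy⟩

/-- For small times, the inverses of a family as in `eventually_bijective` form a smooth family. -/
theorem exists_smooth_inverse (hJ : IsOpen J) (h0J : (0 : ℝ) ∈ J)
    (hF : ContMDiffOn (𝓘(ℝ, ℝ).prod (𝓡 n)) (𝓡 n) ∞ F (J ×ˢ univ))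
    (hinj : ∀ t ∈ J, ∀ x, Function.Injective (mfderiv (𝓡 n) (𝓡 n) (fun x => F (t, x)) x))
    (h0 : ∀ x, F (0, x) = x) {K : Set M} (hK : IsCompact K)
    (hFK : ∀ t ∈ J, ∀ x ∉ K, F (t, x) = x) :
    ∃ δ > 0, Ioo (-δ) δ ⊆ J ∧ ∃ θ : ℝ × M → M,
      ContMDiffOn (𝓘(ℝ, ℝ).prod (𝓡 n)) (𝓡 n) ∞ θ (Ioo (-δ) δ ×ˢ univ) ∧
      ∀ t ∈ Ioo (-δ) δ, ∀ x, F (t, θ (t, x)) = x ∧ θ (t, F (t, x)) = x := by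
  obtain ⟨δ, hδ, hball⟩ := Metric.mem_nhds_iff.1 (Filter.inter_mem (hJ.mem_nhds h0J)
    (eventually_bijective hJ h0J hF hinj h0 hK hFK))
  rw [Real.ball_eq_Ioo, zero_sub, zero_add] at hball
  have hbij : ∀ t ∈ Ioo (-δ) δ, Function.Bijective fun x => F (t, x) := fun t ht => (hball ht).2
  have hex : ∀ z : ℝ × M, ∃ x, z.1 ∈ Ioo (-δ) δ → F (z.1, x) = z.2 := fun z => by
    by_cases hz : z.1 ∈ Ioo (-δ) δ
    · obtain ⟨x, hx⟩ := (hbij z.1 hz).2 z.2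
      exact ⟨x, fun _ => hx⟩
    · exact ⟨z.2, fun h => absurd h hz⟩
  choose θ hθ using hex
  refine ⟨δ, hδ, fun t ht => (hball ht).1, θ, ?_, fun t ht x =>
    ⟨hθ (t, x) ht, (hbij t ht).1 (hθ (t, F (t, x)) ht)⟩⟩
  rintro ⟨t, y⟩ ⟨ht, -⟩
  have htJ : t ∈ J := (hball ht).1
  obtain ⟨L, hLsm, -, hL⟩ := exists_local_inverse hJ hF htJ (θ (t, y)) (hinj t htJ _)
  rw [show F (t, θ (t, y)) = y from hθ (t, y) ht] at hLsm hL
  refine (ContMDiffAt.congr_of_eventuallyEq hLsm.snd ?_).contMDiffWithinAt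
  filter_upwards [hL, (isOpen_Ioo.prod isOpen_univ).mem_nhds
    (show (t, y) ∈ Ioo (-δ) δ ×ˢ univ from ⟨ht, mem_univ _⟩)] with w hw hwt
  have h1 := congrArg Prod.fst hw
  have h2 := congrArg Prod.snd hw
  refine (hbij w.1 hwt.1).1 ((hθ w hwt.1).trans ?_)
  rw [← h2, ← h1]

end Inverse

/-! ### The first and the second variation of volume -/

section Variation

open Polynomial in
theorem exists_polynomial_linearMap_det_one_add_smul {n : ℕ}
    (A : EuclideanSpace ℝ (Fin n) →ₗ[ℝ] EuclideanSpace ℝ (Fin n)) :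
    ∃ P : ℝ[X], (∀ s : ℝ, LinearMap.det (1 + s • A) = P.eval s) ∧
      P.derivative.eval 0 = LinearMap.trace ℝ _ A ∧
      P.derivative.derivative.eval 0
        = LinearMap.trace ℝ _ A ^ 2 - LinearMap.trace ℝ _ (A * A) := by
  obtain ⟨P, h1, h2, h3⟩ :=
    exists_polynomial_det_one_add_smul (LinearMap.toMatrix (stdBasis n) (stdBasis n) A)
  refine ⟨P, fun s => ?_, ?_, ?_⟩
  · rw [← h1, ← LinearMap.det_toMatrix (stdBasis n), map_add, map_smul, LinearMap.toMatrix_one]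
  · rw [h2, LinearMap.trace_eq_matrix_trace ℝ (stdBasis n)]
  · rw [h3, LinearMap.trace_eq_matrix_trace ℝ (stdBasis n),
      LinearMap.trace_eq_matrix_trace ℝ (stdBasis n), LinearMap.toMatrix_mul]

variable {n : ℕ} {M : Type*} [TopologicalSpace M] [ChartedSpace (EuclideanSpace ℝ (Fin n)) M]
  {p : M → Minkowski n} {J : Set ℝ} {σ : ℝ × M → ℝ}

theorem deriv_det_height (hJ : IsOpen J) (h0J : (0 : ℝ) ∈ J)
    (hσ : ContMDiffOn (𝓘(ℝ, ℝ).prod (𝓡 n)) 𝓘(ℝ, ℝ) ∞ σ (J ×ˢ univ)) (hσ0 : ∀ x, σ (0, x) = 0)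
    (x : M) :
    deriv (fun s => LinearMap.det (1 + σ (s, x) • shapeOperator p x)) 0
      = deriv (fun s => σ (s, x)) 0 * LinearMap.trace ℝ _ (shapeOperator p x) := by
  obtain ⟨P, h1, h2, -⟩ := exists_polynomial_linearMap_det_one_add_smul (shapeOperator p x)
  simp only [h1, ← h2]
  have hd := (differentiableAt_of_contMDiffOn hJ hσ h0J x).hasDerivAt
  have h3 : deriv (fun s => P.eval (σ (s, x))) 0
      = P.derivative.eval (σ (0, x)) * deriv (fun s => σ (s, x)) 0 :=
    (HasDerivAt.comp (h₂ := fun y => P.eval y) (0 : ℝ) (P.hasDerivAt (σ (0, x))) hd).deriv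
  rw [h3, hσ0, mul_comm]

variable [IsManifold (𝓡 n) ∞ M] {g : SmoothMetric n M}

theorem contMDiffOn_det_height (hn : 1 ≤ n) (hp : IsIsometricImmersion g p)
    (hσ : ContMDiffOn (𝓘(ℝ, ℝ).prod (𝓡 n)) 𝓘(ℝ, ℝ) ∞ σ (J ×ˢ univ)) :
    ContMDiffOn (𝓘(ℝ, ℝ).prod (𝓡 n)) 𝓘(ℝ, ℝ) ∞
      (fun z : ℝ × M => LinearMap.det (1 + σ z • shapeOperator p z.2)) (J ×ˢ univ) :=
  (contMDiff_det_one_add_smul hn hp).comp_contMDiffOn (hσ.prodMk contMDiffOn_snd)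

theorem deriv_deriv_det_height (hJ : IsOpen J) (h0J : (0 : ℝ) ∈ J)
    (hσ : ContMDiffOn (𝓘(ℝ, ℝ).prod (𝓡 n)) 𝓘(ℝ, ℝ) ∞ σ (J ×ˢ univ)) (hσ0 : ∀ x, σ (0, x) = 0)
    {x : M} (htr : LinearMap.trace ℝ _ (shapeOperator p x) = 0) :
    deriv (deriv fun s => LinearMap.det (1 + σ (s, x) • shapeOperator p x)) 0
      = -(deriv (fun s => σ (s, x)) 0 ^ 2
        * LinearMap.trace ℝ _ (shapeOperator p x * shapeOperator p x)) := by
  obtain ⟨P, h1, h2, h3⟩ := exists_polynomial_linearMap_det_one_add_smul (shapeOperator p x)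
  rw [htr] at h2
  simp only [h1]
  have hd : ∀ s ∈ J, HasDerivAt (fun s => σ (s, x)) (deriv (fun s => σ (s, x)) s) s := fun s hs =>
    (differentiableAt_of_contMDiffOn hJ hσ hs x).hasDerivAt
  have h4 : deriv (fun s => P.eval (σ (s, x))) =ᶠ[𝓝 0]
      fun s => P.derivative.eval (σ (s, x)) * deriv (fun s => σ (s, x)) s := by
    filter_upwards [hJ.mem_nhds h0J] with s hs
    exact ((P.hasDerivAt (σ (s, x))).comp s (hd s hs)).deriv
  have h5 := (differentiableAt_of_contMDiffOn hJ (contMDiffOn_deriv hJ hσ) h0J x).hasDerivAt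
  have h6 : HasDerivAt (fun s => P.derivative.eval (σ (s, x)))
      (P.derivative.derivative.eval (σ (0, x)) * deriv (fun s => σ (s, x)) 0) 0 :=
    HasDerivAt.comp (h₂ := fun y => P.derivative.eval y) (0 : ℝ)
      (P.derivative.hasDerivAt (σ (0, x))) (hd 0 h0J)
  rw [h4.deriv_eq]
  refine (h6.mul h5).deriv.trans ?_
  rw [hσ0, h2, h3, htr]
  ring

/-- Moving along the rulings with a compactly supported speed `f` is a variation. -/
theorem exists_isVariation (hn : 1 ≤ n) (hp : IsIsometricImmersion g p) {f : M → ℝ}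
    (hf : ContMDiff (𝓡 n) 𝓘(ℝ, ℝ) ∞ f) {K : Set M} (hK : IsCompact K) (hfK : ∀ x ∉ K, f x = 0) :
    ∃ ε, IsVariation p ε K fun t x => (t * f x, x) := by
  have hdet : ∀ᶠ t in 𝓝 (0 : ℝ), ∀ x ∈ K,
      0 < LinearMap.det (1 + (t * f x) • shapeOperator p x) := by
    refine hK.eventually_forall_of_forall_eventually fun x _ => ?_
    have h1 : Continuous fun z : ℝ × M =>
        LinearMap.det (1 + (z.1 * f z.2) • shapeOperator p z.2) :=
      (contMDiff_det_one_add_smul hn hp).continuous.comp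
        ((continuous_fst.mul (hf.continuous.comp continuous_snd)).prodMk continuous_snd)
    refine h1.continuousAt.eventually (lt_mem_nhds ?_)
    simp
  obtain ⟨ε, hε, hball⟩ := Metric.mem_nhds_iff.1 hdet
  rw [Real.ball_eq_Ioo, zero_sub, zero_add] at hball
  refine ⟨ε, hε, ?_, fun t ht x v hv => ?_, fun x => by simp, hK, fun t _ x hx => by
    simp [hfK x hx]⟩
  · exact ((contMDiff_fst.mul (hf.comp contMDiff_snd)).prodMk contMDiff_snd).contMDiffOn
  · have hd : MDifferentiableAt (𝓡 n) (𝓘(ℝ, ℝ).prod (𝓡 n)) (fun x => (t * f x, x)) x :=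
      ((contMDiff_const.mul hf).prodMk contMDiff_id).mdifferentiableAt (by simp)
    have hpos : 0 < LinearMap.det (1 + (t * f x) • shapeOperator p x) := by
      by_cases hx : x ∈ K
      · exact hball ht x hx
      · simp [hfK x hx]
    have h1 : mfderiv (𝓡 n) (𝓡 n) (fun x : M => x) x = ContinuousLinearMap.id ℝ _ := mfderiv_id
    refine lt_of_lt_of_eq (g.pos x ((1 + (t * f x) • shapeOperator p x) v) fun h => hv ?_)
      (Eq.trans ?_ (inducedForm_apply hn hp hd v v).symm)
    -- `1 + t f A` is injective, its determinant being nonzero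
    · exact (LinearMap.equivOfDetNeZero _ hpos.ne').injective (h.trans (map_zero _).symm)
    · simp only [h1]
      rfl

variable [T2Space M] [MeasurableSpace M] [BorelSpace M]

/-- Analytic form of the variation formulas: the derivatives of the volume are the integrals of the
derivatives of `det (1 + σ A)`. -/
theorem hasDerivAt_volumeFunction (hn : 1 ≤ n) (hp : IsIsometricImmersion g p) {K : Set M}
    (hK : IsCompact K) {G : ℝ → M → ℝ × M} {δ : ℝ}
    (hσ : ContMDiffOn (𝓘(ℝ, ℝ).prod (𝓡 n)) 𝓘(ℝ, ℝ) ∞ σ (Ioo (-δ) δ ×ˢ univ))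
    (hV : ∀ t ∈ Ioo (-δ) δ, volumeFunction p K G t
      = ∫ x in K, LinearMap.det (1 + σ (t, x) • shapeOperator p x) ∂(volumeMeasure g.form))
    {t : ℝ} (ht : t ∈ Ioo (-δ) δ) :
    HasDerivAt (volumeFunction p K G)
      (∫ x in K, deriv (fun s => LinearMap.det (1 + σ (s, x) • shapeOperator p x)) t
        ∂(volumeMeasure g.form)) t := by
  have := isLocallyFiniteMeasure_volumeMeasure (form_isBilinear g) (continuousOn_det_chartMatrix hp)
  refine (hasDerivAt_setIntegral (volumeMeasure g.form) hK isOpen_Ioo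
    (contMDiffOn_det_height hn hp hσ) ht).congr_of_eventuallyEq ?_
  filter_upwards [isOpen_Ioo.mem_nhds ht] with s hs
  exact hV s hs

variable [SecondCountableTopology M]

/-- For small times, a variation is described, up to a diffeomorphism preserving `K`, by a smooth
height function `σ` vanishing at time zero, and the volume is the integral of `det (1 + σ A)`. -/
theorem IsVariation.exists_height (hn : 1 ≤ n) (hp : IsIsometricImmersion g p) {ε : ℝ} {K : Set M}
    {G : ℝ → M → ℝ × M} (hG : IsVariation p ε K G) :
    ∃ δ > 0, ∃ σ : ℝ × M → ℝ,
      ContMDiffOn (𝓘(ℝ, ℝ).prod (𝓡 n)) 𝓘(ℝ, ℝ) ∞ σ (Ioo (-δ) δ ×ˢ univ) ∧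
      (∀ t ∈ Ioo (-δ) δ, ∀ x, σ (t, (G t x).2) = (G t x).1) ∧
      ∀ t ∈ Ioo (-δ) δ, volumeFunction p K G t
        = ∫ x in K, LinearMap.det (1 + σ (t, x) • shapeOperator p x) ∂(volumeMeasure g.form) := by
  set J := Ioo (-ε) ε with hJdef
  have hJ : IsOpen J := isOpen_Ioo
  have h0J : (0 : ℝ) ∈ J := ⟨by linarith [hG.eps_pos], hG.eps_pos⟩
  have hGd : ∀ t ∈ J, MDifferentiable (𝓡 n) (𝓘(ℝ, ℝ).prod (𝓡 n)) (G t) := by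
    intro t ht x
    have h1 : ContMDiffAt (𝓘(ℝ, ℝ).prod (𝓡 n)) (𝓘(ℝ, ℝ).prod (𝓡 n)) ∞
        (fun z : ℝ × M => G z.1 z.2) (t, x) :=
      hG.smooth.contMDiffAt ((hJ.prod isOpen_univ).mem_nhds ⟨ht, mem_univ _⟩)
    have h2 : ContMDiffAt (𝓡 n) (𝓘(ℝ, ℝ).prod (𝓡 n)) ∞ (fun x => G t x) x :=
      h1.comp x (contMDiffAt_const.prodMk contMDiffAt_id)
    exact h2.mdifferentiableAt (by simp)
  obtain ⟨δ, hδ, hδJ, θ, hθ, hθF⟩ := exists_smooth_inverse (F := fun z : ℝ × M => (G z.1 z.2).2)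
    hJ h0J (contMDiff_snd.comp_contMDiffOn hG.smooth)
    (fun t ht x => mfderiv_snd_injective hn hp (hGd t ht x) (hG.spacelike t ht x))
    (fun x => by simp [hG.initial]) hG.isCompact (fun t ht x hx => by simp [hG.support t ht x hx])
  set σ : ℝ × M → ℝ := fun z => (G z.1 (θ z)).1 with hσdef
  have hσ : ContMDiffOn (𝓘(ℝ, ℝ).prod (𝓡 n)) 𝓘(ℝ, ℝ) ∞ σ (Ioo (-δ) δ ×ˢ univ) := by
    have h1 : ContMDiffOn (𝓘(ℝ, ℝ).prod (𝓡 n)) (𝓘(ℝ, ℝ).prod (𝓡 n)) ∞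
        (fun z : ℝ × M => (z.1, θ z)) (Ioo (-δ) δ ×ˢ univ) := contMDiffOn_fst.prodMk hθ
    exact (contMDiff_fst.comp_contMDiffOn hG.smooth).comp h1 fun z hz => ⟨hδJ hz.1, mem_univ _⟩
  have hσG : ∀ t ∈ Ioo (-δ) δ, ∀ x, σ (t, (G t x).2) = (G t x).1 := fun t ht x => by
    simp only [hσdef, (hθF t ht x).2]
  have h0δ : (0 : ℝ) ∈ Ioo (-δ) δ := ⟨by linarith, hδ⟩
  have hσ0 : ∀ x, σ (0, x) = 0 := fun x => by
    simpa [hG.initial] using hσG 0 h0δ x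
  -- the determinant is positive on `K` for small times, being equal to one at time zero
  have hpos : ∀ᶠ t in 𝓝 (0 : ℝ), ∀ x ∈ K,
      0 < LinearMap.det (1 + σ (t, x) • shapeOperator p x) := by
    refine hG.isCompact.eventually_forall_of_forall_eventually fun x _ => ?_
    have h1 := (contMDiffOn_det_height hn hp hσ).continuousOn.continuousAt
      ((isOpen_Ioo.prod isOpen_univ).mem_nhds (⟨h0δ, mem_univ x⟩ : (0, x) ∈ Ioo (-δ) δ ×ˢ univ))
    refine h1.eventually (lt_mem_nhds ?_)
    simp [hσ0]
  obtain ⟨δ', hδ', hball⟩ := Metric.mem_nhds_iff.1 hpos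
  rw [Real.ball_eq_Ioo, zero_sub, zero_add] at hball
  have hmin : 0 < min δ δ' := lt_min hδ hδ'
  have hsub : Ioo (-min δ δ') (min δ δ') ⊆ Ioo (-δ) δ :=
    Ioo_subset_Ioo (neg_le_neg (min_le_left _ _)) (min_le_left _ _)
  have hsub' : Ioo (-min δ δ') (min δ δ') ⊆ Ioo (-δ') δ' :=
    Ioo_subset_Ioo (neg_le_neg (min_le_right _ _)) (min_le_right _ _)
  refine ⟨min δ δ', hmin, σ, hσ.mono (prod_mono hsub subset_rfl),
    fun t ht => hσG t (hsub ht), fun t ht => ?_⟩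
  have ht' := hsub ht
  have htJ := hδJ ht'
  have hKm : MeasurableSet K := hG.isCompact.isClosed.measurableSet
  let φ : M ≃ₜ M :=
    { toFun := fun x => (G t x).2
      invFun := fun y => θ (t, y)
      left_inv := fun x => (hθF t ht' x).2
      right_inv := fun y => (hθF t ht' y).1
      continuous_toFun := continuous_snd.comp (hGd t htJ).continuous
      continuous_invFun := hθ.continuousOn.comp_continuous (Continuous.prodMk_right t)
        fun x => ⟨ht', mem_univ _⟩ }
  have hφ : ∀ x, φ x = (G t x).2 := fun x => rfl
  have hφK : ∀ x ∉ K, φ x = x := fun x hx => by rw [hφ, hG.support t htJ x hx]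
  -- `φ` is injective and fixes every point outside of `K`, so it preserves `K`
  have hK : φ '' K = K := by
    ext y
    constructor
    · rintro ⟨x, hx, rfl⟩
      by_contra hy
      exact hy (by rwa [φ.injective (hφK _ hy)])
    · intro hy
      obtain ⟨x, rfl⟩ := φ.surjective y
      refine ⟨x, ?_, rfl⟩
      by_contra hx
      exact hx (by rwa [hφK x hx] at hy)
  have hσc : Continuous fun x => σ (t, x) :=
    hσ.continuousOn.comp_continuous (Continuous.prodMk_right t) fun x => ⟨ht', mem_univ _⟩
  rw [volumeFunction, vol_inducedForm hn hp (hGd t htJ) hσc (hσG t ht') φ hφ hKm hK]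
  exact setIntegral_congr_fun hKm fun x hx => abs_of_pos (hball (hsub' ht) x hx)

/-- The first variation of volume. -/
theorem IsVariation.exists_first_variation (hn : 1 ≤ n) (hp : IsIsometricImmersion g p) {ε : ℝ}
    {K : Set M} {G : ℝ → M → ℝ × M} (hG : IsVariation p ε K G) :
    ∃ δ > 0, ∃ σ : ℝ × M → ℝ,
      (∀ t ∈ Ioo (-δ) δ, ∀ x, σ (t, (G t x).2) = (G t x).1) ∧
      HasDerivAt (volumeFunction p K G)
        (∫ x in K, deriv (fun s => σ (s, x)) 0 * LinearMap.trace ℝ _ (shapeOperator p x)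
          ∂(volumeMeasure g.form)) 0 := by
  obtain ⟨δ, hδ, σ, hσ, hσG, hV⟩ := hG.exists_height hn hp
  have h0 : (0 : ℝ) ∈ Ioo (-δ) δ := ⟨by linarith, hδ⟩
  have hσ0 : ∀ x, σ (0, x) = 0 := fun x => by simpa [hG.initial] using hσG 0 h0 x
  refine ⟨δ, hδ, σ, hσG, ?_⟩
  have h1 := hasDerivAt_volumeFunction hn hp hG.isCompact hσ hV h0
  simpa only [deriv_det_height isOpen_Ioo h0 hσ hσ0] using h1

/-- The second variation of volume, when the shape operator is trace-free. -/
theorem IsVariation.second_variation (hn : 1 ≤ n) (hp : IsIsometricImmersion g p)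
    (htr : ∀ x, LinearMap.trace ℝ _ (shapeOperator p x) = 0) {ε : ℝ}
    {K : Set M} {G : ℝ → M → ℝ × M} (hG : IsVariation p ε K G) :
    (∀ᶠ t in 𝓝 0, DifferentiableAt ℝ (volumeFunction p K G) t) ∧
      DifferentiableAt ℝ (deriv (volumeFunction p K G)) 0 ∧
      deriv (deriv (volumeFunction p K G)) 0 ≤ 0 := by
  obtain ⟨δ, hδ, σ, hσ, hσG, hV⟩ := hG.exists_height hn hp
  have h0 : (0 : ℝ) ∈ Ioo (-δ) δ := ⟨by linarith, hδ⟩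
  have hσ0 : ∀ x, σ (0, x) = 0 := fun x => by simpa [hG.initial] using hσG 0 h0 x
  have := isLocallyFiniteMeasure_volumeMeasure (form_isBilinear g) (continuousOn_det_chartMatrix hp)
  have h1 := fun t ht => hasDerivAt_volumeFunction hn hp (t := t) hG.isCompact hσ hV ht
  have h2 : HasDerivAt (deriv (volumeFunction p K G))
      (∫ x in K, deriv (deriv fun s => LinearMap.det (1 + σ (s, x) • shapeOperator p x)) 0
        ∂(volumeMeasure g.form)) 0 := by
    refine (hasDerivAt_setIntegral (volumeMeasure g.form) hG.isCompact isOpen_Ioo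
      (contMDiffOn_deriv isOpen_Ioo (contMDiffOn_det_height hn hp hσ)) h0).congr_of_eventuallyEq ?_
    filter_upwards [isOpen_Ioo.mem_nhds h0] with s hs
    exact (h1 s hs).deriv
  refine ⟨?_, h2.differentiableAt, ?_⟩
  · filter_upwards [isOpen_Ioo.mem_nhds h0] with t ht
    exact (h1 t ht).differentiableAt
  · rw [h2.deriv]
    refine integral_nonpos fun x => ?_
    simp only [deriv_deriv_det_height isOpen_Ioo h0 hσ hσ0 (htr x), Pi.zero_apply]
    exact neg_nonpos.2 (mul_nonneg (sq_nonneg _) (trace_shapeOperator_mul_self_nonneg hn hp x))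

/-- If the first variation always vanishes, then the shape operator is trace-free: take the speed
to be its trace times a bump function. -/
theorem trace_shapeOperator_eq_zero (hn : 1 ≤ n) (hp : IsIsometricImmersion g p)
    (h : ∀ (ε : ℝ) (K : Set M) (G : ℝ → M → ℝ × M), IsVariation p ε K G →
      HasDerivAt (volumeFunction p K G) 0 0) (x : M) :
    LinearMap.trace ℝ _ (shapeOperator p x) = 0 := by
  by_contra hx
  have := isLocallyFiniteMeasure_volumeMeasure (form_isBilinear g) (continuousOn_det_chartMatrix hp)
  have := isOpenPosMeasure_volumeMeasure (form_isBilinear g) (continuousOn_det_chartMatrix hp)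
    (det_chartMatrix_pos hp)
  set τ : M → ℝ := fun x => LinearMap.trace ℝ _ (shapeOperator p x) with hτdef
  have hτ : ContMDiff (𝓡 n) 𝓘(ℝ, ℝ) ∞ τ := contMDiff_trace_shapeOperator hn hp
  obtain ⟨χ⟩ : Nonempty (SmoothBumpFunction (𝓡 n) x) := inferInstance
  have hχ : ContMDiff (𝓡 n) 𝓘(ℝ, ℝ) ∞ χ := χ.contMDiff
  set K := tsupport χ
  have hχK : ∀ y ∉ K, χ y = 0 := fun y hy => image_eq_zero_of_notMem_tsupport hy
  obtain ⟨ε, hvar⟩ := exists_isVariation hn hp (hχ.mul hτ) χ.hasCompactSupport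
    fun y hy => by simp [hχK y hy]
  obtain ⟨δ, hδ, σ, hσ, hd⟩ := hvar.exists_first_variation hn hp
  have h0 : (0 : ℝ) ∈ Ioo (-δ) δ := ⟨by linarith, hδ⟩
  have hσd : ∀ y, deriv (fun s => σ (s, y)) 0 = χ y * τ y := fun y => by
    have h1 : (fun s => σ (s, y)) =ᶠ[𝓝 0] fun s => s * (χ y * τ y) := by
      filter_upwards [isOpen_Ioo.mem_nhds h0] with s hs
      exact hσ s hs y
    rw [h1.deriv_eq, deriv_mul_const_field]
    simp
  have h1 := hd.unique (h ε K _ hvar)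
  simp only [hσd] at h1
  rw [setIntegral_eq_integral_of_forall_compl_eq_zero fun y hy => by simp [hχK y hy]] at h1
  have h2 : 0 < ∫ y, χ y * τ y * τ y ∂(volumeMeasure g.form) := by
    refine Continuous.integral_pos_of_hasCompactSupport_nonneg_nonzero (x := x)
      ((hχ.continuous.mul hτ.continuous).mul hτ.continuous) ?_ (fun y => ?_) ?_
    · exact χ.hasCompactSupport.mul_right.mul_right
    · simp only [Pi.zero_apply, mul_assoc]
      exact mul_nonneg χ.nonneg (mul_self_nonneg _)
    · simp only [χ.eq_one, one_mul]
      exact mul_ne_zero hx hx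
  exact h2.ne' h1

end Variation

end NullSpace

end

open NullSpace in
theorem mainTheorem1 (n : ℕ) (hn : 2 ≤ n) {M : Type*} [TopologicalSpace M] [T2Space M]
    [SecondCountableTopology M] [ChartedSpace (EuclideanSpace ℝ (Fin n)) M]
    [IsManifold (𝓡 n) ∞ M] [MeasurableSpace M] [BorelSpace M]
    (orientation : OrientedAtlas n M)
    (g : SmoothMetric n M) (hg : IsConformallyFlat g)
    (p : M → Minkowski n) (hp : IsIsometricImmersion g p) :
    -- `p` is an isometric embedding into its null-space
    (Manifold.IsSmoothEmbedding (𝓡 n) (𝓘(ℝ, ℝ).prod (𝓡 n)) ∞ (fun x : M => ((0 : ℝ), x)) ∧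
      (∀ x : M, ruledMap p (0, x) = p x) ∧
      inducedForm p (fun x : M => ((0 : ℝ), x)) = g.form) ∧
    -- (a) is equivalent to (b)
    ((∀ x : M, scalarCurvature g.form x = 0) ↔
      ∀ (ε : ℝ) (K : Set M) (G : ℝ → M → ℝ × M), IsVariation p ε K G →
        HasDerivAt (volumeFunction p K G) 0 0) ∧
    -- if (a) or (b) holds, the second variation exists and is nonpositive
    (((∀ x : M, scalarCurvature g.form x = 0) ∨
      ∀ (ε : ℝ) (K : Set M) (G : ℝ → M → ℝ × M), IsVariation p ε K G →
        HasDerivAt (volumeFunction p K G) 0 0) →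
      ∀ (ε : ℝ) (K : Set M) (G : ℝ → M → ℝ × M), IsVariation p ε K G →
        (∀ᶠ t in 𝓝 0, DifferentiableAt ℝ (volumeFunction p K G) t) ∧
        DifferentiableAt ℝ (deriv (volumeFunction p K G)) 0 ∧
        deriv (deriv (volumeFunction p K G)) 0 ≤ 0) := by
  have hn1 : 1 ≤ n := by omega
  have hS : (∀ x : M, scalarCurvature g.form x = 0) ↔
      ∀ x : M, LinearMap.trace ℝ _ (shapeOperator p x) = 0 := by
    have hn2 : (2 : ℝ) ≤ n := by exact_mod_cast hn
    have hc : 2 * ((n : ℝ) - 1) ≠ 0 := by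
      have : (0 : ℝ) < 2 * ((n : ℝ) - 1) := by linarith
      exact this.ne'
    simp only [scalarCurvature_eq hn1 hp, mul_eq_zero, hc, false_or]
  have hab : (∀ x : M, LinearMap.trace ℝ _ (shapeOperator p x) = 0) ↔
      ∀ (ε : ℝ) (K : Set M) (G : ℝ → M → ℝ × M), IsVariation p ε K G →
        HasDerivAt (volumeFunction p K G) 0 0 := by
    refine ⟨fun htr ε K G hG => ?_, trace_shapeOperator_eq_zero hn1 hp⟩
    obtain ⟨δ, -, σ, -, h⟩ := hG.exists_first_variation hn1 hp
    simpa [htr] using h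
  refine ⟨⟨isSmoothEmbedding_zero_prodMk, ruledMap_zero p, inducedForm_zero_prodMk hn1 hp⟩,
    hS.trans hab, fun h ε K G hG => ?_⟩
  exact hG.second_variation hn1 hp (h.elim hS.1 hab.2)
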